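/- Let $k\ge 1$ and write $[k]=\{1,\dots,k\}$. A noncrossing tree is a tree whose vertices $v_1,\dots,v_n$ are placed in this order on a circle and whose edges, drawn as line segments, do not intersect at interior points; its root is $v_1$. A $k$-noncrossing tree is a noncrossing tree whose vertices are labelled with labels in $[k]$ in such a way that whenever $v_i,v_j$ with $i<j$ are adjacent and the path from the root $v_1$ to $v_j$ contains $v_i$, the labels of $v_i$ and $v_j$ add up to at most $k+1$. Let $\ell_1,\dots,\ell_k\ge 0$ be integers, let $n=\ell_1+\ell_2+\cdots+\ell_k$, and assume $n>1$. Empty products are $1$ and empty sums are $0$. Then, for each $h\in[k]$, the number of $k$-noncrossing trees with root label $h$ and $\ell_i$ vertices labelled $i$ for every $i\in[k]$ (hence $n$ vertices in total) is \begin{align*} &\frac{2\ell_h}{(2n-1)(4n-3)} \prod_{r=1}^{\lceil k/2 \rceil} \binom{3n-2-\sum_{j=1}^{r-1} \ell_j - \sum_{j=k+2-r}^k \ell_j}{\ell_r} \\ &\qquad \prod_{r=1}^{h-1} \binom{n - 2 + \sum_{j=1}^{r} \ell_j + \sum_{j=k+1-r}^k \ell_j}{\ell_{k+1-r}} \prod_{r=h}^{\lfloor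 k/2 \rfloor} \binom{n - 1 + \sum_{j=1}^{r} \ell_j + \sum_{j=k+1-r}^k \ell_j}{\ell_{k+1-r}} \\ &\quad - \frac{\ell_h }{(4n-3)(3n-2-\sum_{j=1}^{h-1} \ell_j - \sum_{j=k+2-h}^k \ell_j)} \prod_{r=1}^{\lfloor k/2 \rfloor} \binom{n - 1 + \sum_{j=1}^{r} \ell_j + \sum_{j=k+1-r}^k \ell_j}{\ell_{k+1-r}} \\ &\qquad \prod_{r=1}^{h-1} \binom{3n-3-\sum_{j=1}^{r-1} \ell_j - \sum_{j=k+2-r}^k \ell_j}{\ell_r} \prod_{r=h}^{\lceil k/2 \rceil} \binom{3n-2-\sum_{j=1}^{r-1} \ell_j - \sum_{j=k+2-r}^k \ell_j}{\ell_r} \end{align*} if $h \leq \lceil k/2 \rceil$, and \begin{align*} &\frac{\ell_h}{(n-1)(4n-3)} \prod_{r=1}^{\lfloor k/2 \rfloor} \binom{n - 2 + \sum_{j=1}^{r} \ell_j + \sum_{j=k+1-r}^k \ell_j}{\ell_{k+1-r}} \\ &\qquad \prod_{r=1}^{k+1-h} \binom{3n-2-\sum_{j=1}^{r-1} \ell_j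 - \sum_{j=k+2-r}^k \ell_j}{\ell_r} \prod_{r=k+2-h}^{\lceil k/2 \rceil} \binom{3n-3-\sum_{j=1}^{r-1} \ell_j - \sum_{j=k+2-r}^k \ell_j}{\ell_r} \\ &\quad - \frac{\ell_h }{(4n-3)(n - 1 + \sum_{j=1}^{k+1-h} \ell_j + \sum_{j=h}^k \ell_j)} \prod_{r=1}^{\lceil k/2 \rceil} \binom{3n-3-\sum_{j=1}^{r-1} \ell_j - \sum_{j=k+2-r}^k \ell_j}{\ell_r} \\ &\qquad \prod_{r=1}^{k+1-h} \binom{n - 1 + \sum_{j=1}^{r} \ell_j + \sum_{j=k+1-r}^k \ell_j}{\ell_{k+1-r}} \prod_{r=k+2-h}^{\lfloor k/2 \rfloor} \binom{n - 2 + \sum_{j=1}^{r} \ell_j + \sum_{j=k+1-r}^k \ell_j}{\ell_{k+1-r}} \end{align*} if $h > \lceil k/2 \rceil$. Moreover, the total number of $k$-noncrossing trees with $\ell_i$ vertices labelled $i$ for every $i\in[k]$ is \begin{multline*} \frac{1}{n-1} \prod_{r=1}^{\lceil k/2 \rceil} \binom{3n-3-\sum_{j=1}^{r-1} \ell_j -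 \sum_{j=k+2-r}^k \ell_j}{\ell_r} \prod_{r=1}^{\lfloor k/2 \rfloor} \binom{n - 2 + \sum_{j=1}^{r} \ell_j + \sum_{j=k+1-r}^k \ell_j}{\ell_{k+1-r}} \\ - \frac{1}{2n-1} \prod_{r=1}^{\lceil k/2 \rceil} \binom{3n-2-\sum_{j=1}^{r-1} \ell_j - \sum_{j=k+2-r}^k \ell_j}{\ell_r} \prod_{r=1}^{\lfloor k/2 \rfloor} \binom{n - 1 + \sum_{j=1}^{r} \ell_j + \sum_{j=k+1-r}^k \ell_j}{\ell_{k+1-r}}. \end{multline*} -/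

import Mathlib

/-- A graph on the vertices `v₁, …, vₙ` (here `0, …, n - 1`), placed in this order on a circle, is
noncrossing if no two edges, drawn as chords, meet at a point interior to both: two chords
`{a, b}` and `{c, d}` cross exactly if their endpoints alternate, `a < c < b < d`, up to naming. -/
def IsNoncrossing {n : ℕ} (G : SimpleGraph (Fin n)) : Prop :=
  ∀ a b c d : Fin n, a < c → c < b → b < d → ¬ (G.Adj a b ∧ G.Adj c d)

/-- A `k`-noncrossing tree with `n` vertices. The root is the vertex `0`. The labels of two
adjacent vertices `i < j` must not add up to more than `k + 1` if `i` lies on the path from the root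
to `j`. -/
@[ext]
structure KNoncrossingTree (k n : ℕ) [NeZero n] where
  graph : SimpleGraph (Fin n)
  isTree : graph.IsTree
  noncrossing : IsNoncrossing graph
  label : Fin n → ℕ
  label_mem : ∀ v, label v ∈ Finset.Icc 1 k
  label_add_le : ∀ i j : Fin n, i < j → graph.Adj i j →
    (∃ p : graph.Walk 0 j, p.IsPath ∧ i ∈ p.support) → label i + label j ≤ k + 1

/-- There are only finitely many `k`-noncrossing trees with `n` vertices, so that `Set.ncard`
counts sets of such trees. -/
instance KNoncrossingTree.instFinite (k n : ℕ) [NeZero n] : Finite (KNoncrossingTree k n) := by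
  refine Finite.of_injective (β := SimpleGraph (Fin n) × (Fin n → Finset.Icc 1 k))
    (fun T => (T.graph, fun v => ⟨T.label v, T.label_mem v⟩)) ?_
  intro S T h
  simp only [Prod.mk.injEq] at h
  refine KNoncrossingTree.ext h.1 (funext fun v => ?_)
  exact congrArg Subtype.val (congrFun h.2 v)

/-- `T` has exactly `ℓ i` vertices labelled `i`, for every `i ∈ [k]`. -/
def KNoncrossingTree.HasLabelCounts {k n : ℕ} [NeZero n] (T : KNoncrossingTree k n)
    (ℓ : ℕ → ℕ) : Prop :=
  ∀ i ∈ Finset.Icc 1 k, {v : Fin n | T.label v = i}.ncard = ℓ i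

/-- The sum `∑_{j=1}^{a} ℓ_j + ∑_{j=k+1-a}^{k} ℓ_j` of the first `a` and the last `a` of the
numbers `ℓ_1, …, ℓ_k` (used for `2 * a ≤ k` only). -/
def outerSum (k : ℕ) (ℓ : ℕ → ℕ) (a : ℕ) : ℕ :=
  ∑ j ∈ Finset.Icc 1 a, ℓ j + ∑ j ∈ Finset.Icc (k + 1 - a) k, ℓ j

/-!
The trees are counted by generating functions: a tree with `n` vertices and `ℓ i` vertices labelled
`i` contributes `X ^ n * ∏ x_i ^ (ℓ i)`.

**Functional equations.** Consider noncrossing trees on an interval of integers with the root at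
the left end, and let `d` be the largest neighbour of the root. No edge passes over `d`. Without the
edge from the root to `d`, the vertices up to `d` that are still connected to the root form an
initial interval. Hence the tree is composed of three trees on consecutive intervals: one with the
same root, one with the root `d` at its right end and one with the root `d` at its left end
(`IsIntervalTree.exists_eq_glue`). Reflection gives the decomposition of a tree with the root at the
right end. The condition on the labels restricts only the edges to a larger child. Let `F h` count
the trees with the root at the left end and with label `h`, and let `L` count those with the root
at the right end, where the root does not contribute to the monomial in either case. Then
`L = 1 + L * ∑_{d ≤ k} X x_d L F_d` and `F_h = 1 + F_h * ∑_{d ≤ k + 1 - h} X x_d L F_d`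
(`isTreeSystem_wordSeries`), and the trees with root label `h` have the generating function
`X x_h F_h`.

**Explicit solution.** Take the labels in the order `1, k, 2, k - 1, 3, …`, let `q_i` be
`1 + X (-x_1 + x_k - x_2 + ⋯)` with the first `i` of the variables, and let `P_i` be the alternating
product `q_1 q_2⁻¹ q_3 ⋯ q_i ^ ±1`. Then `1 - ∑_{d ≤ m} X x_d P_{2d-2}` telescopes to `P_{2m-1}`,
and the symmetry `q_{2k-i} = q_i` gives `P_i P_{2k-1-i} = P_{2k-1}`. Put `s = P_{2k-1}`. These
identities say that `1 / s` and `P_{2h-2} / s` solve the system in which `X s ^ 2` marks a vertex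
instead of `X`; as the solution is unique, they are the images of `L` and `F_h` under the substitution
`X ↦ X s ^ 2` (`IsTreeSystem.unique`, `isTreeSystem_altProd`).

**Coefficients.** Lagrange inversion (`coeff_eq_coeff_substXMul`) expresses the coefficients of a
series by those of its image under this substitution. For the number of all trees, the generating
function is `g - g ^ 2` with `g = 1 / L`, whose image is `s`, so powers of `s` suffice. For a fixed
root label, the logarithmic derivative of `s` that enters Lagrange inversion is eliminated by means
of the Euler operator `X d/dX` and the partial derivative by the variable of the root label, whose
effect on coefficients is known (`IsTreeSystem.monoCoeff_eq`). What remains are coefficients of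
products of powers of the `q_i`. Only the last of these factors contains the last variable; once it
is extracted, the factor turns into a power of the factor before it. So the coefficients are
products of binomial coefficients (`monoCoeff_prod_altUnit_zpow`), which are then rewritten in terms
of `outerSum`.
-/

namespace KNoncrossing

/-! ### Noncrossing trees on intervals of integers -/

/-- The graph `G` is a noncrossing tree on the integers in `[a, b]`, with root `r`, such that
`ok x y` holds for each vertex `y` with parent `x`. The integers outside `[a, b]` are isolated.
An adjacent vertex `x` is the parent of `y` if `x` can still be reached from the root when the edge
between them is deleted; `G` is acyclic if all edges are bridges. -/
structure IsIntervalTree (ok : ℤ → ℤ → Prop) (r a b : ℤ) (G : SimpleGraph ℤ) : Prop where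
  mem : ∀ x y, G.Adj x y → a ≤ x ∧ x ≤ b
  reach : ∀ x, a ≤ x → x ≤ b → G.Reachable r x
  bridge : ∀ x y, G.Adj x y → ¬(G.deleteEdges {s(x, y)}).Reachable x y
  noncrossing : ∀ x y z w, x < z → z < y → y < w → G.Adj x y → ¬G.Adj z w
  parent : ∀ x y, G.Adj x y → (G.deleteEdges {s(x, y)}).Reachable r x → ok x y

section Reachable

variable {V W : Type*} {G G' : SimpleGraph V}

/-- A map that sends each edge to an edge or to a single vertex preserves reachability. -/
theorem reachable_of_adj_imp {H : SimpleGraph W} (φ : V → W)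
    (hφ : ∀ x y, G.Adj x y → φ x = φ y ∨ H.Adj (φ x) (φ y)) {u v : V} (h : G.Reachable u v) :
    H.Reachable (φ u) (φ v) := by
  obtain ⟨p⟩ := h
  induction p with
  | nil => exact SimpleGraph.Reachable.refl _
  | cons hadj _ ih =>
    rcases hφ _ _ hadj with h | h
    · rw [h]; exact ih
    · exact h.reachable.trans ih

/-- A retraction of `G` onto `G'`, which sends each edge outside of `G'` to a single vertex,
preserves reachability also after the deletion of an edge. -/
theorem reachable_deleteEdges_of_retraction (φ : V → V)
    (hφ : ∀ x y, G.Adj x y → φ x = φ y ∨ φ x = x ∧ φ y = y ∧ G'.Adj x y)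
    (s : Set (Sym2 V)) {u v : V} (h : (G.deleteEdges s).Reachable u v) :
    (G'.deleteEdges s).Reachable (φ u) (φ v) := by
  refine reachable_of_adj_imp φ (fun x y hxy => ?_) h
  rw [SimpleGraph.deleteEdges_adj] at hxy
  rcases hφ x y hxy.1 with h | ⟨h1, h2, h3⟩
  · exact Or.inl h
  · right
    rw [h1, h2, SimpleGraph.deleteEdges_adj]
    exact ⟨h3, hxy.2⟩

theorem exists_adj_of_reachable {u v : V} (h : G.Reachable u v) (P : V → Prop) (hu : P u)
    (hv : ¬P v) : ∃ x y, G.Reachable u x ∧ G.Adj x y ∧ P x ∧ ¬P y := by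
  obtain ⟨p⟩ := h
  induction p with
  | nil => exact absurd hu hv
  | @cons a b c hadj q ih =>
    by_cases hb : P b
    · obtain ⟨x, y, h1, h2⟩ := ih hb hv
      exact ⟨x, y, hadj.reachable.trans h1, h2⟩
    · exact ⟨a, b, SimpleGraph.Reachable.refl _, hadj, hu, hb⟩

theorem reachable_deleteEdges_mono (h : G ≤ G') (s : Set (Sym2 V)) {u v : V}
    (hr : (G.deleteEdges s).Reachable u v) : (G'.deleteEdges s).Reachable u v :=
  hr.mono fun x y hxy => by
    rw [SimpleGraph.deleteEdges_adj] at hxy ⊢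
    exact ⟨h hxy.1, hxy.2⟩

end Reachable

/-- Three graphs together with the edge between `a` and `d`. In the decomposition of a tree on
`[a, b]` with root `a`, these are trees on `[a, c]`, `[c + 1, d]` and `[d, b]`. -/
def glue (a d : ℤ) (G₁ G₂ G₃ : SimpleGraph ℤ) : SimpleGraph ℤ :=
  G₁ ⊔ G₂ ⊔ G₃ ⊔ SimpleGraph.edge a d

theorem glue_adj {a d : ℤ} (had : a < d) {G₁ G₂ G₃ : SimpleGraph ℤ} {x y : ℤ} :
    (glue a d G₁ G₂ G₃).Adj x y ↔
      G₁.Adj x y ∨ G₂.Adj x y ∨ G₃.Adj x y ∨ x = a ∧ y = d ∨ x = d ∧ y = a := by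
  simp only [glue, SimpleGraph.sup_adj, SimpleGraph.edge_adj, or_assoc]
  have : ∀ x y : ℤ, (x = a ∧ y = d ∨ x = d ∧ y = a) ∧ x ≠ y ↔ (x = a ∧ y = d ∨ x = d ∧ y = a) := by
    intro x y
    constructor
    · exact fun h => h.1
    · intro h; refine ⟨h, ?_⟩; omega
  simp only [Ne, eq_comm, and_comm] at this ⊢
  grind

section Glue

variable {ok : ℤ → ℤ → Prop} {a b c d : ℤ} {G₁ G₂ G₃ : SimpleGraph ℤ}

/-- The edges of the three graphs lie in the intervals `[a, c]`, `[c + 1, d]` and `[d, b]`. -/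
structure InIntervals (a b c d : ℤ) (G₁ G₂ G₃ : SimpleGraph ℤ) : Prop where
  hac : a ≤ c
  hcd : c < d
  hdb : d ≤ b
  mem₁ : ∀ x y, G₁.Adj x y → a ≤ x ∧ x ≤ c
  mem₂ : ∀ x y, G₂.Adj x y → c + 1 ≤ x ∧ x ≤ d
  mem₃ : ∀ x y, G₃.Adj x y → d ≤ x ∧ x ≤ b

namespace InIntervals

theorem had (h : InIntervals a b c d G₁ G₂ G₃) : a < d := h.hac.trans_lt h.hcd

theorem le₁ (h : InIntervals a b c d G₁ G₂ G₃) : G₁ ≤ glue a d G₁ G₂ G₃ := fun _ _ hxy =>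
  (glue_adj h.had).mpr (Or.inl hxy)

theorem le₂ (h : InIntervals a b c d G₁ G₂ G₃) : G₂ ≤ glue a d G₁ G₂ G₃ := fun _ _ hxy =>
  (glue_adj h.had).mpr (Or.inr (Or.inl hxy))

theorem le₃ (h : InIntervals a b c d G₁ G₂ G₃) : G₃ ≤ glue a d G₁ G₂ G₃ := fun _ _ hxy =>
  (glue_adj h.had).mpr (Or.inr (Or.inr (Or.inl hxy)))

theorem adj (h : InIntervals a b c d G₁ G₂ G₃) : (glue a d G₁ G₂ G₃).Adj a d :=
  (glue_adj h.had).mpr (by simp)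

/-- Each edge lies in one of the three intervals, or is the edge between `a` and `d`. -/
theorem cases (h : InIntervals a b c d G₁ G₂ G₃) {x y : ℤ} (hxy : (glue a d G₁ G₂ G₃).Adj x y) :
    (G₁.Adj x y ∧ a ≤ x ∧ x ≤ c ∧ a ≤ y ∧ y ≤ c) ∨
    (G₂.Adj x y ∧ c + 1 ≤ x ∧ x ≤ d ∧ c + 1 ≤ y ∧ y ≤ d) ∨
    (G₃.Adj x y ∧ d ≤ x ∧ x ≤ b ∧ d ≤ y ∧ y ≤ b) ∨ x = a ∧ y = d ∨ x = d ∧ y = a := by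
  rcases (glue_adj h.had).mp hxy with h' | h' | h' | h'
  · have h1 := h.mem₁ _ _ h'
    have h2 := h.mem₁ _ _ h'.symm
    exact Or.inl ⟨h', h1.1, h1.2, h2.1, h2.2⟩
  · have h1 := h.mem₂ _ _ h'
    have h2 := h.mem₂ _ _ h'.symm
    exact Or.inr (Or.inl ⟨h', h1.1, h1.2, h2.1, h2.2⟩)
  · have h1 := h.mem₃ _ _ h'
    have h2 := h.mem₃ _ _ h'.symm
    exact Or.inr (Or.inr (Or.inl ⟨h', h1.1, h1.2, h2.1, h2.2⟩))
  · exact Or.inr (Or.inr (Or.inr h'))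

/-- The map that contracts everything to the right of `c` to `a` is a retraction onto `G₁`. -/
theorem retraction₁ (h : InIntervals a b c d G₁ G₂ G₃) (x y : ℤ)
    (hxy : (glue a d G₁ G₂ G₃).Adj x y) :
    (if x ≤ c then x else a) = (if y ≤ c then y else a) ∨
      (if x ≤ c then x else a) = x ∧ (if y ≤ c then y else a) = y ∧ G₁.Adj x y := by
  have := h.hac
  have := h.hcd
  rcases h.cases hxy with ⟨h', h''⟩ | ⟨h', h''⟩ | ⟨h', h''⟩ | h'' | h''
  · right; rw [if_pos (by omega), if_pos (by omega)]; exact ⟨rfl, rfl, h'⟩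
  all_goals left; split_ifs <;> omega

/-- The map that contracts everything outside of `[c + 1, d]` to `d` is a retraction onto `G₂`. -/
theorem retraction₂ (h : InIntervals a b c d G₁ G₂ G₃) (x y : ℤ)
    (hxy : (glue a d G₁ G₂ G₃).Adj x y) :
    (if c < x ∧ x ≤ d then x else d) = (if c < y ∧ y ≤ d then y else d) ∨
      (if c < x ∧ x ≤ d then x else d) = x ∧ (if c < y ∧ y ≤ d then y else d) = y ∧
        G₂.Adj x y := by
  have := h.hac
  have := h.hcd
  rcases h.cases hxy with ⟨h', h''⟩ | ⟨h', h''⟩ | ⟨h', h''⟩ | h'' | h''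
  · left; split_ifs <;> omega
  · right; rw [if_pos (by omega), if_pos (by omega)]; exact ⟨rfl, rfl, h'⟩
  all_goals left; split_ifs <;> omega

/-- The map that contracts everything to the left of `d` to `d` is a retraction onto `G₃`. -/
theorem retraction₃ (h : InIntervals a b c d G₁ G₂ G₃) (x y : ℤ)
    (hxy : (glue a d G₁ G₂ G₃).Adj x y) :
    (if d ≤ x then x else d) = (if d ≤ y then y else d) ∨
      (if d ≤ x then x else d) = x ∧ (if d ≤ y then y else d) = y ∧ G₃.Adj x y := by
  have := h.hac
  have := h.hcd
  rcases h.cases hxy with ⟨h', h''⟩ | ⟨h', h''⟩ | ⟨h', h''⟩ | h'' | h''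
  · left; split_ifs <;> omega
  · left; split_ifs <;> omega
  · right; rw [if_pos (by omega), if_pos (by omega)]; exact ⟨rfl, rfl, h'⟩
  all_goals left; split_ifs <;> omega

/-- The edge between `a` and `d` is a bridge of the glued graph. -/
theorem bridge (h : InIntervals a b c d G₁ G₂ G₃) :
    ¬((glue a d G₁ G₂ G₃).deleteEdges {s(a, d)}).Reachable a d := by
  intro hr
  have hac := h.hac
  have hcd := h.hcd
  have := reachable_of_adj_imp (H := (⊥ : SimpleGraph ℤ)) (fun x => if x ≤ c then a else d)
    (fun x y hxy => ?_) hr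
  · rw [if_pos hac, if_neg (by omega), SimpleGraph.reachable_bot] at this
    omega
  · rw [SimpleGraph.deleteEdges_adj] at hxy
    left
    have hne : ¬(x = a ∧ y = d) ∧ ¬(x = d ∧ y = a) := by
      have := hxy.2
      simp only [Set.mem_singleton_iff, Sym2.eq_iff, not_or] at this
      exact this
    rcases h.cases hxy.1 with ⟨h', h''⟩ | ⟨h', h''⟩ | ⟨h', h''⟩ | h'' | h''
    · split_ifs <;> omega
    · split_ifs <;> omega
    · split_ifs <;> omega
    · exact absurd h'' hne.1
    · exact absurd h'' hne.2

theorem isIntervalTree_glue (h : InIntervals a b c d G₁ G₂ G₃) (had : ok a d)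
    (h₁ : IsIntervalTree ok a a c G₁) (h₂ : IsIntervalTree ok d (c + 1) d G₂)
    (h₃ : IsIntervalTree ok d d b G₃) : IsIntervalTree ok a a b (glue a d G₁ G₂ G₃) := by
  have hac := h.hac
  have hcd := h.hcd
  have hdb := h.hdb
  constructor
  · intro x y hxy
    rcases h.cases hxy with ⟨h', h''⟩ | ⟨h', h''⟩ | ⟨h', h''⟩ | h'' | h'' <;> omega
  · intro x hax hxb
    by_cases hxc : x ≤ c
    · exact (h₁.reach x hax hxc).mono h.le₁
    · refine h.adj.reachable.trans ?_
      by_cases hxd : x ≤ d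
      · exact (h₂.reach x (by omega) hxd).mono h.le₂
      · exact (h₃.reach x (by omega) hxb).mono h.le₃
  · intro x y hxy hr
    rcases h.cases hxy with ⟨h', h''⟩ | ⟨h', h''⟩ | ⟨h', h''⟩ | ⟨rfl, rfl⟩ | ⟨rfl, rfl⟩
    · have := reachable_deleteEdges_of_retraction _ h.retraction₁ _ hr
      rw [if_pos (by omega), if_pos (by omega)] at this
      exact h₁.bridge _ _ h' this
    · have := reachable_deleteEdges_of_retraction _ h.retraction₂ _ hr
      rw [if_pos (by omega), if_pos (by omega)] at this
      exact h₂.bridge _ _ h' this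
    · have := reachable_deleteEdges_of_retraction _ h.retraction₃ _ hr
      rw [if_pos (by omega), if_pos (by omega)] at this
      exact h₃.bridge _ _ h' this
    · exact h.bridge hr
    · rw [Sym2.eq_swap] at hr
      exact h.bridge hr.symm
  · intro x y z w hxz hzy hyw hxy hzw
    rcases h.cases hxy with ⟨h', h''⟩ | ⟨h', h''⟩ | ⟨h', h''⟩ | h'' | h'' <;>
    rcases h.cases hzw with ⟨g', g''⟩ | ⟨g', g''⟩ | ⟨g', g''⟩ | g'' | g'' <;>
    first
    | omega
    | exact h₁.noncrossing x y z w hxz hzy hyw h' g'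
    | exact h₂.noncrossing x y z w hxz hzy hyw h' g'
    | exact h₃.noncrossing x y z w hxz hzy hyw h' g'
  · intro x y hxy hr
    rcases h.cases hxy with ⟨h', h''⟩ | ⟨h', h''⟩ | ⟨h', h''⟩ | ⟨rfl, rfl⟩ | ⟨rfl, rfl⟩
    · have := reachable_deleteEdges_of_retraction _ h.retraction₁ _ hr
      rw [if_pos (by omega), if_pos (by omega)] at this
      exact h₁.parent _ _ h' this
    · have := reachable_deleteEdges_of_retraction _ h.retraction₂ _ hr
      rw [if_neg (by omega), if_pos (by omega)] at this
      exact h₂.parent _ _ h' this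
    · have := reachable_deleteEdges_of_retraction _ h.retraction₃ _ hr
      rw [if_neg (by omega), if_pos (by omega)] at this
      exact h₃.parent _ _ h' this
    · exact had
    · rw [Sym2.eq_swap] at hr
      exact absurd hr h.bridge

/-- The edge between `a` and `d` survives the deletion of an edge on the right of `a`. -/
theorem reachable_deleteEdges (h : InIntervals a b c d G₁ G₂ G₃) {x y : ℤ} (hx : a < x)
    (hy : a < y) : ((glue a d G₁ G₂ G₃).deleteEdges {s(x, y)}).Reachable a d := by
  refine SimpleGraph.Adj.reachable ?_
  rw [SimpleGraph.deleteEdges_adj]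
  refine ⟨h.adj, ?_⟩
  simp only [Set.mem_singleton_iff, Sym2.eq_iff]
  omega

theorem of_isIntervalTree_glue (h : InIntervals a b c d G₁ G₂ G₃)
    (hG : IsIntervalTree ok a a b (glue a d G₁ G₂ G₃)) :
    ok a d ∧ IsIntervalTree ok a a c G₁ ∧ IsIntervalTree ok d (c + 1) d G₂ ∧
      IsIntervalTree ok d d b G₃ := by
  have hac := h.hac
  have hcd := h.hcd
  have hdb := h.hdb
  refine ⟨hG.parent _ _ h.adj (SimpleGraph.Reachable.refl _), ⟨h.mem₁, ?_, ?_, ?_, ?_⟩,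
    ⟨h.mem₂, ?_, ?_, ?_, ?_⟩, ⟨h.mem₃, ?_, ?_, ?_, ?_⟩⟩
  · intro x hx hx'
    have := reachable_deleteEdges_of_retraction _ h.retraction₁ ∅
      ((hG.reach x hx (by omega)).mono (by simp))
    rw [if_pos hac, if_pos hx'] at this
    exact this.mono (by simp)
  · exact fun x y hxy hr => hG.bridge x y (h.le₁ hxy) (reachable_deleteEdges_mono h.le₁ _ hr)
  · exact fun x y z w h1 h2 h3 h4 h5 => hG.noncrossing x y z w h1 h2 h3 (h.le₁ h4) (h.le₁ h5)
  · exact fun x y hxy hr => hG.parent x y (h.le₁ hxy) (reachable_deleteEdges_mono h.le₁ _ hr)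
  · intro x hx hx'
    have := reachable_deleteEdges_of_retraction _ h.retraction₂ ∅
      ((hG.reach x (by omega) (by omega)).mono (by simp))
    rw [if_neg (by omega), if_pos (by omega)] at this
    exact this.mono (by simp)
  · exact fun x y hxy hr => hG.bridge x y (h.le₂ hxy) (reachable_deleteEdges_mono h.le₂ _ hr)
  · exact fun x y z w h1 h2 h3 h4 h5 => hG.noncrossing x y z w h1 h2 h3 (h.le₂ h4) (h.le₂ h5)
  · intro x y hxy hr
    have h1 := h.mem₂ _ _ hxy
    have h2 := h.mem₂ _ _ hxy.symm
    exact hG.parent x y (h.le₂ hxy) ((h.reachable_deleteEdges (by omega) (by omega)).trans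
      (reachable_deleteEdges_mono h.le₂ _ hr))
  · intro x hx hx'
    have := reachable_deleteEdges_of_retraction _ h.retraction₃ ∅
      ((hG.reach x (by omega) hx').mono (by simp))
    rw [if_neg (by omega), if_pos hx] at this
    exact this.mono (by simp)
  · exact fun x y hxy hr => hG.bridge x y (h.le₃ hxy) (reachable_deleteEdges_mono h.le₃ _ hr)
  · exact fun x y z w h1 h2 h3 h4 h5 => hG.noncrossing x y z w h1 h2 h3 (h.le₃ h4) (h.le₃ h5)
  · intro x y hxy hr
    have h1 := h.mem₃ _ _ hxy
    have h2 := h.mem₃ _ _ hxy.symm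
    exact hG.parent x y (h.le₃ hxy) ((h.reachable_deleteEdges (by omega) (by omega)).trans
      (reachable_deleteEdges_mono h.le₃ _ hr))

end InIntervals

end Glue

/-- The edges of `G` with both ends in `[a, b]`. -/
def restrictTo (G : SimpleGraph ℤ) (a b : ℤ) : SimpleGraph ℤ where
  Adj x y := G.Adj x y ∧ a ≤ x ∧ x ≤ b ∧ a ≤ y ∧ y ≤ b
  symm := ⟨fun _ _ h => ⟨h.1.symm, h.2.2.2.1, h.2.2.2.2, h.2.1, h.2.2.1⟩⟩
  loopless := ⟨fun _ h => h.1.ne rfl⟩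

/-- A noncrossing tree on `[a, b]` with root `a` decomposes: let `d` be the largest neighbour of the
root. No edge passes over `d`. After the deletion of the edge between `a` and `d`, the vertices
of `[a, d]` that are still connected to `a` form an initial interval `[a, c]`. -/
theorem IsIntervalTree.exists_eq_glue {ok : ℤ → ℤ → Prop} {a b : ℤ} {G : SimpleGraph ℤ}
    (hG : IsIntervalTree ok a a b G) (hab : a < b) :
    ∃ c d G₁ G₂ G₃, InIntervals a b c d G₁ G₂ G₃ ∧ G = glue a d G₁ G₂ G₃ := by
  obtain ⟨d, had, hmax⟩ : ∃ d, G.Adj a d ∧ ∀ z, G.Adj a z → z ≤ d := by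
    refine Int.exists_greatest_of_bdd ⟨b, fun z hz => (hG.mem _ _ hz.symm).2⟩ ?_
    obtain ⟨x, y, _, hxy, hx, _⟩ := exists_adj_of_reachable (hG.reach b hab.le le_rfl) (· = a) rfl
      (by omega)
    exact ⟨y, hx ▸ hxy⟩
  have had' : a < d := lt_of_le_of_ne (hG.mem _ _ had.symm).1 had.ne
  have hdb : d ≤ b := (hG.mem _ _ had.symm).2
  have hstr : ∀ x y, G.Adj x y → x < d → y ≤ d := by
    intro x y hxy hxd
    by_contra hy
    rcases (hG.mem _ _ hxy).1.eq_or_lt with rfl | hax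
    · exact hy (hmax _ hxy)
    · exact hG.noncrossing a d x y hax hxd (by omega) had hxy
  set G' := G.deleteEdges {s(a, d)} with hG'
  have hadj' : ∀ x y, G'.Adj x y → G.Adj x y := fun x y h => (SimpleGraph.deleteEdges_adj.mp h).1
  have hbr : ∀ v, G'.Reachable a v → ¬G'.Reachable d v := fun v h1 h2 =>
    hG.bridge a d had (h1.trans h2.symm)
  have hor : ∀ v, G.Reachable a v → G'.Reachable a v ∨ G'.Reachable d v := by
    intro v hv
    by_contra hcon
    obtain ⟨x, y, _, hxy, hx, hy⟩ := exists_adj_of_reachable hv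
      (fun v => G'.Reachable a v ∨ G'.Reachable d v) (Or.inl (SimpleGraph.Reachable.refl _)) hcon
    apply hy
    by_cases he : s(x, y) = s(a, d)
    · rcases Sym2.eq_iff.mp he with ⟨_, rfl⟩ | ⟨_, rfl⟩
      · exact Or.inr (SimpleGraph.Reachable.refl _)
      · exact Or.inl (SimpleGraph.Reachable.refl _)
    · have hxy' : G'.Adj x y := SimpleGraph.deleteEdges_adj.mpr ⟨hxy, he⟩
      exact hx.imp (fun h => h.trans hxy'.reachable) (fun h => h.trans hxy'.reachable)
  obtain ⟨c, ⟨hcd, hc⟩, hcmax⟩ : ∃ c, (c < d ∧ G'.Reachable a c) ∧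
      ∀ z, z < d ∧ G'.Reachable a z → z ≤ c :=
    Int.exists_greatest_of_bdd ⟨d, fun z hz => hz.1.le⟩
      ⟨a, had', SimpleGraph.Reachable.refl _⟩
  have hac : a ≤ c := hcmax a ⟨had', SimpleGraph.Reachable.refl _⟩
  -- An edge of the component of `a` that passes over `v` separates `v` from `d`.
  have hleft : ∀ v, a ≤ v → v ≤ c → G'.Reachable a v := by
    intro v hav hvc
    by_contra hv
    have hdv := (hor v (hG.reach v hav (by omega))).resolve_left hv
    obtain ⟨p, q, hap, hpq, hp, hq⟩ := exists_adj_of_reachable hc (· < v)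
      (lt_of_le_of_ne hav fun h => hv (h ▸ SimpleGraph.Reachable.refl _)) (by omega)
    have haq := hap.trans hpq.reachable
    have hvq : v < q := lt_of_le_of_ne (not_lt.mp hq) fun h => hv (h ▸ haq)
    have hqd : q < d := lt_of_le_of_ne (hstr _ _ (hadj' _ _ hpq) (by omega))
      fun h => hbr q haq (h ▸ SimpleGraph.Reachable.refl _)
    obtain ⟨u, w, hu, huw, ⟨hpu, huq⟩, hw⟩ := exists_adj_of_reachable hdv.symm
      (fun x => p < x ∧ x < q) ⟨hp, hvq⟩ (by omega)
    have hdw := (hdv.trans hu).trans huw.reachable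
    have hwp : w ≠ p := fun h => hbr p hap (h ▸ hdw)
    have hwq : w ≠ q := fun h => hbr q haq (h ▸ hdw)
    rcases lt_or_ge w p with h | h
    · exact hG.noncrossing w u p q h hpu huq (hadj' _ _ huw.symm) (hadj' _ _ hpq)
    · exact hG.noncrossing p q u w hpu huq (by omega) (hadj' _ _ hpq) (hadj' _ _ huw)
  have hright : ∀ v, c < v → v ≤ d → G'.Reachable d v := by
    intro v hcv hvd
    rcases hvd.eq_or_lt with rfl | hvd
    · exact SimpleGraph.Reachable.refl _
    · refine (hor v (hG.reach v (by omega) (by omega))).resolve_left fun h => ?_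
      have := hcmax v ⟨hvd, h⟩
      omega
  have hcut : ∀ x y, G'.Adj x y → x ≤ c → y ≤ c := by
    intro x y hxy hxc
    by_contra hyc
    have hx := hG.mem _ _ (hadj' _ _ hxy)
    exact hbr y ((hleft x hx.1 hxc).trans hxy.reachable)
      (hright y (by omega) (hstr _ _ (hadj' _ _ hxy) (by omega)))
  refine ⟨c, d, restrictTo G a c, restrictTo G (c + 1) d, restrictTo G d b,
    ⟨hac, hcd, hdb, fun x y h => ⟨h.2.1, h.2.2.1⟩, fun x y h => ⟨h.2.1, h.2.2.1⟩,
      fun x y h => ⟨h.2.1, h.2.2.1⟩⟩, ?_⟩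
  ext x y
  rw [glue_adj had']
  constructor
  · intro hxy
    have h1 := hG.mem _ _ hxy
    have h2 := hG.mem _ _ hxy.symm
    by_cases he : s(x, y) = s(a, d)
    · exact Or.inr (Or.inr (Or.inr (Sym2.eq_iff.mp he)))
    · have hxy' : G'.Adj x y := SimpleGraph.deleteEdges_adj.mpr ⟨hxy, he⟩
      have h3 := hcut _ _ hxy'
      have h4 := hcut _ _ hxy'.symm
      have h5 := hstr _ _ hxy
      have h6 := hstr _ _ hxy.symm
      by_cases hxc : x ≤ c
      · exact Or.inl ⟨hxy, by omega, by omega, by omega, by omega⟩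
      · by_cases hxd : x < d ∨ y < d
        · exact Or.inr (Or.inl ⟨hxy, by omega, by omega, by omega, by omega⟩)
        · exact Or.inr (Or.inr (Or.inl ⟨hxy, by omega, by omega, by omega, by omega⟩))
  · rintro (h | h | h | ⟨rfl, rfl⟩ | ⟨rfl, rfl⟩)
    · exact h.1
    · exact h.1
    · exact h.1
    · exact had
    · exact had.symm

/-- The pieces of the decomposition are determined by the tree. -/
theorem glue_injective {ok : ℤ → ℤ → Prop} {a b c d c' d' : ℤ}
    {G₁ G₂ G₃ G₁' G₂' G₃' : SimpleGraph ℤ}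
    (h : InIntervals a b c d G₁ G₂ G₃) (h' : InIntervals a b c' d' G₁' G₂' G₃')
    (ht : IsIntervalTree ok a a c G₁) (ht' : IsIntervalTree ok a a c' G₁')
    (he : glue a d G₁ G₂ G₃ = glue a d' G₁' G₂' G₃') :
    c = c' ∧ d = d' ∧ G₁ = G₁' ∧ G₂ = G₂' ∧ G₃ = G₃' := by
  have hd : ∀ {b c d c' d' : ℤ} {G₁ G₂ G₃ G₁' G₂' G₃' : SimpleGraph ℤ},
      InIntervals a b c d G₁ G₂ G₃ → InIntervals a b c' d' G₁' G₂' G₃' →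
      glue a d G₁ G₂ G₃ = glue a d' G₁' G₂' G₃' → d ≤ d' := by
    intro b c d c' d' G₁ G₂ G₃ G₁' G₂' G₃' h h' he
    have hadj := h.adj
    rw [he] at hadj
    have := h.hac
    have := h.hcd
    have := h'.hac
    have := h'.hcd
    rcases h'.cases hadj with ⟨_, h''⟩ | ⟨_, h''⟩ | ⟨_, h''⟩ | h'' | h'' <;> omega
  have hdd : d = d' := le_antisymm (hd h h' he) (hd h' h he.symm)
  subst hdd
  have hc : ∀ {c c' : ℤ} {G₁ G₂ G₃ G₁' G₂' G₃' : SimpleGraph ℤ},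
      InIntervals a b c d G₁ G₂ G₃ → InIntervals a b c' d G₁' G₂' G₃' →
      IsIntervalTree ok a a c' G₁' →
      glue a d G₁ G₂ G₃ = glue a d G₁' G₂' G₃' → c' ≤ c := by
    intro c c' G₁ G₂ G₃ G₁' G₂' G₃' h h' ht' he
    by_contra hcc
    -- A tree on `[a, c']` has an edge that passes over the gap between `c` and `c + 1`.
    obtain ⟨x, y, _, hxy, hx, hy⟩ := exists_adj_of_reachable (ht'.reach c' h'.hac le_rfl) (· ≤ c)
      h.hac hcc
    have hy' := (ht'.mem _ _ hxy.symm).2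
    have hadj := h'.le₁ hxy
    rw [← he] at hadj
    have := h.hac
    have := h.hcd
    have := h'.hac
    have := h'.hcd
    rcases h.cases hadj with ⟨_, h''⟩ | ⟨_, h''⟩ | ⟨_, h''⟩ | h'' | h'' <;> omega
  have hcc : c = c' := le_antisymm (hc h' h ht he.symm) (hc h h' ht' he)
  subst hcc
  have had := h.had
  have hac := h.hac
  have hcd := h.hcd
  have hadj : ∀ x y, (glue a d G₁ G₂ G₃).Adj x y ↔ (glue a d G₁' G₂' G₃').Adj x y := by
    rw [he]; simp
  refine ⟨rfl, rfl, ?_, ?_, ?_⟩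
  · ext x y
    constructor
    · intro hxy
      have h1 := h.mem₁ _ _ hxy
      have h2 := h.mem₁ _ _ hxy.symm
      rcases h'.cases ((hadj x y).mp (h.le₁ hxy)) with ⟨g, h''⟩ | ⟨g, h''⟩ | ⟨g, h''⟩ | h'' | h''
      · exact g
      all_goals omega
    · intro hxy
      have h1 := h'.mem₁ _ _ hxy
      have h2 := h'.mem₁ _ _ hxy.symm
      rcases h.cases ((hadj x y).mpr (h'.le₁ hxy)) with ⟨g, h''⟩ | ⟨g, h''⟩ | ⟨g, h''⟩ | h'' | h''
      · exact g
      all_goals omega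
  · ext x y
    constructor
    · intro hxy
      have h1 := h.mem₂ _ _ hxy
      have h2 := h.mem₂ _ _ hxy.symm
      have h3 := hxy.ne
      rcases h'.cases ((hadj x y).mp (h.le₂ hxy)) with ⟨g, h''⟩ | ⟨g, h''⟩ | ⟨g, h''⟩ | h'' | h''
      · omega
      · exact g
      all_goals omega
    · intro hxy
      have h1 := h'.mem₂ _ _ hxy
      have h2 := h'.mem₂ _ _ hxy.symm
      have h3 := hxy.ne
      rcases h.cases ((hadj x y).mpr (h'.le₂ hxy)) with ⟨g, h''⟩ | ⟨g, h''⟩ | ⟨g, h''⟩ | h'' | h''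
      · omega
      · exact g
      all_goals omega
  · ext x y
    constructor
    · intro hxy
      have h1 := h.mem₃ _ _ hxy
      have h2 := h.mem₃ _ _ hxy.symm
      have h3 := hxy.ne
      rcases h'.cases ((hadj x y).mp (h.le₃ hxy)) with ⟨g, h''⟩ | ⟨g, h''⟩ | ⟨g, h''⟩ | h'' | h''
      · omega
      · omega
      · exact g
      all_goals omega
    · intro hxy
      have h1 := h'.mem₃ _ _ hxy
      have h2 := h'.mem₃ _ _ hxy.symm
      have h3 := hxy.ne
      rcases h.cases ((hadj x y).mpr (h'.le₃ hxy)) with ⟨g, h''⟩ | ⟨g, h''⟩ | ⟨g, h''⟩ | h'' | h''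
      · omega
      · omega
      · exact g
      all_goals omega

/-! ### The number of noncrossing trees on an interval -/

/-- Translations and reflections preserve noncrossing trees. -/
theorem IsIntervalTree.comap {ok ok' : ℤ → ℤ → Prop} {r a b a' b' : ℤ} {G : SimpleGraph ℤ}
    (e : ℤ ≃ ℤ) (he : StrictMono e ∨ StrictAnti e)
    (hmem : ∀ x, a' ≤ e x ∧ e x ≤ b' ↔ a ≤ x ∧ x ≤ b)
    (hok : ∀ x y, a ≤ x → x ≤ b → a ≤ y → y ≤ b → ok' (e x) (e y) → ok x y)
    (hG : IsIntervalTree ok' (e r) a' b' G) : IsIntervalTree ok r a b (G.comap e) := by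
  have hreach : ∀ (H : SimpleGraph ℤ) x y, (H.comap e).Reachable x y ↔ H.Reachable (e x) (e y) :=
    fun H x y => ((SimpleGraph.Iso.comap e H).reachable_iff (u := x) (v := y)).symm
  have hdel : ∀ x y, (G.comap e).deleteEdges {s(x, y)} = (G.deleteEdges {s(e x, e y)}).comap e := by
    intro x y
    ext u v
    simp [SimpleGraph.deleteEdges_adj]
  refine ⟨fun x y h => (hmem x).mp (hG.mem _ _ h), ?_, ?_, ?_, ?_⟩
  · intro x hx hx'
    have := (hmem x).mpr ⟨hx, hx'⟩
    exact (hreach _ _ _).mpr (hG.reach _ this.1 this.2)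
  · intro x y h
    rw [hdel, hreach]
    exact hG.bridge _ _ h
  · intro x y z w h1 h2 h3 hxy hzw
    rcases he with he | he
    · exact hG.noncrossing _ _ _ _ (he h1) (he h2) (he h3) hxy hzw
    · exact hG.noncrossing _ _ _ _ (he h3) (he h2) (he h1) hzw.symm hxy.symm
  · intro x y h
    rw [hdel, hreach]
    intro hr
    have hx := (hmem x).mp (hG.mem _ _ h)
    have hy := (hmem y).mp (hG.mem _ _ h.symm)
    exact hok x y hx.1 hx.2 hy.1 hy.2 (hG.parent _ _ h hr)

instance finite_isIntervalTree (ok : ℤ → ℤ → Prop) (r a b : ℤ) :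
    Finite {G // IsIntervalTree ok r a b G} := by
  refine Finite.of_injective
    (β := Set.Icc a b × Set.Icc a b → Prop) (fun G p => G.1.Adj p.1 p.2) ?_
  intro G H h
  apply Subtype.ext
  ext x y
  constructor
  · intro hxy
    have := congrFun h (⟨x, G.2.mem _ _ hxy⟩, ⟨y, G.2.mem _ _ hxy.symm⟩)
    exact Eq.mp this hxy
  · intro hxy
    have := congrFun h (⟨x, H.2.mem _ _ hxy⟩, ⟨y, H.2.mem _ _ hxy.symm⟩)
    exact Eq.mpr this hxy

/-- The number of noncrossing trees on `[a, b]` with root `r` and the parent condition `ok`. -/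
noncomputable def treeCard (ok : ℤ → ℤ → Prop) (r a b : ℤ) : ℕ :=
  Nat.card {G // IsIntervalTree ok r a b G}

theorem comap_equiv_injective (e : ℤ ≃ ℤ) :
    Function.Injective (fun G : SimpleGraph ℤ => G.comap e) := by
  intro G H h
  ext x y
  have := congrArg (fun K : SimpleGraph ℤ => K.Adj (e.symm x) (e.symm y)) h
  simpa using this

theorem treeCard_le {ok ok' : ℤ → ℤ → Prop} {r a b a' b' : ℤ}
    (e : ℤ ≃ ℤ) (he : StrictMono e ∨ StrictAnti e)
    (hmem : ∀ x, a' ≤ e x ∧ e x ≤ b' ↔ a ≤ x ∧ x ≤ b)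
    (hok : ∀ x y, a ≤ x → x ≤ b → a ≤ y → y ≤ b → ok' (e x) (e y) → ok x y) :
    treeCard ok' (e r) a' b' ≤ treeCard ok r a b :=
  Nat.card_le_card_of_injective
    (fun G : {G // IsIntervalTree ok' (e r) a' b' G} =>
      (⟨G.1.comap e, G.2.comap e he hmem hok⟩ : {G // IsIntervalTree ok r a b G}))
    fun _ _ h => Subtype.ext (comap_equiv_injective e (congrArg Subtype.val h))

/-- Translation invariance. -/
theorem treeCard_add {ok ok' : ℤ → ℤ → Prop} {r a b : ℤ} (s : ℤ)
    (hok : ∀ x y, a ≤ x → x ≤ b → a ≤ y → y ≤ b → (ok x y ↔ ok' (x + s) (y + s))) :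
    treeCard ok r a b = treeCard ok' (r + s) (a + s) (b + s) := by
  apply le_antisymm
  · have := treeCard_le (ok := ok') (ok' := ok) (r := r + s) (a := a + s) (b := b + s)
      (a' := a) (b' := b) (Equiv.addRight (-s)) (Or.inl fun x y h => by simpa using h)
      (fun x => by simp only [Equiv.coe_addRight]; omega)
      (fun x y h1 h2 h3 h4 h => by
        simp only [Equiv.coe_addRight] at h
        simpa using (hok _ _ (by omega) (by omega) (by omega) (by omega)).mp h)
    simpa using this
  · exact treeCard_le (Equiv.addRight s) (Or.inl fun x y h => by simpa using h)
      (fun x => by simp)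
      (fun x y h1 h2 h3 h4 h => (hok x y h1 h2 h3 h4).mpr h)

/-- Reflection invariance. -/
theorem treeCard_neg (ok : ℤ → ℤ → Prop) (r a b : ℤ) :
    treeCard ok r a b = treeCard (fun x y => ok (-x) (-y)) (-r) (-b) (-a) := by
  apply le_antisymm
  · have := treeCard_le (ok := fun x y => ok (-x) (-y)) (ok' := ok) (r := -r) (a := -b) (b := -a)
      (a' := a) (b' := b) (Equiv.neg ℤ) (Or.inr fun x y h => by simpa using h)
      (fun x => by simp only [Equiv.neg_apply]; omega) (fun x y _ _ _ _ h => h)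
    simpa using this
  · exact treeCard_le (ok' := fun x y => ok (-x) (-y)) (Equiv.neg ℤ)
      (Or.inr fun x y h => by simpa using h)
      (fun x => by simp only [Equiv.neg_apply]; omega) (fun x y _ _ _ _ h => by simpa using h)

theorem treeCard_self (ok : ℤ → ℤ → Prop) (a : ℤ) : treeCard ok a a a = 1 := by
  rw [treeCard, Nat.card_eq_one_iff_unique]
  have hbot : ∀ G : SimpleGraph ℤ, (∀ x y, G.Adj x y → a ≤ x ∧ x ≤ a) → G = ⊥ := by
    intro G h
    ext x y
    simp only [SimpleGraph.bot_adj, iff_false]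
    intro hxy
    have h1 := h _ _ hxy
    have h2 := h _ _ hxy.symm
    have := hxy.ne
    omega
  refine ⟨⟨fun G H => Subtype.ext ((hbot _ G.2.mem).trans (hbot _ H.2.mem).symm)⟩, ⟨⟨⊥, ?_⟩⟩⟩
  refine ⟨fun x y h => h.elim, fun x h1 h2 => ?_, fun x y h => h.elim,
    fun x y z w _ _ _ h => h.elim, fun x y h => h.elim⟩
  obtain rfl : a = x := le_antisymm h1 h2
  exact SimpleGraph.Reachable.refl _

open Classical in
/-- The recursion for trees with root at the left end: the summand `p` counts the trees in
which the largest neighbour of the root is `d = a + p.1 + 1 + p.2` and, without the edge between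
them, the part of `[a, d]` connected to the root is `[a, a + p.1]`. -/
theorem treeCard_left (ok : ℤ → ℤ → Prop) (a : ℤ) {n : ℕ} (hn : 0 < n) :
    treeCard ok a a (a + n) = ∑ p ∈ Finset.range n ×ˢ Finset.range n,
      if p.1 + p.2 < n ∧ ok a (a + p.1 + 1 + p.2) then
        treeCard ok a a (a + p.1) *
        (treeCard ok (a + p.1 + 1 + p.2) (a + p.1 + 1) (a + p.1 + 1 + p.2) *
        treeCard ok (a + p.1 + 1 + p.2) (a + p.1 + 1 + p.2) (a + n)) else 0 := by
  rw [← Finset.sum_filter]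
  set I := (Finset.range n ×ˢ Finset.range n).filter
    (fun p : ℕ × ℕ => p.1 + p.2 < n ∧ ok a (a + p.1 + 1 + p.2)) with hI
  have hin : ∀ (p : I) {G₁ G₂ G₃}, IsIntervalTree ok a a (a + p.1.1) G₁ →
      IsIntervalTree ok (a + p.1.1 + 1 + p.1.2) (a + p.1.1 + 1) (a + p.1.1 + 1 + p.1.2) G₂ →
      IsIntervalTree ok (a + p.1.1 + 1 + p.1.2) (a + p.1.1 + 1 + p.1.2) (a + n) G₃ →
      InIntervals a (a + n) (a + p.1.1) (a + p.1.1 + 1 + p.1.2) G₁ G₂ G₃ := by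
    intro p G₁ G₂ G₃ h₁ h₂ h₃
    have hp := (Finset.mem_filter.mp p.2).2.1
    exact ⟨by omega, by omega, by omega, h₁.mem, h₂.mem, h₃.mem⟩
  let f : (Σ p : I, {G // IsIntervalTree ok a a (a + p.1.1) G} ×
      ({G // IsIntervalTree ok (a + p.1.1 + 1 + p.1.2) (a + p.1.1 + 1) (a + p.1.1 + 1 + p.1.2) G} ×
      {G // IsIntervalTree ok (a + p.1.1 + 1 + p.1.2) (a + p.1.1 + 1 + p.1.2) (a + n) G})) →
      {G // IsIntervalTree ok a a (a + n) G} := fun q =>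
    ⟨glue a (a + q.1.1.1 + 1 + q.1.1.2) q.2.1.1 q.2.2.1.1 q.2.2.2.1,
      (hin q.1 q.2.1.2 q.2.2.1.2 q.2.2.2.2).isIntervalTree_glue (Finset.mem_filter.mp q.1.2).2.2
        q.2.1.2 q.2.2.1.2 q.2.2.2.2⟩
  have hf : Function.Bijective f := by
    constructor
    · rintro ⟨⟨⟨i, j⟩, hp⟩, ⟨G₁, h₁⟩, ⟨G₂, h₂⟩, ⟨G₃, h₃⟩⟩
        ⟨⟨⟨i', j'⟩, hp'⟩, ⟨G₁', h₁'⟩, ⟨G₂', h₂'⟩, ⟨G₃', h₃'⟩⟩ h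
      have he := congrArg Subtype.val h
      have hinj := glue_injective (hin ⟨_, hp⟩ h₁ h₂ h₃) (hin ⟨_, hp'⟩ h₁' h₂' h₃') h₁ h₁' he
      obtain ⟨hc, hd, rfl, rfl, rfl⟩ := hinj
      dsimp only at hc hd
      obtain rfl : i = i' := by omega
      obtain rfl : j = j' := by omega
      rfl
    · rintro ⟨G, hG⟩
      obtain ⟨c, d, G₁, G₂, G₃, hint, rfl⟩ := hG.exists_eq_glue (by omega)
      obtain ⟨hok, h₁, h₂, h₃⟩ := hint.of_isIntervalTree_glue hG
      have h1 := hint.hac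
      have h2 := hint.hcd
      have h3 := hint.hdb
      obtain ⟨i, rfl⟩ : ∃ i : ℕ, c = a + i := ⟨(c - a).toNat, by omega⟩
      obtain ⟨j, rfl⟩ : ∃ j : ℕ, d = a + i + 1 + j := ⟨(d - (a + i + 1)).toNat, by omega⟩
      exact ⟨⟨⟨(i, j), by
        rw [hI, Finset.mem_filter, Finset.mem_product, Finset.mem_range, Finset.mem_range]
        exact ⟨⟨by dsimp only; omega, by dsimp only; omega⟩, by dsimp only; omega, hok⟩⟩,
        ⟨G₁, h₁⟩, ⟨G₂, h₂⟩, ⟨G₃, h₃⟩⟩, rfl⟩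
  rw [treeCard, ← Nat.card_congr (Equiv.ofBijective f hf), Nat.card_sigma]
  simp only [Nat.card_prod]
  exact Finset.sum_coe_sort I fun p : ℕ × ℕ => treeCard ok a a (a + p.1) *
        (treeCard ok (a + p.1 + 1 + p.2) (a + p.1 + 1) (a + p.1 + 1 + p.2) *
        treeCard ok (a + p.1 + 1 + p.2) (a + p.1 + 1 + p.2) (a + n))

open Classical in
/-- The recursion for trees with root at the right end, by reflection. Here `a + p.1` is the
smallest neighbour of the root. -/
theorem treeCard_right (ok : ℤ → ℤ → Prop) (a : ℤ) {n : ℕ} (hn : 0 < n) :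
    treeCard ok (a + n) a (a + n) = ∑ p ∈ Finset.range n ×ˢ Finset.range n,
      if p.1 + p.2 < n ∧ ok (a + n) (a + p.1) then
        treeCard ok (a + p.1) a (a + p.1) *
        (treeCard ok (a + p.1) (a + p.1) (a + p.1 + p.2) *
        treeCard ok (a + n) (a + p.1 + p.2 + 1) (a + n)) else 0 := by
  have h := treeCard_left (fun x y => ok (-x) (-y)) (-(a + n)) hn
  rw [treeCard_neg, show -a = -(a + n) + n by ring, h, ← Finset.sum_filter, ← Finset.sum_filter]
  refine Finset.sum_nbij' (fun p => (n - 1 - p.1 - p.2, p.2)) (fun p => (n - 1 - p.1 - p.2, p.2))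
    ?_ ?_ ?_ ?_ ?_
  · rintro ⟨i, j⟩ hp
    simp only [Finset.mem_filter, Finset.mem_product, Finset.mem_range] at hp ⊢
    obtain ⟨_, h1, h2⟩ := hp
    refine ⟨⟨by omega, by omega⟩, by omega, ?_⟩
    convert h2 using 1 <;> omega
  · rintro ⟨i, j⟩ hp
    simp only [Finset.mem_filter, Finset.mem_product, Finset.mem_range] at hp ⊢
    obtain ⟨_, h1, h2⟩ := hp
    refine ⟨⟨by omega, by omega⟩, by omega, ?_⟩
    convert h2 using 1 <;> omega
  · rintro ⟨i, j⟩ hp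
    simp only [Finset.mem_filter, Finset.mem_product, Finset.mem_range] at hp
    exact Prod.ext (by dsimp only; omega) rfl
  · rintro ⟨i, j⟩ hp
    simp only [Finset.mem_filter, Finset.mem_product, Finset.mem_range] at hp
    exact Prod.ext (by dsimp only; omega) rfl
  · rintro ⟨i, j⟩ hp
    simp only [Finset.mem_filter, Finset.mem_product, Finset.mem_range] at hp
    dsimp only
    rw [treeCard_neg ok (a + ((n - 1 - i - j : ℕ) : ℤ)) a,
      treeCard_neg ok (a + ((n - 1 - i - j : ℕ) : ℤ)) (a + ((n - 1 - i - j : ℕ) : ℤ)),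
      treeCard_neg ok (a + n) (a + ((n - 1 - i - j : ℕ) : ℤ) + j + 1) (a + n)]
    have e1 : -(a + ((n - 1 - i - j : ℕ) : ℤ)) = -(a + n) + i + 1 + j := by omega
    have e2 : -(a + ((n - 1 - i - j : ℕ) : ℤ) + j) = -(a + n) + i + 1 := by omega
    have e3 : -(a + ((n - 1 - i - j : ℕ) : ℤ) + j + 1) = -(a + n) + i := by omega
    have e4 : -(a + n) + n = -a := by ring
    rw [e1, e2, e3, e4]
    ring

open PowerSeries

/-! ### Logarithmic derivatives -/

section LogDeriv

variable {S A : Type*} [CommRing S] [CommRing A] [Algebra S A]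

/-- The logarithmic derivative `D u / u` of a unit `u`. -/
def dlog (D : Derivation S A A) (u : Aˣ) : A := D u * ↑u⁻¹

theorem apply_unit (D : Derivation S A A) (u : Aˣ) : D (u : A) = u * dlog D u := by
  rw [dlog, mul_left_comm, Units.mul_inv, mul_one]

@[simp] theorem dlog_one (D : Derivation S A A) : dlog D 1 = 0 := by
  simp [dlog]

theorem dlog_mul (D : Derivation S A A) (u w : Aˣ) : dlog D (u * w) = dlog D u + dlog D w := by
  have hu : (u : A) * ↑u⁻¹ = 1 := u.mul_inv
  have hw : (w : A) * ↑w⁻¹ = 1 := w.mul_inv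
  simp only [dlog, Units.val_mul, Derivation.leibniz, mul_inv, smul_eq_mul]
  linear_combination (D ↑w * ↑w⁻¹) * hu + (D ↑u * ↑u⁻¹) * hw

/-- The logarithmic derivative as a homomorphism. -/
def dlogHom (D : Derivation S A A) : Aˣ →* Multiplicative A where
  toFun u := Multiplicative.ofAdd (dlog D u)
  map_one' := by simp
  map_mul' u w := by rw [dlog_mul]; rfl

theorem dlog_zpow (D : Derivation S A A) (u : Aˣ) (e : ℤ) :
    dlog D (u ^ e) = e * dlog D u := by
  have h := map_zpow (dlogHom D) u e
  rw [← zsmul_eq_mul]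
  exact h

theorem dlog_prod {ι : Type*} (D : Derivation S A A) (s : Finset ι) (u : ι → Aˣ) :
    dlog D (∏ i ∈ s, u i) = ∑ i ∈ s, dlog D (u i) := by
  classical
  induction s using Finset.induction_on with
  | empty => simp
  | insert a s ha ih => rw [Finset.prod_insert ha, Finset.sum_insert ha, dlog_mul, ih]

end LogDeriv

/-! ### Two derivations of a power series ring -/

section Derivations

variable {R : Type*} [CommRing R]

/-- The Euler operator `X d/dX`, which multiplies the coefficient of `X ^ n` by `n`. -/
noncomputable def euler (R : Type*) [CommRing R] : Derivation R R⟦X⟧ R⟦X⟧ :=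
  (X : R⟦X⟧) • derivative R

theorem coeff_euler (f : R⟦X⟧) (n : ℕ) : coeff n (euler R f) = n * coeff n f := by
  rw [euler, Derivation.smul_apply, smul_eq_mul]
  cases n with
  | zero => simp
  | succ n => rw [coeff_succ_X_mul, coeff_derivative, mul_comm]; push_cast; ring

/-- A derivation of the coefficient ring, applied to each coefficient of a power series. -/
noncomputable def coeffwise {S : Type*} [CommRing S] [Algebra S R] (d : Derivation S R R) :
    Derivation S R⟦X⟧ R⟦X⟧ :=
  Derivation.mk'
    { toFun := fun f => PowerSeries.mk fun n => d (coeff n f)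
      map_add' := fun f g => by ext n; simp
      map_smul' := fun s f => by ext n; simp }
    (fun f g => by
      ext n
      simp only [LinearMap.coe_mk, AddHom.coe_mk, coeff_mk, coeff_mul, map_sum, smul_eq_mul,
        Derivation.leibniz, Finset.sum_add_distrib, map_add]
      congr 1
      rw [← Finset.Nat.sum_antidiagonal_swap]
      rfl)

@[simp] theorem coeff_coeffwise {S : Type*} [CommRing S] [Algebra S R] (d : Derivation S R R)
    (f : R⟦X⟧) (n : ℕ) : coeff n (coeffwise d f) = d (coeff n f) :=
  coeff_mk n fun n => d (coeff n f)

theorem coeffwise_X_mul_C {S : Type*} [CommRing S] [Algebra S R] (d : Derivation S R R)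
    (r : R) : coeffwise d (X * C r) = X * C (d r) := by
  ext n
  rw [coeff_coeffwise]
  cases n with
  | zero => rw [coeff_zero_X_mul, coeff_zero_X_mul, map_zero]
  | succ n => simp only [coeff_succ_X_mul, coeff_C]; split <;> simp

theorem euler_X_mul_C (r : R) : euler R (X * C r) = X * C r := by
  ext n
  rw [coeff_euler]
  rcases n with _ | _ | n
  · simp
  · simp
  · rw [coeff_succ_X_mul, coeff_C, if_neg (by omega), mul_zero]

end Derivations

/-! ### Lagrange inversion -/

section Lagrange

variable {R : Type*} [CommRing R]

theorem euler_mul_zpow_add (w : R⟦X⟧ˣ) (m : ℕ) :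
    (m : R⟦X⟧) * ((w ^ (-(m : ℤ))).val * (1 + dlog (euler R) w)) =
      m * (w ^ (-(m : ℤ))).val - euler R (w ^ (-(m : ℤ))).val := by
  rw [apply_unit, dlog_zpow]
  push_cast
  ring

/-- The residue computation behind Lagrange inversion: for `m ≠ 0`, the series is, up to the factor
`m`, of the form `m f - X f'`, which has no term of degree `m`. -/
theorem coeff_zpow_neg_mul_one_add_dlog [IsDomain R] [CharZero R] (w : R⟦X⟧ˣ) (m : ℕ) :
    coeff m ((w ^ (-(m : ℤ))).val * (1 + dlog (euler R) w)) = if m = 0 then 1 else 0 := by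
  rcases eq_or_ne m 0 with rfl | hm
  · have h : coeff 0 (euler R (w : R⟦X⟧)) = 0 := by rw [coeff_euler]; simp
    simp only [Nat.cast_zero, neg_zero, zpow_zero, Units.val_one, one_mul, dlog, if_true, map_add,
      coeff_zero_eq_constantCoeff, map_one, map_mul] at h ⊢
    rw [h, zero_mul, add_zero]
  · have h := congrArg (coeff m) (euler_mul_zpow_add w m)
    rw [map_sub, coeff_euler, ← nsmul_eq_mul, ← nsmul_eq_mul, map_nsmul, map_nsmul, nsmul_eq_mul,
      nsmul_eq_mul, sub_self] at h
    rw [if_neg hm]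
    exact (mul_eq_zero.mp h).resolve_left (by exact_mod_cast hm)

theorem hasSubst_X_mul (w : R⟦X⟧) : HasSubst (X * w : R⟦X⟧) :=
  HasSubst.of_constantCoeff_zero' (by simp)

/-- The substitution `X ↦ X w` as a ring homomorphism. -/
noncomputable def substXMul (w : R⟦X⟧) : R⟦X⟧ →+* R⟦X⟧ :=
  (substAlgHom (hasSubst_X_mul w)).toRingHom

@[simp] theorem substXMul_X (w : R⟦X⟧) : substXMul w X = X * w := by
  change substAlgHom (hasSubst_X_mul w) X = _
  rw [substAlgHom_X]

@[simp] theorem substXMul_C (w : R⟦X⟧) (r : R) : substXMul w (C r) = C r := by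
  change substAlgHom (hasSubst_X_mul w) (C r) = _
  exact (substAlgHom (hasSubst_X_mul w)).commutes r

/-- Lagrange inversion: the coefficients of `f` can be read off from the series obtained from `f`
by the substitution `X ↦ X w`, for a unit `w`. Modulo `X ^ (n + 1)`, the series `f` is a polynomial,
and for a monomial this is the residue computation. -/
theorem coeff_eq_coeff_substXMul [IsDomain R] [CharZero R] (w : R⟦X⟧ˣ) (f : R⟦X⟧) (n : ℕ) :
    coeff n f =
      coeff n (substXMul w f * ((w ^ (-(n : ℤ))).val * (1 + dlog (euler R) w))) := by
  obtain ⟨g, hg⟩ : (X : R⟦X⟧) ^ (n + 1) ∣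
      f - ∑ d ∈ Finset.range (n + 1), C (coeff d f) * X ^ d := by
    rw [X_pow_dvd_iff]
    intro m hm
    simp [coeff_X_pow, coeff_C_mul, hm]
  rw [sub_eq_iff_eq_add] at hg
  have hs : substXMul (w : R⟦X⟧) f = X ^ (n + 1) * ((w : R⟦X⟧) ^ (n + 1) * substXMul w g) +
      ∑ d ∈ Finset.range (n + 1), C (coeff d f) * (X ^ d * (w : R⟦X⟧) ^ d) := by
    conv_lhs => rw [hg]
    simp [mul_pow, mul_assoc]
  rw [hs, add_mul, map_add, mul_assoc, coeff_X_pow_mul', if_neg (by omega), zero_add,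
    Finset.sum_mul, map_sum]
  rw [Finset.sum_eq_single_of_mem n (by simp)]
  · have := coeff_zpow_neg_mul_one_add_dlog w 0
    have hw : (w : R⟦X⟧) ^ n * (w ^ (-(n : ℤ))).val = 1 := by
      rw [← Units.val_pow_eq_pow_val, ← Units.val_mul, zpow_neg, zpow_natCast, mul_inv_cancel,
        Units.val_one]
    rw [show C (coeff n f) * (X ^ n * (w : R⟦X⟧) ^ n) *
        ((w ^ (-(n : ℤ))).val * (1 + dlog (euler R) w)) = C (coeff n f) * (X ^ n *
        ((w : R⟦X⟧) ^ n * (w ^ (-(n : ℤ))).val * (1 + dlog (euler R) w))) by ring, hw,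
      coeff_C_mul, coeff_X_pow_mul', if_pos le_rfl, Nat.sub_self]
    simp only [CharP.cast_eq_zero, neg_zero, zpow_zero, Units.val_one, if_true] at this
    rw [this, mul_one]
  · intro d hd hdn
    have hd' : d < n := by have := Finset.mem_range.mp hd; omega
    have hw : (w : R⟦X⟧) ^ d * (w ^ (-(n : ℤ))).val = (w ^ (-((n - d : ℕ) : ℤ))).val := by
      rw [← Units.val_pow_eq_pow_val, ← Units.val_mul, ← zpow_natCast, ← zpow_add]
      congr 2
      omega
    rw [show C (coeff d f) * (X ^ d * (w : R⟦X⟧) ^ d) *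
        ((w ^ (-(n : ℤ))).val * (1 + dlog (euler R) w)) = C (coeff d f) * (X ^ d *
        ((w : R⟦X⟧) ^ d * (w ^ (-(n : ℤ))).val * (1 + dlog (euler R) w))) by ring, hw,
      coeff_C_mul, coeff_X_pow_mul', if_pos hd'.le, coeff_zpow_neg_mul_one_add_dlog,
      if_neg (by omega), mul_zero]

end Lagrange

/-! ### Coefficients of products of powers of linear forms -/

/-- The coefficient ring: polynomials over `ℚ`, with one variable for each label. -/
abbrev LabelRing : Type := MvPolynomial ℕ ℚ

/-- The coefficient of `X ^ n * ∏ x_i ^ (l i)`. -/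
noncomputable def monoCoeff (n : ℕ) (l : ℕ →₀ ℕ) : LabelRing⟦X⟧ →ₗ[ℚ] ℚ :=
  MvPolynomial.lcoeff ℚ l ∘ₗ (coeff (R := LabelRing) n).restrictScalars ℚ

theorem monoCoeff_apply (n : ℕ) (l : ℕ →₀ ℕ) (f : LabelRing⟦X⟧) :
    monoCoeff n l f = MvPolynomial.coeff l (coeff n f) := rfl

theorem monoCoeff_intCast_mul (n : ℕ) (l : ℕ →₀ ℕ) (c : ℤ) (f : LabelRing⟦X⟧) :
    monoCoeff n l (c * f) = c * monoCoeff n l f := by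
  rw [← zsmul_eq_mul, map_zsmul, zsmul_eq_mul]

theorem monoCoeff_natCast_mul (n : ℕ) (l : ℕ →₀ ℕ) (c : ℕ) (f : LabelRing⟦X⟧) :
    monoCoeff n l (c * f) = c * monoCoeff n l f := by
  rw [← nsmul_eq_mul, map_nsmul, nsmul_eq_mul]

theorem monoCoeff_X_mul (n : ℕ) (l : ℕ →₀ ℕ) (f : LabelRing⟦X⟧) :
    monoCoeff (n + 1) l (X * f) = monoCoeff n l f := by
  rw [monoCoeff_apply, coeff_succ_X_mul, monoCoeff_apply]

/-- The partial derivative with respect to the variable of the label `a`. -/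
noncomputable def labelDeriv (a : ℕ) : Derivation ℚ LabelRing⟦X⟧ LabelRing⟦X⟧ :=
  coeffwise (MvPolynomial.pderiv a)

theorem monoCoeff_labelDeriv (n a : ℕ) (l : ℕ →₀ ℕ) (f : LabelRing⟦X⟧) :
    monoCoeff n l (labelDeriv a f) = (l a + 1) * monoCoeff n (l + Finsupp.single a 1) f := by
  rw [monoCoeff_apply, labelDeriv, coeff_coeffwise, MvPolynomial.coeff_pderiv, monoCoeff_apply,
    mul_comm]

theorem monoCoeff_euler (n : ℕ) (l : ℕ →₀ ℕ) (f : LabelRing⟦X⟧) :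
    monoCoeff n l (euler LabelRing f) = n * monoCoeff n l f := by
  rw [monoCoeff_apply, coeff_euler, ← nsmul_eq_mul, MvPolynomial.coeff_smul, nsmul_eq_mul,
    monoCoeff_apply]

theorem monoCoeff_C_X_mul_of_eq_zero (n a : ℕ) (l : ℕ →₀ ℕ) (hl : l a = 0) (f : LabelRing⟦X⟧) :
    monoCoeff n l (C (MvPolynomial.X a) * f) = 0 := by
  rw [monoCoeff_apply, coeff_C_mul, MvPolynomial.coeff_X_mul', if_neg (by simpa using hl)]

/-- The alternating sum of the first `i` of the variables `x_{v 1}, x_{v 2}, …`. -/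
noncomputable def altSum (v : ℕ → ℕ) (i : ℕ) : LabelRing :=
  ∑ j ∈ Finset.Icc 1 i, (-1) ^ j * MvPolynomial.X (v j)

theorem isUnit_one_add_X_mul_C {R : Type*} [CommRing R] (r : R) : IsUnit (1 + X * C r) := by
  rw [isUnit_iff_constantCoeff]
  simp

/-- The unit `1 + X (-x_{v 1} + x_{v 2} - ⋯ ± x_{v i})` of the power series ring. -/
noncomputable def altUnit (v : ℕ → ℕ) (i : ℕ) : LabelRing⟦X⟧ˣ :=
  (isUnit_one_add_X_mul_C (altSum v i)).unit

theorem val_altUnit (v : ℕ → ℕ) (i : ℕ) :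
    (altUnit v i : LabelRing⟦X⟧) = 1 + X * C (altSum v i) := rfl

theorem altSum_succ (v : ℕ → ℕ) (i : ℕ) :
    altSum v (i + 1) = altSum v i + (-1) ^ (i + 1) * MvPolynomial.X (v (i + 1)) := by
  rw [altSum, Finset.sum_Icc_succ_top (by omega), altSum]

theorem altUnit_succ (v : ℕ → ℕ) (i : ℕ) :
    (altUnit v (i + 1) : LabelRing⟦X⟧) =
      (altUnit v i).val + (-1) ^ (i + 1) * (X * C (MvPolynomial.X (v (i + 1)))) := by
  rw [val_altUnit, val_altUnit, altSum_succ]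
  simp only [map_add, map_mul, map_pow, map_neg, map_one]
  ring

@[simp] theorem altUnit_zero (v : ℕ → ℕ) : altUnit v 0 = 1 := by
  ext1
  simp [val_altUnit, altSum]

theorem dlog_euler_altUnit (v : ℕ → ℕ) (i : ℕ) :
    dlog (euler LabelRing) (altUnit v i) = 1 - (altUnit v i)⁻¹.val := by
  have h : euler LabelRing (altUnit v i : LabelRing⟦X⟧) = altUnit v i - 1 := by
    rw [val_altUnit, map_add, Derivation.map_one_eq_zero, euler_X_mul_C]
    ring
  rw [dlog, h, sub_mul, Units.mul_inv, one_mul]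

theorem pderiv_altSum {v : ℕ → ℕ} {k : ℕ} (hv : Set.InjOn v (Set.Icc 1 k)) {i j : ℕ}
    (hi : i ∈ Set.Icc 1 k) (hj : j ≤ k) :
    MvPolynomial.pderiv (v i) (altSum v j) = if i ≤ j then (-1) ^ i else 0 := by
  have h : ∀ m ∈ Finset.Icc 1 j, MvPolynomial.pderiv (v i)
      ((-1) ^ m * MvPolynomial.X (v m) : LabelRing) = if m = i then (-1) ^ i else 0 := by
    intro m hm
    rw [Finset.mem_Icc] at hm
    have hc : ((-1) ^ m : LabelRing) = MvPolynomial.C ((-1) ^ m) := by simp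
    rw [hc, MvPolynomial.pderiv_C_mul, MvPolynomial.pderiv_X]
    split_ifs with h
    · subst h; simp
    · rw [Pi.single_eq_of_ne, mul_zero]
      intro hc
      exact h (hv ⟨hm.1, by omega⟩ hi hc)
  rw [altSum, map_sum, Finset.sum_congr rfl h, Finset.sum_ite_eq']
  simp only [Finset.mem_Icc, hi.1, true_and]

theorem dlog_labelDeriv_altUnit {v : ℕ → ℕ} {k : ℕ} (hv : Set.InjOn v (Set.Icc 1 k)) {i j : ℕ}
    (hi : i ∈ Set.Icc 1 k) (hj : j ≤ k) :
    dlog (labelDeriv (v i)) (altUnit v j) =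
      if i ≤ j then (-1) ^ i * (X * (altUnit v j)⁻¹.val) else 0 := by
  rw [dlog, val_altUnit, map_add, Derivation.map_one_eq_zero, zero_add, labelDeriv,
    coeffwise_X_mul_C, pderiv_altSum hv hi hj]
  split_ifs
  · simp only [map_pow, map_neg, map_one]; ring
  · simp

/-- Congruent units have congruent powers, also for negative exponents. -/
theorem dvd_zpow_sub_zpow {A : Type*} [CommRing A] {a : A} {u w : Aˣ} (h : a ∣ (u : A) - w)
    (e : ℤ) : a ∣ (u ^ e).val - (w ^ e).val := by
  rw [← Ideal.mem_span_singleton, ← Ideal.Quotient.mk_eq_mk_iff_sub_mem] at h ⊢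
  have h' : Units.map (Ideal.Quotient.mk (Ideal.span {a})).toMonoidHom u =
      Units.map (Ideal.Quotient.mk (Ideal.span {a})).toMonoidHom w := Units.ext h
  have := congrArg (fun z => (z ^ e).val) h'
  simp only [← map_zpow] at this
  exact this

theorem succ_mul_choose_succ (e : ℤ) (m : ℕ) :
    (m + 1 : ℚ) * (Ring.choose e (m + 1) : ℤ) = e * (Ring.choose (e - 1) m : ℤ) := by
  have h := Ring.choose_smul_choose e (n := m + 1) (k := 1) (by omega)
  rw [Nat.choose_one_right, Ring.choose_one_right, nsmul_eq_mul] at h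
  have h2 := congrArg (Int.cast : ℤ → ℚ) h
  push_cast at h2
  simpa using h2

/-- Extraction of the last variable, which occurs in `altUnit v (k + 1)` only. Each partial
derivative by this variable lowers the exponent of the unit by one, and where the variable does not
occur any more, `altUnit v (k + 1)` may be replaced by `altUnit v k`. -/
theorem monoCoeff_mul_altUnit_succ_zpow {v : ℕ → ℕ} {k : ℕ}
    (hv : Set.InjOn v (Set.Icc 1 (k + 1))) (U : LabelRing⟦X⟧ˣ)
    (hU : labelDeriv (v (k + 1)) (U : LabelRing⟦X⟧) = 0) (n : ℕ) (l : ℕ →₀ ℕ)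
    (hl : l (v (k + 1)) = 0) (m : ℕ) (e : ℤ) :
    monoCoeff (n + m) (l + Finsupp.single (v (k + 1)) m) (U * altUnit v (k + 1) ^ e).val =
      (-1) ^ ((k + 1) * m) * (Ring.choose e m : ℤ) *
        monoCoeff n l (U * altUnit v k ^ (e - m)).val := by
  induction m generalizing e with
  | zero =>
    obtain ⟨g, hg⟩ := dvd_zpow_sub_zpow (a := C (MvPolynomial.X (v (k + 1))))
      (u := altUnit v (k + 1)) (w := altUnit v k)
      ⟨(-1) ^ (k + 1) * X, by rw [altUnit_succ]; ring⟩ e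
    have h : (U * altUnit v (k + 1) ^ e).val =
        (U * altUnit v k ^ e).val + C (MvPolynomial.X (v (k + 1))) * (U.val * g) := by
      rw [Units.val_mul, Units.val_mul, mul_left_comm, ← hg]; ring
    simp [h, monoCoeff_C_X_mul_of_eq_zero n _ l hl]
  | succ m ih =>
    have hd : labelDeriv (v (k + 1)) (U * altUnit v (k + 1) ^ e).val =
        ((e * (-1) ^ (k + 1) : ℤ) : LabelRing⟦X⟧) *
          (X * (U * altUnit v (k + 1) ^ (e - 1)).val) := by
      rw [apply_unit, dlog_mul, dlog_zpow, dlog, hU, zero_mul, zero_add,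
        dlog_labelDeriv_altUnit hv ⟨by omega, le_rfl⟩ le_rfl, if_pos le_rfl, zpow_sub_one]
      push_cast
      ring
    have h := monoCoeff_labelDeriv (n + (m + 1)) (v (k + 1))
      (l + Finsupp.single (v (k + 1)) m) (U * altUnit v (k + 1) ^ e).val
    rw [hd, monoCoeff_intCast_mul, ← add_assoc, monoCoeff_X_mul, ih, add_assoc l,
      ← Finsupp.single_add] at h
    simp only [Finsupp.add_apply, hl, Finsupp.single_eq_same, zero_add] at h
    have hm : (m + 1 : ℚ) ≠ 0 := by positivity
    apply mul_left_cancel₀ hm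
    rw [← add_assoc, ← h, show e - 1 - (m : ℤ) = e - ((m + 1 : ℕ) : ℤ) by push_cast; ring]
    have hc := succ_mul_choose_succ e m
    push_cast
    rw [mul_add (k + 1) m 1, pow_add, mul_one]
    linear_combination (-(-1) ^ ((k + 1) * m) * (-1) ^ (k + 1) *
      monoCoeff n l (U * altUnit v k ^ (e - (m + 1))).val) * hc

/-- The exponent vector that has `c i` at `v i` for `1 ≤ i ≤ k`. -/
noncomputable def expVec (v c : ℕ → ℕ) (k : ℕ) : ℕ →₀ ℕ :=
  ∑ i ∈ Finset.Icc 1 k, Finsupp.single (v i) (c i)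

/-- The coefficients of a product of powers of the series `altUnit v i` are products of binomial
coefficients: the variables are extracted one by one, the last one first. -/
theorem monoCoeff_prod_altUnit_zpow (v c : ℕ → ℕ) (k : ℕ) (hv : Set.InjOn v (Set.Icc 1 k))
    (e : ℕ → ℤ) :
    monoCoeff (∑ i ∈ Finset.Icc 1 k, c i) (expVec v c k)
        (∏ i ∈ Finset.Icc 1 k, altUnit v i ^ e i).val =
      ∏ i ∈ Finset.Icc 1 k, ((-1) ^ (i * c i) *
        (Ring.choose (∑ j ∈ Finset.Icc i k, e j - ∑ j ∈ Finset.Icc (i + 1) k, (c j : ℤ)) (c i) :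
          ℤ) : ℚ) := by
  induction k generalizing e with
  | zero => simp [monoCoeff_apply, expVec]
  | succ k ih =>
    have hv' : Set.InjOn v (Set.Icc 1 k) := hv.mono (Set.Icc_subset_Icc_right (by omega))
    have hU : labelDeriv (v (k + 1)) (∏ i ∈ Finset.Icc 1 k, altUnit v i ^ e i).val = 0 := by
      rw [apply_unit, dlog_prod, Finset.sum_eq_zero, mul_zero]
      intro j hj
      rw [Finset.mem_Icc] at hj
      rw [dlog_zpow, dlog_labelDeriv_altUnit hv ⟨by omega, le_rfl⟩ (by omega),
        if_neg (by omega), mul_zero]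
    have hl : expVec v c k (v (k + 1)) = 0 := by
      rw [expVec, Finsupp.finsetSum_apply, Finset.sum_eq_zero]
      intro j hj
      rw [Finset.mem_Icc] at hj
      rw [Finsupp.single_apply, if_neg]
      intro h
      have := hv ⟨hj.1, by omega⟩ ⟨by omega, le_rfl⟩ h
      omega
    rw [Finset.sum_Icc_succ_top (by omega), expVec, Finset.sum_Icc_succ_top (by omega), ← expVec,
      Finset.prod_Icc_succ_top (by omega),
      monoCoeff_mul_altUnit_succ_zpow hv _ hU _ _ hl, Finset.prod_Icc_succ_top (by omega),
      mul_comm, Finset.Icc_self (k + 1), Finset.sum_singleton,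
      Finset.Icc_eq_empty (show ¬k + 1 + 1 ≤ k + 1 by omega),
      Finset.sum_empty, sub_zero]
    congr 1
    -- After the extraction, the factor with index `k + 1` turns into a power of the one before it.
    rcases Nat.eq_zero_or_pos k with rfl | hk
    · simp [monoCoeff_apply, expVec]
    · have hp : (∏ i ∈ Finset.Icc 1 k, altUnit v i ^ e i) * altUnit v k ^ (e (k + 1) - c (k + 1)) =
          ∏ i ∈ Finset.Icc 1 k,
            altUnit v i ^ (e i + if i = k then e (k + 1) - (c (k + 1) : ℤ) else 0) := by
        simp only [zpow_add, Finset.prod_mul_distrib]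
        congr 1
        rw [Finset.prod_eq_single_of_mem k (by simp; omega)]
        · simp
        · intro b _ hb; simp [hb]
      rw [hp, ih hv']
      refine Finset.prod_congr rfl fun i hi => ?_
      rw [Finset.mem_Icc] at hi
      rw [Finset.sum_add_distrib, Finset.sum_ite_eq', if_pos (by simp; omega),
        Finset.sum_Icc_succ_top (b := k) (f := e) (by omega),
        Finset.sum_Icc_succ_top (b := k) (f := fun j => (c j : ℤ)) (by omega)]
      congr 3
      ring

/-! ### The functional equations and their solution -/

/-- The functional equations of the generating functions: `L` counts the sequences of subtrees to
the left of a vertex and `F h` those to the right of a vertex labelled `h`; the root of each of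
these subtrees has a left and a right sequence of its own. The factor `Y` marks a vertex. -/
structure IsTreeSystem {R : Type*} [CommRing R] (k : ℕ) (x : ℕ → R) (Y L : R)
    (F : ℕ → R) : Prop where
  left : L = 1 + L * ∑ d ∈ Finset.Icc 1 k, Y * (x d * (L * F d))
  right : ∀ h ∈ Finset.Icc 1 k, F h =
    1 + F h * ∑ d ∈ Finset.Icc 1 (k + 1 - h), Y * (x d * (L * F d))

theorem IsTreeSystem.map {R R' : Type*} [CommRing R] [CommRing R'] {k : ℕ} {x : ℕ → R} {Y L : R}
    {F : ℕ → R} (hs : IsTreeSystem k x Y L F) (f : R →+* R') :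
    IsTreeSystem k (fun i => f (x i)) (f Y) (f L) (fun i => f (F i)) where
  left := by
    have := congrArg f hs.left
    simpa only [map_add, map_one, map_mul, map_sum] using this
  right h hh := by
    have := congrArg f (hs.right h hh)
    simpa only [map_add, map_one, map_mul, map_sum] using this

/-- A system over a power series ring, in which `Y` has no constant term, has only one solution. -/
theorem IsTreeSystem.unique {R : Type*} [CommRing R] {k : ℕ} {x : ℕ → R⟦X⟧} {Y L L' : R⟦X⟧}
    {F F' : ℕ → R⟦X⟧} (hY : X ∣ Y) (hs : IsTreeSystem k x Y L F) (hs' : IsTreeSystem k x Y L' F') :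
    L = L' ∧ ∀ h ∈ Finset.Icc 1 k, F h = F' h := by
  have key : ∀ n : ℕ, X ^ n ∣ L - L' ∧ ∀ h ∈ Finset.Icc 1 k, X ^ n ∣ F h - F' h := by
    intro n
    induction n with
    | zero => simp
    | succ n ih =>
      obtain ⟨ihL, ihF⟩ := ih
      have hS : ∀ m ≤ k, X ^ (n + 1) ∣ ∑ d ∈ Finset.Icc 1 m, Y * (x d * (L * F d)) -
          ∑ d ∈ Finset.Icc 1 m, Y * (x d * (L' * F' d)) := by
        intro m hm
        rw [← Finset.sum_sub_distrib]
        refine Finset.dvd_sum fun d hd => ?_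
        have hd' : d ∈ Finset.Icc 1 k := by rw [Finset.mem_Icc] at hd ⊢; omega
        rw [show Y * (x d * (L * F d)) - Y * (x d * (L' * F' d)) =
          Y * (x d * ((L - L') * F d + L' * (F d - F' d))) by ring, pow_succ']
        exact mul_dvd_mul hY ((dvd_add (ihL.mul_right _) ((ihF d hd').mul_left _)).mul_left _)
      have hY' : ∀ m, X ∣ ∑ d ∈ Finset.Icc 1 m, Y * (x d * (L * F d)) := fun m =>
        Finset.dvd_sum fun d _ => hY.mul_right _
      have step : ∀ (f f' s s' : R⟦X⟧), f = 1 + f * s → f' = 1 + f' * s' → X ∣ s →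
          X ^ n ∣ f - f' → X ^ (n + 1) ∣ s - s' → X ^ (n + 1) ∣ f - f' := by
        intro f f' s s' h h' hs hf hss
        have e : f - f' = s * (f - f') + (s - s') * f' := by linear_combination h - h'
        rw [e]
        exact dvd_add (by rw [pow_succ']; exact mul_dvd_mul hs hf) (hss.mul_right _)
      refine ⟨step _ _ _ _ hs.left hs'.left (hY' k) ihL (hS k le_rfl), fun h hh => ?_⟩
      have hh' := Finset.mem_Icc.mp hh
      exact step _ _ _ _ (hs.right h hh) (hs'.right h hh) (hY' _) (ihF h hh) (hS _ (by omega))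
  have aux : ∀ f : R⟦X⟧, (∀ n : ℕ, X ^ n ∣ f) → f = 0 := fun f hf => by
    ext n
    rw [(X_pow_dvd_iff.mp (hf (n + 1))) n (by omega), map_zero]
  exact ⟨sub_eq_zero.mp (aux _ fun n => (key n).1),
    fun h hh => sub_eq_zero.mp (aux _ fun n => (key n).2 h hh)⟩

/-- The labels in the order `1, k, 2, k - 1, 3, …`. For `i ≤ k` each label occurs once; for
`k < i ≤ 2 * k` the labels are repeated in the reverse order. -/
def zigzag (k i : ℕ) : ℕ := if Even i then k + 1 - i / 2 else (i + 1) / 2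

theorem zigzag_even (k m : ℕ) : zigzag k (2 * m) = k + 1 - m := by
  rw [zigzag, if_pos (by simp)]
  omega

theorem zigzag_odd (k m : ℕ) : zigzag k (2 * m + 1) = m + 1 := by
  rw [zigzag, if_neg (by simp)]
  omega

theorem zigzag_injOn (k : ℕ) : Set.InjOn (zigzag k) (Set.Icc 1 k) := by
  intro i hi j hj h
  obtain ⟨hi1, hi2⟩ := hi
  obtain ⟨hj1, hj2⟩ := hj
  simp only [zigzag, Nat.even_iff] at h
  split_ifs at h <;> omega

theorem zigzag_reflect {k i : ℕ} (h1 : 1 ≤ i) (hi : i ≤ 2 * k) :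
    zigzag k (2 * k + 1 - i) = zigzag k i := by
  simp only [zigzag, Nat.even_iff]
  split_ifs <;> omega

/-- Each label occurs twice among the first `2 * k`, with opposite signs. -/
theorem altSum_zigzag_two_mul (k : ℕ) : altSum (zigzag k) (2 * k) = 0 := by
  refine Finset.sum_involution (fun j _ => 2 * k + 1 - j) ?_ ?_ ?_ ?_
  · intro j hj
    rw [Finset.mem_Icc] at hj
    have hp : ((-1) ^ (2 * k + 1 - j) : LabelRing) = -(-1) ^ j := by
      rcases Nat.even_or_odd j with h | h
      · rw [h.neg_one_pow, Odd.neg_one_pow]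
        rw [Nat.odd_iff]; rw [Nat.even_iff] at h; omega
      · rw [h.neg_one_pow, Even.neg_one_pow, neg_neg]
        rw [Nat.even_iff]; rw [Nat.odd_iff] at h; omega
    rw [zigzag_reflect hj.1 hj.2, hp]
    ring
  · intro j hj _ h
    omega
  · intro j hj
    rw [Finset.mem_Icc] at hj ⊢
    omega
  · intro j hj
    rw [Finset.mem_Icc] at hj
    omega

theorem altSum_zigzag_reflect (k : ℕ) {i : ℕ} (hi : i ≤ 2 * k) :
    altSum (zigzag k) (2 * k - i) = altSum (zigzag k) i := by
  induction i with
  | zero => rw [Nat.sub_zero, altSum_zigzag_two_mul]; simp [altSum]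
  | succ i ih =>
    have ih := ih (by omega)
    obtain ⟨m, hm⟩ : ∃ m, 2 * k - i = m + 1 := ⟨2 * k - i - 1, by omega⟩
    have hp : ((-1) ^ (m + 1) : LabelRing) = (-1) ^ i := by
      apply neg_one_pow_congr
      rw [Nat.even_iff, Nat.even_iff]
      omega
    have hz := zigzag_reflect (k := k) (i := i + 1) (by omega) hi
    rw [show 2 * k + 1 - (i + 1) = m + 1 by omega] at hz
    rw [hm, altSum_succ, hz, hp] at ih
    rw [show 2 * k - (i + 1) = m by omega, altSum_succ, ← ih, pow_succ]
    ring

/-- The unit `q_i = 1 + X (-x_1 + x_k - x_2 + x_{k-1} - ⋯)` with `i` variables. -/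
noncomputable abbrev zigUnit (k i : ℕ) : LabelRing⟦X⟧ˣ := altUnit (zigzag k) i

theorem zigUnit_reflect (k : ℕ) {i : ℕ} (hi : i ≤ 2 * k) : zigUnit k (2 * k - i) = zigUnit k i := by
  ext1
  rw [val_altUnit, val_altUnit, altSum_zigzag_reflect k hi]

/-- The alternating product `q_1 q_2⁻¹ q_3 ⋯ q_i ^ ±1` of the units `q_j = zigUnit k j`. -/
noncomputable def altProd (k i : ℕ) : LabelRing⟦X⟧ˣ :=
  ∏ j ∈ Finset.Icc 1 i, zigUnit k j ^ ((-1) ^ (j + 1) : ℤ)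

@[simp] theorem altProd_zero (k : ℕ) : altProd k 0 = 1 := by simp [altProd]

theorem altProd_succ (k i : ℕ) :
    altProd k (i + 1) = altProd k i * zigUnit k (i + 1) ^ ((-1) ^ i : ℤ) := by
  rw [altProd, Finset.prod_Icc_succ_top (by omega), altProd, pow_succ, pow_succ]
  simp

theorem altProd_two_mul_mul (k m : ℕ) :
    altProd k (2 * m) * zigUnit k (2 * m) = altProd k (2 * m - 1) := by
  cases m with
  | zero => simp
  | succ m =>
    rw [show 2 * (m + 1) = 2 * m + 1 + 1 by ring, altProd_succ, Odd.neg_one_pow (by simp)]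
    simp

theorem altProd_two_mul_add_one (k m : ℕ) :
    altProd k (2 * m + 1) = altProd k (2 * m) * zigUnit k (2 * m + 1) := by
  rw [altProd_succ, Even.neg_one_pow (by simp), zpow_one]

theorem altProd_mul_altProd (k : ℕ) {i : ℕ} (hi : i < 2 * k) :
    altProd k (2 * k - 1 - i) * altProd k i = altProd k (2 * k - 1) := by
  induction i with
  | zero => simp
  | succ i ih =>
    obtain ⟨m, hm⟩ : ∃ m, 2 * k - 1 - i = m + 1 := ⟨2 * k - 1 - i - 1, by omega⟩
    have hp : ((-1) ^ m : ℤ) = (-1) ^ i := by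
      apply neg_one_pow_congr
      rw [Nat.even_iff, Nat.even_iff]
      omega
    rw [← ih (by omega), hm, altProd_succ, show 2 * k - 1 - (i + 1) = m by omega, altProd_succ, hp,
      show zigUnit k (m + 1) = zigUnit k (i + 1) by
        rw [← zigUnit_reflect k (i := i + 1) (by omega)]
        congr 1
        omega]
    exact (mul_assoc _ _ _).symm.trans (mul_right_comm _ _ _)

/-- The image `s` of `1 / L` under the substitution `X ↦ X s ^ 2`. -/
noncomputable def rootUnit (k : ℕ) : LabelRing⟦X⟧ˣ := altProd k (2 * k - 1)

theorem rootUnit_eq {k : ℕ} (hk : 1 ≤ k) : rootUnit k = altProd k k * altProd k (k - 1) := by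
  rw [rootUnit, ← altProd_mul_altProd k (i := k - 1) (by omega)]
  congr 2
  omega

/-- The sum telescopes, as `q_{2m+1} = q_{2m} - X x_{m+1}`. -/
theorem one_sub_sum_altProd (k m : ℕ) :
    (1 : LabelRing⟦X⟧) -
      ∑ d ∈ Finset.Icc 1 m, X * (C (MvPolynomial.X d) * (altProd k (2 * d - 2)).val) =
      altProd k (2 * m - 1) := by
  induction m with
  | zero => simp
  | succ m ih =>
    rw [Finset.sum_Icc_succ_top (by omega), ← sub_sub, ih, ← altProd_two_mul_mul,
      show 2 * (m + 1) - 1 = 2 * m + 1 by omega, show 2 * (m + 1) - 2 = 2 * m by omega,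
      altProd_two_mul_add_one, Units.val_mul, Units.val_mul, altUnit_succ, zigzag_odd,
      Odd.neg_one_pow (by simp)]
    ring

/-- The explicit solution of the functional equations in which `X s ^ 2` marks a vertex. -/
theorem isTreeSystem_altProd (k : ℕ) :
    IsTreeSystem k (fun d => C (MvPolynomial.X d)) (X * (rootUnit k ^ 2).val)
      ((rootUnit k)⁻¹).val (fun h => ((rootUnit k)⁻¹ * altProd k (2 * h - 2)).val) := by
  have hsum : ∀ m, ∑ d ∈ Finset.Icc 1 m, X * (rootUnit k ^ 2).val *
      (C (MvPolynomial.X d : LabelRing) *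
      (((rootUnit k)⁻¹).val * ((rootUnit k)⁻¹ * altProd k (2 * d - 2)).val)) =
      1 - (altProd k (2 * m - 1)).val := by
    intro m
    rw [← one_sub_sum_altProd, sub_sub_cancel]
    refine Finset.sum_congr rfl fun d _ => ?_
    have h : (rootUnit k).val * ((rootUnit k)⁻¹).val = 1 := Units.mul_inv _
    rw [Units.val_mul, Units.val_pow_eq_pow_val]
    linear_combination (X * C (MvPolynomial.X d) * (altProd k (2 * d - 2)).val) *
      ((rootUnit k).val * ((rootUnit k)⁻¹).val + 1) * h
  constructor
  · rw [hsum]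
    have h : ((rootUnit k)⁻¹).val * (rootUnit k).val = 1 := Units.inv_mul _
    rw [rootUnit] at h ⊢
    linear_combination h
  · intro h hh
    rw [Finset.mem_Icc] at hh
    rw [hsum]
    have e : (rootUnit k)⁻¹ * altProd k (2 * h - 2) * altProd k (2 * (k + 1 - h) - 1) = 1 := by
      rw [mul_assoc, mul_comm (altProd k _), inv_mul_eq_one,
        show 2 * (k + 1 - h) - 1 = 2 * k - 1 - (2 * h - 2) by omega,
        altProd_mul_altProd k (by omega), rootUnit]
    have e' := congrArg Units.val e
    rw [Units.val_mul, Units.val_one] at e'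
    linear_combination e'

/-! ### The coefficients of the generating functions -/

theorem IsTreeSystem.substXMul_eq {k : ℕ} {L : LabelRing⟦X⟧} {F : ℕ → LabelRing⟦X⟧}
    (hs : IsTreeSystem k (fun d => C (MvPolynomial.X d)) X L F) :
    substXMul (rootUnit k ^ 2).val L = ((rootUnit k)⁻¹).val ∧ ∀ h ∈ Finset.Icc 1 k,
      substXMul (rootUnit k ^ 2).val (F h) = ((rootUnit k)⁻¹ * altProd k (2 * h - 2)).val := by
  have h := hs.map (substXMul (rootUnit k ^ 2).val)
  simp only [substXMul_X, substXMul_C] at h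
  exact h.unique (dvd_mul_right _ _) (isTreeSystem_altProd k)

/-- Lagrange inversion for the substitution `X ↦ X s ^ 2`. -/
theorem monoCoeff_eq_of_substXMul_eq {s u : LabelRing⟦X⟧ˣ} {f : LabelRing⟦X⟧}
    (hf : substXMul (s ^ 2).val f = u.val) (n : ℕ) (l : ℕ →₀ ℕ) :
    monoCoeff n l f = monoCoeff n l ((u * s ^ (-(2 * n : ℤ))).val *
      (1 + 2 * dlog (euler LabelRing) s)) := by
  rw [monoCoeff_apply, coeff_eq_coeff_substXMul (s ^ 2) f n, hf, monoCoeff_apply, ← mul_assoc,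
    ← Units.val_mul]
  have h1 : dlog (euler LabelRing) (s ^ 2) = 2 * dlog (euler LabelRing) s := by
    rw [pow_two, dlog_mul, two_mul]
  have h2 : (s ^ 2) ^ (-(n : ℤ)) = s ^ (-(2 * n : ℤ)) := by
    rw [← zpow_natCast s 2, ← zpow_mul]
    congr 1
    push_cast
    ring
  rw [h1, h2]

/-- If `f` becomes `s ^ a`, its coefficients are multiples of those of a power of `s`. -/
theorem monoCoeff_eq_of_substXMul_eq_pow {s : LabelRing⟦X⟧ˣ} {f : LabelRing⟦X⟧} {a : ℤ}
    (hf : substXMul (s ^ 2).val f = (s ^ a).val) (n : ℕ) (l : ℕ →₀ ℕ) :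
    (a - 2 * n : ℚ) * monoCoeff n l f = a * monoCoeff n l (s ^ (a - 2 * n : ℤ)).val := by
  have h := monoCoeff_euler n l (s ^ (a - 2 * n : ℤ)).val
  rw [apply_unit, dlog_zpow, mul_left_comm, monoCoeff_intCast_mul] at h
  rw [monoCoeff_eq_of_substXMul_eq hf, ← zpow_add, ← sub_eq_add_neg, mul_add, mul_one, map_add,
    mul_left_comm, ← Nat.cast_two (R := LabelRing⟦X⟧), monoCoeff_natCast_mul]
  push_cast at h ⊢
  linear_combination 2 * h

/-- The total generating function, in terms of `g = 1 / L`. -/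
theorem IsTreeSystem.exists_sum_eq {k : ℕ} {L : LabelRing⟦X⟧} {F : ℕ → LabelRing⟦X⟧}
    (hs : IsTreeSystem k (fun d => C (MvPolynomial.X d)) X L F) :
    ∃ g : LabelRing⟦X⟧, substXMul (rootUnit k ^ 2).val g = rootUnit k ∧
      ∑ h ∈ Finset.Icc 1 k, X * (C (MvPolynomial.X h) * F h) = g - g ^ 2 := by
  have hL := hs.left
  set S := ∑ d ∈ Finset.Icc 1 k, X * (C (MvPolynomial.X d) * (L * F d)) with hS
  refine ⟨1 - S, ?_, ?_⟩
  · have h1 : L * (1 - S) = 1 := by linear_combination hL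
    have h2 := congrArg (substXMul (rootUnit k ^ 2).val) h1
    rw [map_mul, map_one, hs.substXMul_eq.1] at h2
    have h3 : (rootUnit k).val * ((rootUnit k)⁻¹).val = 1 := Units.mul_inv _
    linear_combination (rootUnit k).val * h2 - (substXMul (rootUnit k ^ 2).val (1 - S)) * h3
  · have h : S = L * ∑ h ∈ Finset.Icc 1 k, X * (C (MvPolynomial.X h) * F h) := by
      rw [hS, Finset.mul_sum]
      exact Finset.sum_congr rfl fun d _ => by ring
    linear_combination (-(1 - S)) * h -
      (∑ h ∈ Finset.Icc 1 k, X * (C (MvPolynomial.X h) * F h)) * hL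

/-- The coefficients of the total generating function. -/
theorem IsTreeSystem.monoCoeff_sum_eq {k : ℕ} {L : LabelRing⟦X⟧} {F : ℕ → LabelRing⟦X⟧}
    (hs : IsTreeSystem k (fun d => C (MvPolynomial.X d)) X L F) {n : ℕ} (hn : 1 < n)
    (l : ℕ →₀ ℕ) :
    monoCoeff n l (∑ h ∈ Finset.Icc 1 k, X * (C (MvPolynomial.X h) * F h)) =
      1 / (n - 1) * monoCoeff n l (rootUnit k ^ (-((2 * n - 2 : ℕ) : ℤ))).val -
      1 / (2 * n - 1) * monoCoeff n l (rootUnit k ^ (-((2 * n - 1 : ℕ) : ℤ))).val := by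
  obtain ⟨g, hg, hsum⟩ := hs.exists_sum_eq
  have h1 := monoCoeff_eq_of_substXMul_eq_pow (a := 1) (hg.trans (by rw [zpow_one])) n l
  have hg2 : substXMul (rootUnit k ^ 2).val (g ^ 2) = (rootUnit k ^ (2 : ℤ)).val := by
    rw [map_pow, hg]
    norm_cast
  have h2 := monoCoeff_eq_of_substXMul_eq_pow hg2 n l
  rw [show (1 - 2 * n : ℤ) = -((2 * n - 1 : ℕ) : ℤ) by omega] at h1
  rw [show (2 - 2 * n : ℤ) = -((2 * n - 2 : ℕ) : ℤ) by omega] at h2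
  have hn' : (1 : ℚ) < n := by exact_mod_cast hn
  have hn1 : (n : ℚ) - 1 ≠ 0 := by linarith
  have hn2 : 2 * (n : ℚ) - 1 ≠ 0 := by linarith
  rw [hsum, map_sub]
  push_cast at h1 h2
  have e1 : ((n : ℚ) - 1) * (1 / (n - 1)) = 1 := mul_one_div_cancel hn1
  have e2 : (2 * (n : ℚ) - 1) * (1 / (2 * n - 1)) = 1 := mul_one_div_cancel hn2
  apply mul_left_cancel₀ hn1
  apply mul_left_cancel₀ hn2
  linear_combination (-(n - 1 : ℚ)) * h1 + (2 * n - 1 : ℚ) / 2 * h2 -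
    (2 * n - 1 : ℚ) * monoCoeff n l (rootUnit k ^ (-((2 * n - 2 : ℕ) : ℤ))).val * e1 +
    (n - 1 : ℚ) * monoCoeff n l (rootUnit k ^ (-((2 * n - 1 : ℕ) : ℤ))).val * e2

/-- The alternating sum `q_1⁻¹ - q_2⁻¹ + ⋯ ± q_i⁻¹`, part of the logarithmic derivatives of
`altProd k i`. -/
noncomputable def altInvSum (k i : ℕ) : LabelRing⟦X⟧ :=
  ∑ j ∈ Finset.Icc 1 i, (-1) ^ (j + 1) * ((zigUnit k j)⁻¹).val

theorem altInvSum_succ (k i : ℕ) :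
    altInvSum k (i + 1) = altInvSum k i + (-1) ^ i * ((zigUnit k (i + 1))⁻¹).val := by
  rw [altInvSum, Finset.sum_Icc_succ_top (by omega), altInvSum, pow_succ, pow_succ]
  simp

theorem dlog_euler_altProd (k i : ℕ) :
    dlog (euler LabelRing) (altProd k i) = (if Even i then 0 else 1) - altInvSum k i := by
  induction i with
  | zero => simp [altInvSum]
  | succ i ih =>
    rw [altProd_succ, dlog_mul, ih, dlog_zpow, dlog_euler_altUnit, altInvSum_succ]
    rcases Nat.even_or_odd i with h | h
    · rw [if_pos h, if_neg (by simpa [Nat.even_add_one] using h), h.neg_one_pow, h.neg_one_pow]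
      push_cast
      ring
    · rw [if_neg (Nat.not_even_iff_odd.mpr h), if_pos h.add_one, h.neg_one_pow, h.neg_one_pow]
      push_cast
      ring

/-- Only the factors `q_j` with `i < j` contain the variable of the label `zigzag k (i + 1)`. -/
theorem dlog_labelDeriv_altProd {k i m : ℕ} (hi : i + 1 ≤ k) (him : i ≤ m) (hm : m ≤ k) :
    dlog (labelDeriv (zigzag k (i + 1))) (altProd k m) =
      (-1) ^ (i + 1) * (X * (altInvSum k m - altInvSum k i)) := by
  have hz := zigzag_injOn k
  induction m, him using Nat.le_induction with
  | base =>
    rw [sub_self, mul_zero, mul_zero, altProd, dlog_prod, Finset.sum_eq_zero]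
    intro j hj
    rw [Finset.mem_Icc] at hj
    rw [dlog_zpow, dlog_labelDeriv_altUnit hz ⟨by omega, hi⟩ (by omega), if_neg (by omega),
      mul_zero]
  | succ m him ih =>
    rw [altProd_succ, dlog_mul, ih (by omega), dlog_zpow,
      dlog_labelDeriv_altUnit hz ⟨by omega, hi⟩ hm, if_pos (by omega), altInvSum_succ]
    push_cast
    ring

theorem dlog_euler_rootUnit {k : ℕ} (hk : 1 ≤ k) :
    dlog (euler LabelRing) (rootUnit k) = 1 - (altInvSum k k + altInvSum k (k - 1)) := by
  obtain ⟨k, rfl⟩ : ∃ m, k = m + 1 := ⟨k - 1, by omega⟩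
  rw [rootUnit_eq hk, dlog_mul, dlog_euler_altProd, dlog_euler_altProd, Nat.add_sub_cancel]
  simp only [Nat.even_add_one]
  split_ifs <;> ring

theorem dlog_labelDeriv_rootUnit {k i : ℕ} (hi : i + 1 ≤ k) :
    dlog (labelDeriv (zigzag k (i + 1))) (rootUnit k) =
      (-1) ^ (i + 1) * (X * (altInvSum k k + altInvSum k (k - 1) - 2 * altInvSum k i)) := by
  rw [rootUnit_eq (by omega), dlog_mul, dlog_labelDeriv_altProd hi (by omega) le_rfl,
    dlog_labelDeriv_altProd hi (by omega) (by omega)]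
  ring

/-- The product of powers of the units `q_j` whose coefficients are the two products of binomial
coefficients in the number of trees with root label `zigzag k (i + 1)`. -/
noncomputable def rootedProd (k i b : ℕ) : LabelRing⟦X⟧ˣ :=
  rootUnit k ^ (-(b : ℤ)) * altProd k i ^ ((-1) ^ i : ℤ)

/-- The series for the root label `zigzag k (i + 1)`, after the substitution. -/
theorem inv_rootUnit_mul_altProd_zigzag {k i : ℕ} (hi : i + 1 ≤ k) :
    (rootUnit k)⁻¹ * altProd k (2 * zigzag k (i + 1) - 2) =
      rootUnit k ^ (-(if Even i then 1 else 0 : ℤ)) * altProd k i ^ ((-1) ^ i : ℤ) := by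
  rcases Nat.even_or_odd i with h | h
  · obtain ⟨m, rfl⟩ := h.two_dvd
    rw [zigzag_odd, if_pos h, h.neg_one_pow, zpow_one, zpow_neg_one]
    rfl
  · obtain ⟨m, rfl⟩ := h
    rw [if_neg (by simp), Odd.neg_one_pow (by simp), neg_zero, zpow_zero, one_mul, zpow_neg_one,
      show 2 * m + 1 + 1 = 2 * (m + 1) by ring, zigzag_even, inv_mul_eq_iff_eq_mul, rootUnit,
      ← altProd_mul_altProd k (i := 2 * m + 1) (by omega), mul_inv_cancel_right]
    congr 1
    omega

/-- The coefficients of the generating function of the trees with root label `zigzag k (i + 1)`.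
Lagrange inversion expresses them by the series `G`, `G Σ` and `G D`, where `G` is `rootedProd` and
`Σ` and `D` are sums of inverses of the `q_j`; comparing the coefficients of the Euler operator and
of the partial derivative by the root label, applied to `G`, eliminates `G Σ` and `G D`. -/
theorem IsTreeSystem.monoCoeff_eq {k : ℕ} {L : LabelRing⟦X⟧} {F : ℕ → LabelRing⟦X⟧}
    (hs : IsTreeSystem k (fun d => C (MvPolynomial.X d)) X L F) {i : ℕ} (hi : i + 1 ≤ k)
    {N b : ℕ} (hN : 0 < N) (hb : b = 2 * N + if Even i then 1 else 0) (l : ℕ →₀ ℕ) :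
    monoCoeff N l (F (zigzag k (i + 1))) =
      1 / (4 * N + 1) * (2 * (l (zigzag k (i + 1)) + 1) / b * monoCoeff (N + 1)
          (l + Finsupp.single (zigzag k (i + 1)) 1) (rootedProd k i b).val -
        monoCoeff N l (rootedProd k i b).val) := by
  have hz : zigzag k (i + 1) ∈ Finset.Icc 1 k := by
    simp only [zigzag, Nat.even_iff, Finset.mem_Icc]
    split_ifs <;> omega
  have hlag := monoCoeff_eq_of_substXMul_eq
    ((hs.substXMul_eq.2 _ hz).trans (congrArg _ (inv_rootUnit_mul_altProd_zigzag hi))) N l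
  have hG : rootUnit k ^ (-(if Even i then 1 else 0 : ℤ)) * altProd k i ^ ((-1) ^ i : ℤ) *
      rootUnit k ^ (-(2 * N : ℤ)) = rootedProd k i b := by
    rw [rootedProd, mul_right_comm, ← zpow_add, hb]
    congr 2
    push_cast
    ring
  rw [hG, dlog_euler_rootUnit (by omega)] at hlag
  set G := rootedProd k i b with hGdef
  set T := altInvSum k k + altInvSum k (k - 1) with hT
  set D := altInvSum k i with hD
  have hE := monoCoeff_euler N l G.val
  have hP := monoCoeff_labelDeriv (N + 1) (zigzag k (i + 1)) l G.val
  rw [apply_unit, hGdef, rootedProd, dlog_mul, dlog_zpow, dlog_zpow, ← rootedProd, ← hGdef] at hE hP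
  rw [dlog_euler_rootUnit (by omega), dlog_euler_altProd, ← hT, ← hD] at hE
  rw [dlog_labelDeriv_rootUnit hi, dlog_labelDeriv_altProd hi le_rfl (by omega), ← hT, ← hD] at hP
  set g := monoCoeff N l G.val
  set gT := monoCoeff N l (G.val * T) with hgT
  set gD := monoCoeff N l (G.val * D) with hgD
  have hb0 : (b : ℚ) ≠ 0 := by
    have : 0 < b := by omega
    positivity
  have hN1 : (4 * N + 1 : ℚ) ≠ 0 := by positivity
  have e1 : G.val * (1 + 2 * (1 - T)) = ((3 : ℕ) : LabelRing⟦X⟧) * G.val -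
      ((2 : ℕ) : LabelRing⟦X⟧) * (G.val * T) := by push_cast; ring
  rw [e1, map_sub, monoCoeff_natCast_mul, monoCoeff_natCast_mul] at hlag
  have e2 : G.val * (((-b : ℤ) : LabelRing⟦X⟧) * ((-1) ^ (i + 1) * (X * (T - 2 * D))) +
      (((-1) ^ i : ℤ) : LabelRing⟦X⟧) * ((-1) ^ (i + 1) * (X * (D - D)))) =
      ((b * (-1) ^ i : ℤ) : LabelRing⟦X⟧) * (X * (G.val * T)) -
      ((2 * b * (-1) ^ i : ℤ) : LabelRing⟦X⟧) * (X * (G.val * D)) := by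
    push_cast
    ring
  rw [e2, map_sub, monoCoeff_intCast_mul, monoCoeff_intCast_mul, monoCoeff_X_mul,
    monoCoeff_X_mul] at hP
  rw [hlag]
  rcases Nat.even_or_odd i with h | h
  · rw [if_pos h] at hE hb
    have e3 : G.val * (((-b : ℤ) : LabelRing⟦X⟧) * (1 - T) +
        (((-1) ^ i : ℤ) : LabelRing⟦X⟧) * (0 - D)) =
        ((b : ℤ) : LabelRing⟦X⟧) * (G.val * T) - ((b : ℤ) : LabelRing⟦X⟧) * G.val - G.val * D := by
      rw [h.neg_one_pow]
      push_cast
      ring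
    rw [e3, map_sub, map_sub, monoCoeff_intCast_mul, monoCoeff_intCast_mul] at hE
    rw [h.neg_one_pow] at hP
    have hbq : (b : ℚ) = 2 * N + 1 := by rw [hb]; push_cast; ring
    push_cast at hE hP ⊢
    field_simp
    rw [hbq] at hE hP ⊢
    linear_combination 2 * hP - 4 * (2 * N + 1) * hE
  · have h' := Nat.not_even_iff_odd.mpr h
    rw [if_neg h'] at hE hb
    have e3 : G.val * (((-b : ℤ) : LabelRing⟦X⟧) * (1 - T) +
        (((-1) ^ i : ℤ) : LabelRing⟦X⟧) * (1 - D)) =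
        ((b : ℤ) : LabelRing⟦X⟧) * (G.val * T) - ((b + 1 : ℤ) : LabelRing⟦X⟧) * G.val +
          G.val * D := by
      rw [h.neg_one_pow]
      push_cast
      ring
    rw [e3, map_add, map_sub, monoCoeff_intCast_mul, monoCoeff_intCast_mul] at hE
    rw [h.neg_one_pow] at hP
    have hbq : (b : ℚ) = 2 * N := by rw [hb]; push_cast; ring
    push_cast at hE hP ⊢
    field_simp
    rw [hbq] at hE hP ⊢
    linear_combination 2 * hP - 4 * (2 * N) * hE

/-! ### Evaluation of the coefficients -/

theorem neg_one_pow_mul_choose_neg {x : ℕ} (hx : 1 ≤ x) (m : ℕ) :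
    (-1 : ℤ) ^ m * Ring.choose (-(x : ℤ)) m = (x + m - 1).choose m := by
  rw [Ring.choose_neg, Units.smul_def, smul_eq_mul, ← mul_assoc, Int.coe_negOnePow_natCast,
    ← pow_add, Even.neg_one_pow (by simp), one_mul,
    show (x : ℤ) + m - 1 = ((x + m - 1 : ℕ) : ℤ) by omega,
    Ring.choose_natCast]

theorem sum_neg_one_pow_Icc (j m : ℕ) (hj : j ≤ m + 1) :
    ∑ i ∈ Finset.Icc j m, (-1 : ℤ) ^ (i + 1) = if Even (j + m) then (-1) ^ (j + 1) else 0 := by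
  rcases Nat.lt_or_ge m j with h | h
  · obtain rfl : j = m + 1 := by omega
    rw [Finset.Icc_eq_empty (by omega), Finset.sum_empty, if_neg]
    rw [Nat.even_iff]; omega
  · induction m, h using Nat.le_induction with
    | base => simp
    | succ m hm ih =>
      rw [Finset.sum_Icc_succ_top (by omega), ih (by omega)]
      simp only [← add_assoc, Nat.even_add_one]
      split_ifs with h
      · have : Even (j + m) := h
        rw [show ((-1 : ℤ) ^ (m + 1 + 1)) = (-1) ^ j from
          neg_one_pow_congr (by rw [Nat.even_iff] at *; rw [Nat.even_iff]; omega), pow_succ]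
        ring
      · rw [zero_add]
        exact neg_one_pow_congr (by rw [Nat.even_iff] at *; rw [Nat.even_iff]; omega)

theorem rootedProd_eq_prod {k i : ℕ} (hi : i + 1 ≤ k) (b : ℕ) :
    rootedProd k i b = ∏ j ∈ Finset.Icc 1 k, altUnit (zigzag k) j ^
      (-(b : ℤ) * ((-1) ^ (j + 1) + if j ≤ k - 1 then (-1) ^ (j + 1) else 0) +
        (-1) ^ i * if j ≤ i then (-1) ^ (j + 1) else 0 : ℤ) := by
  have hP : ∀ m ≤ k, ∀ a : ℤ, altProd k m ^ a = ∏ j ∈ Finset.Icc 1 k, altUnit (zigzag k) j ^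
      (a * if j ≤ m then (-1) ^ (j + 1) else 0 : ℤ) := by
    intro m hm a
    rw [altProd, ← Finset.prod_zpow,
      ← Finset.prod_subset (s₁ := Finset.Icc 1 m) (Finset.Icc_subset_Icc_right hm)]
    · refine Finset.prod_congr rfl fun j hj => ?_
      rw [if_pos (Finset.mem_Icc.mp hj).2, ← zpow_mul, mul_comm]
    · intro j hj hj'
      rw [Finset.mem_Icc] at hj hj'
      rw [if_neg (by omega), mul_zero, zpow_zero]
  rw [rootedProd, rootUnit_eq (by omega), mul_zpow, hP k le_rfl, hP (k - 1) (by omega),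
    hP i (by omega), ← Finset.prod_mul_distrib, ← Finset.prod_mul_distrib]
  refine Finset.prod_congr rfl fun j hj => ?_
  rw [if_pos (Finset.mem_Icc.mp hj).2, ← zpow_add, ← zpow_add, mul_add]

theorem sum_Icc_ite_le (j k m : ℕ) (hm : m ≤ k) (f : ℕ → ℤ) :
    ∑ x ∈ Finset.Icc j k, (if x ≤ m then f x else 0) = ∑ x ∈ Finset.Icc j m, f x := by
  rw [← Finset.sum_filter]
  congr 1
  ext x
  simp only [Finset.mem_filter, Finset.mem_Icc]
  omega

/-- The coefficients of `rootedProd k i b`. -/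
theorem monoCoeff_rootedProd {k i : ℕ} (hi : i + 1 ≤ k) {b : ℕ} (hb : 1 ≤ b) (c : ℕ → ℕ)
    (hc : ∀ j ∈ Finset.Icc 1 k, Even j →
      (if j ≤ i ∧ Even (i + j) then 1 else 0) + ∑ x ∈ Finset.Icc (j + 1) k, c x ≤ b) :
    monoCoeff (∑ j ∈ Finset.Icc 1 k, c j) (expVec (zigzag k) c k) (rootedProd k i b).val =
      ∏ j ∈ Finset.Icc 1 k,
        ((if Even j then b - ((if j ≤ i ∧ Even (i + j) then 1 else 0) +
            ∑ x ∈ Finset.Icc (j + 1) k, c x)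
          else b + (if j ≤ i ∧ Even (i + j) then 1 else 0) + ∑ x ∈ Finset.Icc j k, c x - 1).choose
            (c j) : ℚ) := by
  rw [rootedProd_eq_prod hi, monoCoeff_prod_altUnit_zpow _ _ _ (zigzag_injOn k)]
  refine Finset.prod_congr rfl fun j hj => ?_
  have hcj := hc j hj
  rw [Finset.mem_Icc] at hj
  have hsum : ∑ x ∈ Finset.Icc j k,
      (-(b : ℤ) * ((-1) ^ (x + 1) + if x ≤ k - 1 then (-1) ^ (x + 1) else 0) +
        (-1) ^ i * if x ≤ i then (-1) ^ (x + 1) else 0 : ℤ) =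
      (-1) ^ j * b - if j ≤ i ∧ Even (i + j) then 1 else 0 := by
    rw [Finset.sum_add_distrib, ← Finset.mul_sum, ← Finset.mul_sum, Finset.sum_add_distrib,
      sum_Icc_ite_le j k (k - 1) (by omega), sum_Icc_ite_le j k i (by omega),
      sum_neg_one_pow_Icc j k (by omega), sum_neg_one_pow_Icc j (k - 1) (by omega)]
    have h1 : ((if Even (j + k) then (-1) ^ (j + 1) else 0) +
        if Even (j + (k - 1)) then (-1) ^ (j + 1) else 0 : ℤ) = -(-1) ^ j := by
      have : Even (j + (k - 1)) ↔ ¬Even (j + k) := by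
        rw [Nat.even_iff, Nat.even_iff]; omega
      simp only [this]
      split_ifs <;> ring
    have h2 : (-1) ^ i * ∑ x ∈ Finset.Icc j i, (-1 : ℤ) ^ (x + 1) =
        -if j ≤ i ∧ Even (i + j) then 1 else 0 := by
      rcases Nat.lt_or_ge i j with h | h
      · rw [Finset.Icc_eq_empty (by omega), if_neg (by omega)]
        simp
      · rw [sum_neg_one_pow_Icc j i (by omega)]
        simp only [h, true_and, add_comm i j]
        split_ifs with h'
        · rw [← pow_add, Odd.neg_one_pow]
          rw [Nat.even_iff] at h'; rw [Nat.odd_iff]; omega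
        · simp
    rw [h1, h2]
    ring
  rw [hsum]
  set β : ℕ := if j ≤ i ∧ Even (i + j) then 1 else 0 with hβ
  have hβ' : (if j ≤ i ∧ Even (i + j) then 1 else 0 : ℤ) = (β : ℤ) := by
    rw [hβ]; split_ifs <;> rfl
  rw [hβ']
  rcases Nat.even_or_odd j with h | h
  · have hcj := hcj h
    rw [if_pos h, h.neg_one_pow, (h.mul_right (c j)).neg_one_pow, one_mul, one_mul]
    rw [show ((b : ℤ) - β - ∑ x ∈ Finset.Icc (j + 1) k, (c x : ℤ)) =
      ((b - (β + ∑ x ∈ Finset.Icc (j + 1) k, c x) : ℕ) : ℤ) by push_cast [Nat.cast_sub hcj]; ring,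
      Ring.choose_natCast]
    norm_cast
  · rw [if_neg (Nat.not_even_iff_odd.mpr h), h.neg_one_pow, pow_mul, h.neg_one_pow]
    have := neg_one_pow_mul_choose_neg (x := b + β + ∑ x ∈ Finset.Icc (j + 1) k, c x)
      (by omega) (c j)
    rw [show (-1 * (b : ℤ) - β - ∑ x ∈ Finset.Icc (j + 1) k, (c x : ℤ)) =
      -((b + β + ∑ x ∈ Finset.Icc (j + 1) k, c x : ℕ) : ℤ) by push_cast; ring]
    rw [← Finset.add_sum_Ioc_eq_sum_Icc hj.2, ← Finset.Icc_succ_left_eq_Ioc, Nat.succ_eq_succ,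
      Nat.succ_eq_add_one,
      show b + β + (c j + ∑ x ∈ Finset.Icc (j + 1) k, c x) - 1 =
        b + β + ∑ x ∈ Finset.Icc (j + 1) k, c x + c j - 1 by omega]
    exact_mod_cast this

theorem prod_Icc_eq_prod_odd_mul_prod_even {M : Type*} [CommMonoid M] (f : ℕ → M) (k : ℕ) :
    ∏ i ∈ Finset.Icc 1 k, f i =
      (∏ r ∈ Finset.Icc 1 ((k + 1) / 2), f (2 * r - 1)) *
        ∏ r ∈ Finset.Icc 1 (k / 2), f (2 * r) := by
  induction k with
  | zero => simp
  | succ k ih =>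
    rw [Finset.prod_Icc_succ_top (by omega), ih]
    rcases Nat.even_or_odd' k with ⟨m, rfl | rfl⟩
    · rw [show (2 * m + 1 + 1) / 2 = m + 1 by omega, show (2 * m + 1) / 2 = m by omega,
        show 2 * m / 2 = m by omega, Finset.prod_Icc_succ_top (by omega),
        show 2 * (m + 1) - 1 = 2 * m + 1 by omega, mul_right_comm]
    · rw [show (2 * m + 1 + 1 + 1) / 2 = m + 1 by omega, show (2 * m + 1 + 1) / 2 = m + 1 by omega,
        show (2 * m + 1) / 2 = m by omega,
        Finset.prod_Icc_succ_top (b := m) (f := fun r => f (2 * r)) (by omega),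
        show 2 * (m + 1) = 2 * m + 1 + 1 by omega, mul_assoc]

theorem sum_zigzag_eq_outerSum {k r : ℕ} (hr : 2 * r ≤ k) (ℓ : ℕ → ℕ) :
    ∑ j ∈ Finset.Icc 1 (2 * r), ℓ (zigzag k j) = outerSum k ℓ r := by
  induction r with
  | zero => simp [outerSum]
  | succ r ih =>
    rw [show 2 * (r + 1) = 2 * r + 1 + 1 by ring, Finset.sum_Icc_succ_top (by omega),
      Finset.sum_Icc_succ_top (by omega), ih (by omega), zigzag_odd,
      show 2 * r + 1 + 1 = 2 * (r + 1) by ring, zigzag_even, outerSum, outerSum,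
      Finset.sum_Icc_succ_top (by omega), show k + 1 - r = k + 1 - (r + 1) + 1 by omega,
      ← Finset.add_sum_Ioc_eq_sum_Icc (a := k + 1 - (r + 1)) (by omega),
      ← Finset.Icc_succ_left_eq_Ioc, Nat.succ_eq_succ, Nat.succ_eq_add_one]
    ring

theorem sum_zigzag (k : ℕ) {M : Type*} [AddCommMonoid M] (f : ℕ → M) :
    ∑ i ∈ Finset.Icc 1 k, f (zigzag k i) = ∑ j ∈ Finset.Icc 1 k, f j := by
  have himg : (Finset.Icc 1 k).image (zigzag k) = Finset.Icc 1 k := by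
    apply Finset.eq_of_subset_of_card_le
    · intro x hx
      obtain ⟨i, hi, rfl⟩ := Finset.mem_image.mp hx
      rw [Finset.mem_Icc] at hi ⊢
      simp only [zigzag, Nat.even_iff]
      split_ifs <;> omega
    · rw [Finset.card_image_of_injOn]
      simpa using zigzag_injOn k
  conv_rhs => rw [← himg, Finset.sum_image (by simpa using zigzag_injOn k)]

/-- The exponent vector with the multiplicities `ℓ 1, …, ℓ k` of the labels. -/
noncomputable def labelVec (k : ℕ) (ℓ : ℕ → ℕ) : ℕ →₀ ℕ :=
  ∑ j ∈ Finset.Icc 1 k, Finsupp.single j (ℓ j)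

theorem expVec_zigzag (k : ℕ) (ℓ : ℕ → ℕ) :
    expVec (zigzag k) (fun i => ℓ (zigzag k i)) k = labelVec k ℓ := by
  exact sum_zigzag k fun j => Finsupp.single j (ℓ j)

theorem labelVec_apply {k h : ℕ} (hh : h ∈ Finset.Icc 1 k) (ℓ : ℕ → ℕ) : labelVec k ℓ h = ℓ h := by
  rw [labelVec, Finsupp.finsetSum_apply, Finset.sum_eq_single_of_mem h hh]
  · simp
  · intro j _ hj
    simp [hj.symm]

theorem sum_Icc_zigzag_add_outerSum {k n r : ℕ} (hr : 2 * r ≤ k) {ℓ : ℕ → ℕ}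
    (hℓ : ∑ i ∈ Finset.Icc 1 k, ℓ i = n) :
    ∑ j ∈ Finset.Icc (2 * r + 1) k, ℓ (zigzag k j) + outerSum k ℓ r = n := by
  rw [← sum_zigzag_eq_outerSum hr, ← hℓ, ← sum_zigzag k ℓ, add_comm]
  have := Finset.sum_Ioc_consecutive (fun j => ℓ (zigzag k j)) (Nat.zero_le (2 * r)) hr
  simpa only [← Finset.Icc_succ_left_eq_Ioc, Nat.succ_eq_succ, Nat.succ_eq_add_one,
    zero_add] using this

theorem prod_Icc_split {m R : ℕ} (hm : m ≤ R) {M : Type*} [CommMonoid M] (f : ℕ → M) :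
    ∏ r ∈ Finset.Icc 1 R, f r = (∏ r ∈ Finset.Icc 1 m, f r) * ∏ r ∈ Finset.Icc (m + 1) R, f r := by
  have := Finset.prod_Ioc_consecutive f (Nat.zero_le m) hm
  simpa only [← Finset.Icc_succ_left_eq_Ioc, Nat.succ_eq_succ, Nat.succ_eq_add_one,
    zero_add] using this.symm

/-- The coefficients of `rootedProd` at the multiplicities of the labels, in terms of `outerSum`. -/
theorem monoCoeff_rootedProd_labelVec {k n i b : ℕ} (hi : i + 1 ≤ k) (hn : 1 ≤ n) {ℓ : ℕ → ℕ}
    (hℓ : ∑ i ∈ Finset.Icc 1 k, ℓ i = n) (hb : n + (if i ≠ 0 ∧ Even i then 1 else 0) ≤ b) :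
    monoCoeff n (labelVec k ℓ) (rootedProd k i b).val =
      (∏ r ∈ Finset.Icc 1 ((k + 1) / 2),
        ((b + (if 2 * r - 1 ≤ i ∧ Odd i then 1 else 0) + n - 1 -
          outerSum k ℓ (r - 1)).choose (ℓ r) : ℚ)) *
      ∏ r ∈ Finset.Icc 1 (k / 2),
        ((b - (if 2 * r ≤ i ∧ Even i then 1 else 0) - n + outerSum k ℓ r).choose
           (ℓ (k + 1 - r)) : ℚ) := by
  have hsum : ∀ r, 2 * r ≤ k →
      ∑ j ∈ Finset.Icc (2 * r + 1) k, ℓ (zigzag k j) + outerSum k ℓ r = n := fun r hr =>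
    sum_Icc_zigzag_add_outerSum hr hℓ
  have h := monoCoeff_rootedProd hi (b := b) (by omega) (fun j => ℓ (zigzag k j)) (by
    intro j hj hje
    obtain ⟨r, rfl⟩ := hje.two_dvd
    rw [Finset.mem_Icc] at hj
    have := hsum r hj.2
    simp only [Nat.even_add, even_two, Even.mul_right, iff_true]
    by_cases h1 : 2 * r ≤ i ∧ Even i
    · rw [if_pos ⟨by omega, h1.2⟩] at hb
      rw [if_pos h1]
      omega
    · rw [if_neg h1]
      omega)
  rw [sum_zigzag k ℓ, hℓ, expVec_zigzag, prod_Icc_eq_prod_odd_mul_prod_even] at h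
  rw [h]
  congr 1
  · refine Finset.prod_congr rfl fun r hr => ?_
    rw [Finset.mem_Icc] at hr
    obtain ⟨r, rfl⟩ : ∃ m, r = m + 1 := ⟨r - 1, by omega⟩
    have := hsum r (by omega)
    rw [show 2 * (r + 1) - 1 = 2 * r + 1 by omega, if_neg (by simp), zigzag_odd,
      Nat.add_sub_cancel]
    have he : Even (i + (2 * r + 1)) ↔ Odd i := by
      rw [Nat.even_iff, Nat.odd_iff]; omega
    simp only [he]
    congr 2
    omega
  · refine Finset.prod_congr rfl fun r hr => ?_
    rw [Finset.mem_Icc] at hr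
    have := hsum r (by omega)
    rw [if_pos (by simp), zigzag_even]
    have he : Even (i + 2 * r) ↔ Even i := by
      rw [Nat.even_iff, Nat.even_iff]; omega
    simp only [he]
    congr 2
    split_ifs at hb ⊢ <;> grind

/-- The coefficients of `rootedProd` after one vertex with the label `zigzag k (i + 1)` is
removed. -/
theorem monoCoeff_rootedProd_labelVec_sub {k n i b : ℕ} (hi : i + 1 ≤ k) {ℓ : ℕ → ℕ}
    (hℓ : ∑ i ∈ Finset.Icc 1 k, ℓ i = n) (hb : n ≤ b) (hpos : 0 < ℓ (zigzag k (i + 1))) :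
    monoCoeff (n - 1) (labelVec k ℓ - Finsupp.single (zigzag k (i + 1)) 1) (rootedProd k i b).val =
      (∏ r ∈ Finset.Icc 1 ((k + 1) / 2),
        ((b + (if 2 * r - 1 ≤ i ∧ Odd i then 1 else 0) + n - 1 - outerSum k ℓ (r - 1) -
          (if 2 * r - 1 ≤ i + 1 then 1 else 0)).choose
            (ℓ r - if 2 * r - 1 = i + 1 then 1 else 0) : ℚ)) *
      ∏ r ∈ Finset.Icc 1 (k / 2),
        ((b - n + outerSum k ℓ r + (if 2 * r ≤ i ∧ Odd i then 1 else 0)).choose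
          (ℓ (k + 1 - r) - if 2 * r = i + 1 then 1 else 0) : ℚ) := by
  set c : ℕ → ℕ := fun j => ℓ (zigzag k j) - if j = i + 1 then 1 else 0 with hcdef
  have hsumc : ∀ a, ∑ j ∈ Finset.Icc a k, c j + (if a ≤ i + 1 then 1 else 0) =
      ∑ j ∈ Finset.Icc a k, ℓ (zigzag k j) := by
    intro a
    have h1 : (if a ≤ i + 1 then 1 else 0) = ∑ j ∈ Finset.Icc a k, if j = i + 1 then 1 else 0 := by
      rw [Finset.sum_ite_eq']
      simp only [Finset.mem_Icc, hi, and_true]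
    rw [h1, ← Finset.sum_add_distrib]
    refine Finset.sum_congr rfl fun j _ => ?_
    rw [hcdef]
    dsimp only
    split_ifs with hj
    · subst hj; omega
    · rfl
  have hvec : expVec (zigzag k) c k = labelVec k ℓ - Finsupp.single (zigzag k (i + 1)) 1 := by
    apply (eq_tsub_of_add_eq _)
    rw [← expVec_zigzag, expVec, expVec]
    have h1 : Finsupp.single (zigzag k (i + 1)) 1 =
        ∑ j ∈ Finset.Icc 1 k, Finsupp.single (zigzag k j) (if j = i + 1 then 1 else 0) := by
      rw [Finset.sum_eq_single_of_mem (i + 1) (by simp; omega)]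
      · simp
      · intro j _ hj; simp [hj]
    rw [h1, ← Finset.sum_add_distrib]
    refine Finset.sum_congr rfl fun j _ => ?_
    rw [← Finsupp.single_add, hcdef]
    congr 1
    dsimp only
    split_ifs with hj
    · subst hj; omega
    · rfl
  have hsum : ∀ r, 2 * r ≤ k →
      ∑ j ∈ Finset.Icc (2 * r + 1) k, c j + (if 2 * r + 1 ≤ i + 1 then 1 else 0) +
      outerSum k ℓ r = n := fun r hr => by rw [hsumc]; exact sum_Icc_zigzag_add_outerSum hr hℓ
  have htot : ∑ j ∈ Finset.Icc 1 k, c j = n - 1 := by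
    have := hsumc 1
    rw [sum_zigzag k ℓ, hℓ, if_pos (by omega)] at this
    omega
  have hn : 1 ≤ n := by
    rw [← hℓ]
    refine hpos.trans_le (Finset.single_le_sum (f := ℓ) (fun _ _ => Nat.zero_le _) ?_)
    simp only [zigzag, Nat.even_iff, Finset.mem_Icc]
    split_ifs <;> omega
  have h := monoCoeff_rootedProd hi (b := b) (by omega) c (by
    intro j hj hje
    obtain ⟨r, rfl⟩ := hje.two_dvd
    rw [Finset.mem_Icc] at hj
    have := hsum r hj.2
    split_ifs at this ⊢ <;> omega)
  rw [htot, hvec, prod_Icc_eq_prod_odd_mul_prod_even] at h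
  rw [h]
  congr 1
  · refine Finset.prod_congr rfl fun r hr => ?_
    rw [Finset.mem_Icc] at hr
    obtain ⟨r, rfl⟩ : ∃ m, r = m + 1 := ⟨r - 1, by omega⟩
    have := hsum r (by omega)
    rw [show 2 * (r + 1) - 1 = 2 * r + 1 by omega, if_neg (by simp),
      show c (2 * r + 1) = ℓ (r + 1) - if 2 * r + 1 = i + 1 then 1 else 0 by
        rw [← zigzag_odd k r], Nat.add_sub_cancel]
    have he : Even (i + (2 * r + 1)) ↔ Odd i := by
      rw [Nat.even_iff, Nat.odd_iff]; omega
    simp only [he]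
    congr 2
    omega
  · refine Finset.prod_congr rfl fun r hr => ?_
    rw [Finset.mem_Icc] at hr
    have := hsum r (by omega)
    rw [if_pos (by simp), show c (2 * r) = ℓ (k + 1 - r) - if 2 * r = i + 1 then 1 else 0 by
        rw [← zigzag_even k r]]
    have he : Even (i + 2 * r) ↔ ¬Odd i := by
      rw [Nat.even_iff, Nat.odd_iff]; omega
    simp only [he]
    congr 2
    by_cases h1 : 2 * r ≤ i <;> by_cases h2 : Odd i <;> simp [h1, h2] at this ⊢ <;> omega

/-! ### The closed formulas -/

theorem monoCoeff_X_mul_C_X_mul (n h : ℕ) (l : ℕ →₀ ℕ) (f : LabelRing⟦X⟧) :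
    monoCoeff (n + 1) l (X * (C (MvPolynomial.X h) * f)) =
      if l h = 0 then 0 else monoCoeff n (l - Finsupp.single h 1) f := by
  rw [monoCoeff_X_mul]
  split_ifs with hl
  · exact monoCoeff_C_X_mul_of_eq_zero n h l hl f
  · rw [monoCoeff_apply, coeff_C_mul, MvPolynomial.coeff_X_mul', if_pos (by simpa using hl),
      monoCoeff_apply]

theorem outerSum_le {k n r : ℕ} (hr : 2 * r ≤ k) {ℓ : ℕ → ℕ}
    (hℓ : ∑ i ∈ Finset.Icc 1 k, ℓ i = n) : outerSum k ℓ r ≤ n := by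
  have := sum_Icc_zigzag_add_outerSum hr hℓ
  omega

theorem choose_pred_pred_mul (M m : ℕ) (hM : 1 ≤ M) (hm : 1 ≤ m) :
    ((M - 1).choose (m - 1) : ℚ) * M = m * (M.choose m : ℚ) := by
  obtain ⟨M, rfl⟩ : ∃ a, M = a + 1 := ⟨M - 1, by omega⟩
  obtain ⟨m, rfl⟩ : ∃ a, m = a + 1 := ⟨m - 1, by omega⟩
  have := Nat.add_one_mul_choose_eq M m
  rw [Nat.add_sub_cancel, Nat.add_sub_cancel]
  rw [mul_comm, mul_comm ((m + 1 : ℕ) : ℚ)]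
  exact_mod_cast this

theorem prod_mul_eq_mul_prod {s : Finset ℕ} {a : ℕ} (ha : a ∈ s) {f g : ℕ → ℚ} {x y : ℚ}
    (h : ∀ r ∈ s, r ≠ a → f r = g r) (hxy : f a * x = y * g a) :
    (∏ r ∈ s, f r) * x = y * ∏ r ∈ s, g r := by
  rw [← Finset.mul_prod_erase s f ha, ← Finset.mul_prod_erase s g ha,
    Finset.prod_congr rfl fun r hr => h r (Finset.mem_of_mem_erase hr) (Finset.ne_of_mem_erase hr)]
  linear_combination (∏ r ∈ s.erase a, g r) * hxy

theorem IsTreeSystem.monoCoeff_root {k : ℕ} {L : LabelRing⟦X⟧} {F : ℕ → LabelRing⟦X⟧}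
    (hs : IsTreeSystem k (fun d => C (MvPolynomial.X d)) X L F) {i n b : ℕ} (hi : i + 1 ≤ k)
    (hn : 1 < n) (hb : b = 2 * n - 2 + if Even i then 1 else 0) {ℓ : ℕ → ℕ} {h : ℕ}
    (hh : zigzag k (i + 1) = h) (hh' : h ∈ Finset.Icc 1 k) :
    monoCoeff n (labelVec k ℓ) (X * (C (MvPolynomial.X h) * F h)) =
      if ℓ h = 0 then 0 else
      1 / (4 * n - 3) * (2 * ℓ h / b * monoCoeff n (labelVec k ℓ) (rootedProd k i b).val -
        monoCoeff (n - 1) (labelVec k ℓ - Finsupp.single (zigzag k (i + 1)) 1)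
          (rootedProd k i b).val) := by
  obtain ⟨N, rfl⟩ : ∃ N, n = N + 1 := ⟨n - 1, by omega⟩
  rw [monoCoeff_X_mul_C_X_mul, labelVec_apply hh']
  split_ifs with h0
  · rfl
  have hle : Finsupp.single h 1 ≤ labelVec k ℓ := by
    rw [Finsupp.single_le_iff, labelVec_apply hh']
    omega
  have := hs.monoCoeff_eq hi (N := N) (b := b) (by omega) (by rw [hb]; congr 1)
    (labelVec k ℓ - Finsupp.single h 1)
  rw [hh, tsub_add_cancel_of_le hle, Finsupp.tsub_apply, labelVec_apply hh',
    Finsupp.single_eq_same] at this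
  rw [this, hh, Nat.add_sub_cancel]
  have hl : ((ℓ h - 1 : ℕ) : ℚ) + 1 = ℓ h := by
    rw [Nat.cast_sub (by omega)]; simp
  rw [hl]
  push_cast
  ring

/-- The number of trees with a root label in the lower half. -/
theorem IsTreeSystem.monoCoeff_root_of_le {k n : ℕ} {L : LabelRing⟦X⟧} {F : ℕ → LabelRing⟦X⟧}
    (hs : IsTreeSystem k (fun d => C (MvPolynomial.X d)) X L F) (hn : 1 < n) {ℓ : ℕ → ℕ}
    (hℓ : ∑ i ∈ Finset.Icc 1 k, ℓ i = n) {h : ℕ} (hh : h ∈ Finset.Icc 1 k)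
    (hk : h ≤ (k + 1) / 2) :
    monoCoeff n (labelVec k ℓ) (X * (C (MvPolynomial.X h) * F h)) =
      (2 * ℓ h : ℚ) / ((2 * n - 1) * (4 * n - 3)) *
            (∏ r ∈ Finset.Icc 1 ((k + 1) / 2),
              ((3 * n - 2 - outerSum k ℓ (r - 1)).choose (ℓ r) : ℚ)) *
            (∏ r ∈ Finset.Icc 1 (h - 1),
              ((n - 2 + outerSum k ℓ r).choose (ℓ (k + 1 - r)) : ℚ)) *
            (∏ r ∈ Finset.Icc h (k / 2),
              ((n - 1 + outerSum k ℓ r).choose (ℓ (k + 1 - r)) : ℚ))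
          - (ℓ h : ℚ) / ((4 * n - 3) * (3 * n - 2 - outerSum k ℓ (h - 1))) *
            (∏ r ∈ Finset.Icc 1 (k / 2),
              ((n - 1 + outerSum k ℓ r).choose (ℓ (k + 1 - r)) : ℚ)) *
            (∏ r ∈ Finset.Icc 1 (h - 1),
              ((3 * n - 3 - outerSum k ℓ (r - 1)).choose (ℓ r) : ℚ)) *
            (∏ r ∈ Finset.Icc h ((k + 1) / 2),
              ((3 * n - 2 - outerSum k ℓ (r - 1)).choose (ℓ r) : ℚ)) := by
  obtain ⟨h1, h2⟩ := Finset.mem_Icc.mp hh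
  have hi : 2 * (h - 1) + 1 ≤ k := by omega
  have hev : Even (2 * (h - 1)) := by simp
  have hod : ¬Odd (2 * (h - 1)) := by simp
  have hz : zigzag k (2 * (h - 1) + 1) = h := by rw [zigzag_odd]; omega
  rw [hs.monoCoeff_root hi hn (b := 2 * n - 1) (by rw [if_pos hev]; omega) hz hh]
  split_ifs with h0
  · simp [h0]
  have hO : ∀ r, 2 * r ≤ k → outerSum k ℓ r ≤ n := fun r hr => outerSum_le hr hℓ
  rw [monoCoeff_rootedProd_labelVec hi (by omega) hℓ (by split_ifs <;> omega)]
  have hB := monoCoeff_rootedProd_labelVec_sub hi hℓ (b := 2 * n - 1) (by omega)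
    (by rw [hz]; omega)
  set B := monoCoeff (n - 1) (labelVec k ℓ - Finsupp.single (zigzag k (2 * (h - 1) + 1)) 1)
    (rootedProd k (2 * (h - 1)) (2 * n - 1)).val
  have hD : ((3 * n - 2 - outerSum k ℓ (h - 1) : ℕ) : ℚ) = 3 * n - 2 - outerSum k ℓ (h - 1) := by
    have := hO (h - 1) (by omega)
    rw [Nat.cast_sub (by omega), Nat.cast_sub (by omega)]
    push_cast
    ring
  have hD0 : (3 * n - 2 - outerSum k ℓ (h - 1) : ℚ) ≠ 0 := by
    rw [← hD]
    have := hO (h - 1) (by omega)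
    exact_mod_cast (by omega : 3 * n - 2 - outerSum k ℓ (h - 1) ≠ 0)
  have hB' : B * (3 * n - 2 - outerSum k ℓ (h - 1)) = ℓ h *
      ((∏ r ∈ Finset.Icc 1 ((k + 1) / 2),
        ((3 * n - (if r ≤ h - 1 then 3 else 2) - outerSum k ℓ (r - 1)).choose (ℓ r) : ℚ)) *
      ∏ r ∈ Finset.Icc 1 (k / 2), ((n - 1 + outerSum k ℓ r).choose (ℓ (k + 1 - r)) : ℚ)) := by
    rw [hB, mul_right_comm, ← mul_assoc]
    congr 1
    · refine prod_mul_eq_mul_prod (a := h) (by simp; omega) ?_ ?_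
      · intro r hr hrh
        rw [Finset.mem_Icc] at hr
        rw [if_neg (show ¬(2 * r - 1 = 2 * (h - 1) + 1) by omega), Nat.sub_zero]
        congr 2
        simp only [hod, and_false, if_false]
        split_ifs <;> omega
      · rw [if_pos (show 2 * h - 1 = 2 * (h - 1) + 1 by omega),
          if_neg (show ¬(2 * h - 1 ≤ 2 * (h - 1) ∧ Odd (2 * (h - 1))) from fun hc => hod hc.2),
          if_pos (show 2 * h - 1 ≤ 2 * (h - 1) + 1 by omega),
          if_neg (show ¬h ≤ h - 1 by omega), ← hD,
          ← choose_pred_pred_mul _ _ (by have := hO (h - 1) (by omega); omega) (by omega)]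
        congr 3
        omega
    · refine Finset.prod_congr rfl fun r hr => ?_
      rw [Finset.mem_Icc] at hr
      rw [if_neg (by simp), if_neg (by omega), Nat.sub_zero]
      congr 2
      omega
  have hBeq := eq_div_of_mul_eq hD0 hB'
  rw [hBeq, prod_Icc_split (m := h - 1) (R := k / 2) (by omega)
    (fun r => (((2 * n - 1 - (if 2 * r ≤ 2 * (h - 1) ∧ Even (2 * (h - 1)) then 1 else 0) - n +
      outerSum k ℓ r).choose (ℓ (k + 1 - r)) : ℕ) : ℚ)),
    prod_Icc_split (m := h - 1) (R := (k + 1) / 2) (by omega)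
    (fun r => (((3 * n - (if r ≤ h - 1 then 3 else 2) -
      outerSum k ℓ (r - 1)).choose (ℓ r) : ℕ) : ℚ)),
    show h - 1 + 1 = h by omega]
  have e1 : ∏ r ∈ Finset.Icc 1 ((k + 1) / 2), (((2 * n - 1 +
      (if 2 * r - 1 ≤ 2 * (h - 1) ∧ Odd (2 * (h - 1)) then 1 else 0) + n - 1 -
        outerSum k ℓ (r - 1)).choose (ℓ r) : ℕ) : ℚ) = ∏ r ∈ Finset.Icc 1 ((k + 1) / 2),
        ((3 * n - 2 - outerSum k ℓ (r - 1)).choose (ℓ r) : ℚ) := by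
    refine Finset.prod_congr rfl fun r _ => ?_
    simp only [hod, and_false, if_false]
    congr 2
    omega
  have e2 : ∏ r ∈ Finset.Icc 1 (h - 1), (((2 * n - 1 -
      (if 2 * r ≤ 2 * (h - 1) ∧ Even (2 * (h - 1)) then 1 else 0) - n +
      outerSum k ℓ r).choose (ℓ (k + 1 - r)) : ℕ) : ℚ) = ∏ r ∈ Finset.Icc 1 (h - 1),
              ((n - 2 + outerSum k ℓ r).choose (ℓ (k + 1 - r)) : ℚ) := by
    refine Finset.prod_congr rfl fun r hr => ?_
    rw [Finset.mem_Icc] at hr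
    rw [if_pos ⟨by omega, hev⟩]
    congr 2
    omega
  have e3 : ∏ r ∈ Finset.Icc h (k / 2), (((2 * n - 1 -
      (if 2 * r ≤ 2 * (h - 1) ∧ Even (2 * (h - 1)) then 1 else 0) - n +
      outerSum k ℓ r).choose (ℓ (k + 1 - r)) : ℕ) : ℚ) = ∏ r ∈ Finset.Icc h (k / 2),
              ((n - 1 + outerSum k ℓ r).choose (ℓ (k + 1 - r)) : ℚ) := by
    refine Finset.prod_congr rfl fun r hr => ?_
    rw [Finset.mem_Icc] at hr
    rw [if_neg (by omega)]
    congr 2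
    omega
  have e4 : ∏ r ∈ Finset.Icc 1 (h - 1), (((3 * n - (if r ≤ h - 1 then 3 else 2) -
      outerSum k ℓ (r - 1)).choose (ℓ r) : ℕ) : ℚ) = ∏ r ∈ Finset.Icc 1 (h - 1),
              ((3 * n - 3 - outerSum k ℓ (r - 1)).choose (ℓ r) : ℚ) := by
    refine Finset.prod_congr rfl fun r hr => ?_
    rw [if_pos (Finset.mem_Icc.mp hr).2]
  have e5 : ∏ r ∈ Finset.Icc h ((k + 1) / 2), (((3 * n - (if r ≤ h - 1 then 3 else 2) -
      outerSum k ℓ (r - 1)).choose (ℓ r) : ℕ) : ℚ) = ∏ r ∈ Finset.Icc h ((k + 1) / 2),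
              ((3 * n - 2 - outerSum k ℓ (r - 1)).choose (ℓ r) : ℚ) := by
    refine Finset.prod_congr rfl fun r hr => ?_
    rw [if_neg (by have := (Finset.mem_Icc.mp hr).1; omega)]
  rw [e1, e2, e3, e4, e5]
  have hn' : (1 : ℚ) < n := by exact_mod_cast hn
  have hb : ((2 * n - 1 : ℕ) : ℚ) = 2 * n - 1 := by
    rw [Nat.cast_sub (by omega)]; push_cast; ring
  rw [hb, ← div_div (ℓ h : ℚ) (4 * n - 3), ← div_div (2 * ℓ h : ℚ)]
  simp only [div_eq_mul_inv]
  ring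

/-- The number of trees with a root label in the upper half. -/
theorem IsTreeSystem.monoCoeff_root_of_lt {k n : ℕ} {L : LabelRing⟦X⟧} {F : ℕ → LabelRing⟦X⟧}
    (hs : IsTreeSystem k (fun d => C (MvPolynomial.X d)) X L F) (hn : 1 < n) {ℓ : ℕ → ℕ}
    (hℓ : ∑ i ∈ Finset.Icc 1 k, ℓ i = n) {h : ℕ} (hh : h ∈ Finset.Icc 1 k)
    (hk : (k + 1) / 2 < h) :
    monoCoeff n (labelVec k ℓ) (X * (C (MvPolynomial.X h) * F h)) =
      (ℓ h : ℚ) / ((n - 1) * (4 * n - 3)) *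
            (∏ r ∈ Finset.Icc 1 (k / 2),
              ((n - 2 + outerSum k ℓ r).choose (ℓ (k + 1 - r)) : ℚ)) *
            (∏ r ∈ Finset.Icc 1 (k + 1 - h),
              ((3 * n - 2 - outerSum k ℓ (r - 1)).choose (ℓ r) : ℚ)) *
            (∏ r ∈ Finset.Icc (k + 2 - h) ((k + 1) / 2),
              ((3 * n - 3 - outerSum k ℓ (r - 1)).choose (ℓ r) : ℚ))
          - (ℓ h : ℚ) / ((4 * n - 3) * (n - 1 + outerSum k ℓ (k + 1 - h))) *
            (∏ r ∈ Finset.Icc 1 ((k + 1) / 2),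
              ((3 * n - 3 - outerSum k ℓ (r - 1)).choose (ℓ r) : ℚ)) *
            (∏ r ∈ Finset.Icc 1 (k + 1 - h),
              ((n - 1 + outerSum k ℓ r).choose (ℓ (k + 1 - r)) : ℚ)) *
            (∏ r ∈ Finset.Icc (k + 2 - h) (k / 2),
              ((n - 2 + outerSum k ℓ r).choose (ℓ (k + 1 - r)) : ℚ)) := by
  obtain ⟨h1, h2⟩ := Finset.mem_Icc.mp hh
  obtain ⟨m, rfl⟩ : ∃ m, h = k + 1 - m := ⟨k + 1 - h, by omega⟩
  have hm1 : 1 ≤ m := by omega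
  have hm2 : 2 * m ≤ k := by omega
  rw [show k + 1 - (k + 1 - m) = m by omega, show k + 2 - (k + 1 - m) = m + 1 by omega]
  set h := k + 1 - m with hdef
  have hi : 2 * m - 1 + 1 ≤ k := by omega
  have hev : ¬Even (2 * m - 1) := by rw [Nat.even_iff]; omega
  have hod : Odd (2 * m - 1) := by rw [Nat.odd_iff]; omega
  have hz : zigzag k (2 * m - 1 + 1) = h := by
    rw [show 2 * m - 1 + 1 = 2 * m by omega, zigzag_even]
  rw [hs.monoCoeff_root hi hn (b := 2 * n - 2) (by rw [if_neg hev]; omega) hz hh]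
  split_ifs with h0
  · simp [h0]
  have hO : ∀ r, 2 * r ≤ k → outerSum k ℓ r ≤ n := fun r hr => outerSum_le hr hℓ
  rw [monoCoeff_rootedProd_labelVec hi (by omega) hℓ (by rw [if_neg (by simp [hev])]; omega)]
  have hB := monoCoeff_rootedProd_labelVec_sub hi hℓ (b := 2 * n - 2) (by omega)
    (by rw [hz]; omega)
  set B := monoCoeff (n - 1) (labelVec k ℓ - Finsupp.single (zigzag k (2 * m - 1 + 1)) 1)
    (rootedProd k (2 * m - 1) (2 * n - 2)).val
  have hD : ((n - 1 + outerSum k ℓ m : ℕ) : ℚ) = n - 1 + outerSum k ℓ m := by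
    rw [Nat.cast_add, Nat.cast_sub (by omega)]
    push_cast
    ring
  have hD0 : (n - 1 + outerSum k ℓ m : ℚ) ≠ 0 := by
    rw [← hD]
    exact_mod_cast (by omega : n - 1 + outerSum k ℓ m ≠ 0)
  have hB' : B * (n - 1 + outerSum k ℓ m) = ℓ h *
      ((∏ r ∈ Finset.Icc 1 (k / 2),
        ((n - (if r ≤ m then 1 else 2) + outerSum k ℓ r).choose (ℓ (k + 1 - r)) : ℚ)) *
      ∏ r ∈ Finset.Icc 1 ((k + 1) / 2),
        ((3 * n - 3 - outerSum k ℓ (r - 1)).choose (ℓ r) : ℚ)) := by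
    rw [hB, mul_comm (∏ r ∈ Finset.Icc 1 ((k + 1) / 2), _), mul_right_comm, ← mul_assoc]
    congr 1
    · refine prod_mul_eq_mul_prod (a := m) (by simp; omega) ?_ ?_
      · intro r hr hrh
        rw [Finset.mem_Icc] at hr
        rw [if_neg (show ¬(2 * r = 2 * m - 1 + 1) by omega), Nat.sub_zero]
        congr 2
        simp only [hod, and_true]
        split_ifs <;> omega
      · rw [if_pos (show 2 * m = 2 * m - 1 + 1 by omega), if_neg (by omega),
          if_pos le_rfl, ← hD, ← hdef,
          ← choose_pred_pred_mul _ _ (by omega) (by omega)]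
        congr 3
        omega
    · refine Finset.prod_congr rfl fun r hr => ?_
      rw [Finset.mem_Icc] at hr
      rw [if_neg (show ¬(2 * r - 1 = 2 * m - 1 + 1) by omega), Nat.sub_zero]
      congr 2
      simp only [hod, and_true]
      split_ifs <;> omega
  have hBeq := eq_div_of_mul_eq hD0 hB'
  rw [hBeq, prod_Icc_split (m := m) (R := (k + 1) / 2) (by omega)
    (fun r => (((2 * n - 2 + (if 2 * r - 1 ≤ 2 * m - 1 ∧ Odd (2 * m - 1) then 1 else 0) + n - 1 -
        outerSum k ℓ (r - 1)).choose (ℓ r) : ℕ) : ℚ)),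
    prod_Icc_split (m := m) (R := k / 2) (by omega)
    (fun r => (((n - (if r ≤ m then 1 else 2) + outerSum k ℓ r).choose (ℓ (k + 1 - r)) : ℕ) : ℚ))]
  have e1 : ∏ r ∈ Finset.Icc 1 (k / 2), (((2 * n - 2 -
      (if 2 * r ≤ 2 * m - 1 ∧ Even (2 * m - 1) then 1 else 0) - n +
      outerSum k ℓ r).choose (ℓ (k + 1 - r)) : ℕ) : ℚ) = ∏ r ∈ Finset.Icc 1 (k / 2),
              ((n - 2 + outerSum k ℓ r).choose (ℓ (k + 1 - r)) : ℚ) := by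
    refine Finset.prod_congr rfl fun r _ => ?_
    simp only [hev, and_false, if_false]
    congr 2
    omega
  have e2 : ∏ r ∈ Finset.Icc 1 m, (((2 * n - 2 +
      (if 2 * r - 1 ≤ 2 * m - 1 ∧ Odd (2 * m - 1) then 1 else 0) + n - 1 -
        outerSum k ℓ (r - 1)).choose (ℓ r) : ℕ) : ℚ) = ∏ r ∈ Finset.Icc 1 m,
              ((3 * n - 2 - outerSum k ℓ (r - 1)).choose (ℓ r) : ℚ) := by
    refine Finset.prod_congr rfl fun r hr => ?_
    rw [Finset.mem_Icc] at hr
    rw [if_pos ⟨by omega, hod⟩]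
    congr 2
    omega
  have e3 : ∏ r ∈ Finset.Icc (m + 1) ((k + 1) / 2), (((2 * n - 2 +
      (if 2 * r - 1 ≤ 2 * m - 1 ∧ Odd (2 * m - 1) then 1 else 0) + n - 1 -
        outerSum k ℓ (r - 1)).choose (ℓ r) : ℕ) : ℚ) = ∏ r ∈ Finset.Icc (m + 1) ((k + 1) / 2),
              ((3 * n - 3 - outerSum k ℓ (r - 1)).choose (ℓ r) : ℚ) := by
    refine Finset.prod_congr rfl fun r hr => ?_
    rw [Finset.mem_Icc] at hr
    rw [if_neg (by omega)]
    congr 2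
    omega
  have e4 : ∏ r ∈ Finset.Icc 1 m, (((n - (if r ≤ m then 1 else 2) +
      outerSum k ℓ r).choose (ℓ (k + 1 - r)) : ℕ) : ℚ) = ∏ r ∈ Finset.Icc 1 m,
              ((n - 1 + outerSum k ℓ r).choose (ℓ (k + 1 - r)) : ℚ) := by
    refine Finset.prod_congr rfl fun r hr => ?_
    rw [if_pos (Finset.mem_Icc.mp hr).2]
  have e5 : ∏ r ∈ Finset.Icc (m + 1) (k / 2), (((n - (if r ≤ m then 1 else 2) +
      outerSum k ℓ r).choose (ℓ (k + 1 - r)) : ℕ) : ℚ) = ∏ r ∈ Finset.Icc (m + 1) (k / 2),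
              ((n - 2 + outerSum k ℓ r).choose (ℓ (k + 1 - r)) : ℚ) := by
    refine Finset.prod_congr rfl fun r hr => ?_
    rw [if_neg (by have := (Finset.mem_Icc.mp hr).1; omega)]
  rw [e1, e2, e3, e4, e5]
  have hb : (2 : ℚ) * ℓ h / ((2 * n - 2 : ℕ) : ℚ) = ℓ h / (n - 1) := by
    rw [Nat.cast_sub (by omega), show ((2 * n : ℕ) : ℚ) - ((2 : ℕ) : ℚ) = 2 * (n - 1) by
      push_cast; ring, mul_div_mul_left _ _ two_ne_zero]
  rw [hb, ← div_div (ℓ h : ℚ) (4 * n - 3), ← div_div (ℓ h : ℚ) (n - 1)]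
  simp only [div_eq_mul_inv]
  ring

/-- The number of all trees. -/
theorem IsTreeSystem.monoCoeff_sum {k n : ℕ} {L : LabelRing⟦X⟧} {F : ℕ → LabelRing⟦X⟧}
    (hs : IsTreeSystem k (fun d => C (MvPolynomial.X d)) X L F) (hn : 1 < n) {ℓ : ℕ → ℕ}
    (hℓ : ∑ i ∈ Finset.Icc 1 k, ℓ i = n) :
    monoCoeff n (labelVec k ℓ) (∑ h ∈ Finset.Icc 1 k, X * (C (MvPolynomial.X h) * F h)) =
      1 / ((n : ℚ) - 1) *
        (∏ r ∈ Finset.Icc 1 ((k + 1) / 2),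
          ((3 * n - 3 - outerSum k ℓ (r - 1)).choose (ℓ r) : ℚ)) *
        (∏ r ∈ Finset.Icc 1 (k / 2),
          ((n - 2 + outerSum k ℓ r).choose (ℓ (k + 1 - r)) : ℚ))
      - 1 / (2 * (n : ℚ) - 1) *
        (∏ r ∈ Finset.Icc 1 ((k + 1) / 2),
          ((3 * n - 2 - outerSum k ℓ (r - 1)).choose (ℓ r) : ℚ)) *
        (∏ r ∈ Finset.Icc 1 (k / 2),
          ((n - 1 + outerSum k ℓ r).choose (ℓ (k + 1 - r)) : ℚ)) := by
  have hk : 0 + 1 ≤ k := by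
    by_contra h
    obtain rfl : k = 0 := by omega
    simp at hℓ
    omega
  have hr : ∀ b : ℕ, rootUnit k ^ (-(b : ℤ)) = rootedProd k 0 b := fun b => by simp [rootedProd]
  rw [hs.monoCoeff_sum_eq hn, hr, hr, mul_assoc, mul_assoc,
    monoCoeff_rootedProd_labelVec hk (by omega) hℓ (by simp; omega),
    monoCoeff_rootedProd_labelVec hk (by omega) hℓ (by simp; omega)]
  congr 3
  all_goals
    refine Finset.prod_congr rfl fun r hr => ?_
    rw [Finset.mem_Icc] at hr
    rw [if_neg (by simp; try omega)]
    congr 2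
    omega

/-! ### Generating functions of functions on words -/

/-- The convolution of two functions on words: the sum over all ways to cut the word in two. -/
def conv (f g : List ℕ → ℚ) (w : List ℕ) : ℚ :=
  ∑ i ∈ Finset.range (w.length + 1), f (w.take i) * g (w.drop i)

@[simp] theorem conv_nil (f g : List ℕ → ℚ) : conv f g [] = f [] * g [] := by simp [conv]

theorem conv_cons (f g : List ℕ → ℚ) (a : ℕ) (w : List ℕ) :
    conv f g (a :: w) = f [] * g (a :: w) + conv (fun w => f (a :: w)) g w := by
  rw [conv, List.length_cons, Finset.sum_range_succ']
  simp [conv, add_comm]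

/-- The function that removes the first letter of a word and applies `f` if this letter is `d`, and
that vanishes on all other words. -/
def pre (d : ℕ) (f : List ℕ → ℚ) : List ℕ → ℚ
  | [] => 0
  | a :: w => if a = d then f w else 0

theorem conv_pre (d : ℕ) (f g : List ℕ → ℚ) : conv (pre d f) g = pre d (conv f g) := by
  funext w
  cases w with
  | nil => simp [pre]
  | cons a w =>
    rw [conv_cons]
    by_cases h : a = d
    · simp [pre, h]
    · simp [pre, h, conv]

/-- A sum over the letter at which a word is cut becomes a sum over the positions in the word. -/
theorem sum_conv_pre (D : Finset ℕ) (g f : ℕ → List ℕ → ℚ) (v : List ℕ) :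
    ∑ d ∈ D, conv (g d) (pre d (f d)) v = ∑ j ∈ Finset.range v.length,
      if v.getD j 0 ∈ D then
        g (v.getD j 0) (v.take j) * f (v.getD j 0) (v.drop (j + 1)) else 0 := by
  simp only [conv]
  rw [Finset.sum_comm, Finset.sum_range_succ]
  have h0 : ∑ d ∈ D, g d (v.take v.length) * pre d (f d) (v.drop v.length) = 0 :=
    Finset.sum_eq_zero fun d _ => by simp [pre]
  rw [h0, add_zero]
  refine Finset.sum_congr rfl fun j hj => ?_
  have hj' := Finset.mem_range.mp hj
  rw [List.drop_eq_getElem_cons hj', List.getD_eq_getElem _ _ hj']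
  simp only [pre, mul_ite, mul_zero]
  rw [Finset.sum_ite_eq]

/-- The coefficients of the generating function of `f`: the sum over all words of length `n` with
letters in `{1, …, k}`, where the letter `a` contributes the variable `x_a`. -/
noncomputable def wordCoeff (k : ℕ) : ℕ → (List ℕ → ℚ) → LabelRing
  | 0, f => MvPolynomial.C (f [])
  | n + 1, f => ∑ a ∈ Finset.Icc 1 k, MvPolynomial.X a * wordCoeff k n fun w => f (a :: w)

/-- The generating function of a function on words. -/
noncomputable def wordSeries (k : ℕ) (f : List ℕ → ℚ) : LabelRing⟦X⟧ :=
  PowerSeries.mk fun n => wordCoeff k n f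

theorem coeff_wordSeries (k n : ℕ) (f : List ℕ → ℚ) :
    coeff n (wordSeries k f) = wordCoeff k n f := coeff_mk _ _

theorem wordCoeff_congr (k n : ℕ) {f g : List ℕ → ℚ}
    (h : ∀ w : List ℕ, (∀ a ∈ w, a ∈ Finset.Icc 1 k) → f w = g w) :
    wordCoeff k n f = wordCoeff k n g := by
  induction n generalizing f g with
  | zero => rw [wordCoeff, wordCoeff, h [] (by simp)]
  | succ n ih =>
    rw [wordCoeff, wordCoeff]
    refine Finset.sum_congr rfl fun a ha => ?_
    rw [ih fun w hw => h (a :: w) ?_]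
    intro b hb
    rcases List.mem_cons.mp hb with rfl | hb
    · exact ha
    · exact hw b hb

theorem wordSeries_congr (k : ℕ) {f g : List ℕ → ℚ}
    (h : ∀ w : List ℕ, (∀ a ∈ w, a ∈ Finset.Icc 1 k) → f w = g w) :
    wordSeries k f = wordSeries k g := by
  ext1 n
  rw [coeff_wordSeries, coeff_wordSeries, wordCoeff_congr k n h]

theorem wordCoeff_add (k n : ℕ) (f g : List ℕ → ℚ) :
    wordCoeff k n (fun w => f w + g w) = wordCoeff k n f + wordCoeff k n g := by
  induction n generalizing f g with
  | zero => simp [wordCoeff]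
  | succ n ih => simp only [wordCoeff, ih, mul_add, Finset.sum_add_distrib]

theorem wordCoeff_zero_fun (k n : ℕ) : wordCoeff k n (fun _ => 0) = 0 := by
  induction n with
  | zero => simp [wordCoeff]
  | succ n ih => simp [wordCoeff, ih]

theorem wordCoeff_const_mul (k n : ℕ) (c : ℚ) (f : List ℕ → ℚ) :
    wordCoeff k n (fun w => c * f w) = MvPolynomial.C c * wordCoeff k n f := by
  induction n generalizing f with
  | zero => simp [wordCoeff]
  | succ n ih => simp only [wordCoeff, ih, mul_left_comm _ (MvPolynomial.C c), Finset.mul_sum]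

theorem wordSeries_add (k : ℕ) (f g : List ℕ → ℚ) :
    wordSeries k (fun w => f w + g w) = wordSeries k f + wordSeries k g := by
  ext1 n
  simp only [coeff_wordSeries, map_add, wordCoeff_add]

theorem wordSeries_sum (k : ℕ) (D : Finset ℕ) (f : ℕ → List ℕ → ℚ) :
    wordSeries k (fun w => ∑ d ∈ D, f d w) = ∑ d ∈ D, wordSeries k (f d) := by
  classical
  induction D using Finset.induction_on with
  | empty =>
    ext1 n
    simp [coeff_wordSeries, wordCoeff_zero_fun]
  | insert a s ha ih =>
    simp only [Finset.sum_insert ha, wordSeries_add, ih]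

theorem coeff_succ_wordSeries_mul (k n : ℕ) (f : List ℕ → ℚ) (G : LabelRing⟦X⟧) :
    coeff (n + 1) (wordSeries k f * G) = MvPolynomial.C (f []) * coeff (n + 1) G +
      ∑ a ∈ Finset.Icc 1 k, MvPolynomial.X a *
        coeff n (wordSeries k (fun w => f (a :: w)) * G) := by
  have h : wordSeries k f = C (MvPolynomial.C (f [])) +
      X * ∑ a ∈ Finset.Icc 1 k, C (MvPolynomial.X a) * wordSeries k (fun w => f (a :: w)) := by
    ext1 n
    cases n with
    | zero => simp [wordSeries, wordCoeff]
    | succ n =>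
      simp [coeff_wordSeries, wordCoeff, coeff_succ_X_mul]
  rw [h, add_mul, map_add, coeff_C_mul, mul_assoc, coeff_succ_X_mul, Finset.sum_mul, map_sum]
  congr 1
  refine Finset.sum_congr rfl fun a _ => ?_
  rw [mul_assoc, coeff_C_mul]

theorem wordSeries_conv (k : ℕ) (f g : List ℕ → ℚ) :
    wordSeries k (conv f g) = wordSeries k f * wordSeries k g := by
  ext1 n
  induction n generalizing f with
  | zero => simp [wordSeries, wordCoeff]
  | succ n ih =>
    rw [coeff_succ_wordSeries_mul, coeff_wordSeries, wordCoeff]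
    simp only [conv_cons, wordCoeff_add, mul_add, Finset.sum_add_distrib, wordCoeff_const_mul]
    simp only [← coeff_wordSeries, ih]
    rw [coeff_wordSeries k (n + 1), wordCoeff, Finset.mul_sum]
    congr 1
    refine Finset.sum_congr rfl fun a _ => ?_
    rw [coeff_wordSeries, mul_left_comm]

theorem wordSeries_pre (k : ℕ) {d : ℕ} (hd : d ∈ Finset.Icc 1 k) (f : List ℕ → ℚ) :
    wordSeries k (pre d f) = X * (C (MvPolynomial.X d) * wordSeries k f) := by
  ext1 n
  cases n with
  | zero => simp [wordSeries, wordCoeff, pre]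
  | succ n =>
    rw [coeff_succ_X_mul, coeff_C_mul, coeff_wordSeries, coeff_wordSeries, wordCoeff,
      Finset.sum_eq_single_of_mem d hd]
    · simp [pre]
    · intro a _ ha
      simp [pre, ha, wordCoeff_zero_fun]

/-- The function that is `1` on the empty word only. -/
def emptyWord : List ℕ → ℚ
  | [] => 1
  | _ :: _ => 0

theorem wordSeries_emptyWord (k : ℕ) : wordSeries k emptyWord = 1 := by
  ext1 n
  cases n with
  | zero => simp [wordSeries, wordCoeff, emptyWord]
  | succ n => simp [coeff_wordSeries, wordCoeff, emptyWord, wordCoeff_zero_fun, coeff_one]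

/-! ### Trees labelled by words -/

/-- The vertex `z` has the label with index `z` of the word, counted from `0`. Beyond the end
of the word the label is `0`, and negative vertices have the first label; they are not used. -/
def wordLabel (w : List ℕ) (z : ℤ) : ℕ := w.getD z.toNat 0

/-- The condition on the labels of a vertex `y` and its parent `x`, which is void if the parent is
the larger vertex. -/
def LabelOk (k : ℕ) (lab : ℤ → ℕ) (x y : ℤ) : Prop := x < y → lab x + lab y ≤ k + 1

theorem treeCard_labelOk_add {k : ℕ} {lab lab' : ℤ → ℕ} {r a b : ℤ} (s : ℤ)
    (h : ∀ x, a ≤ x → x ≤ b → lab x = lab' (x + s)) :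
    treeCard (LabelOk k lab) r a b = treeCard (LabelOk k lab') (r + s) (a + s) (b + s) := by
  refine treeCard_add s fun x y h1 h2 h3 h4 => ?_
  simp only [LabelOk, h x h1 h2, h y h3 h4, add_lt_add_iff_right]

/-- The number of trees whose root, the first vertex, is labelled `h`, and whose other vertices are
labelled by `w`. -/
noncomputable def rightCount (k h : ℕ) (w : List ℕ) : ℚ :=
  treeCard (LabelOk k (wordLabel (h :: w))) 0 0 w.length

/-- The number of trees whose root, the last vertex, is labelled `d`, and whose other vertices are
labelled by `w`. -/
noncomputable def leftCount (k d : ℕ) (w : List ℕ) : ℚ :=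
  treeCard (LabelOk k (wordLabel (w ++ [d]))) w.length 0 w.length

theorem treeCard_eq_rightCount {k : ℕ} {lab : ℤ → ℕ} {a b : ℤ} {h : ℕ} {w : List ℕ}
    (hb : b = a + w.length) (hlab : ∀ m : ℕ, m ≤ w.length → lab (a + m) = (h :: w).getD m 0) :
    (treeCard (LabelOk k lab) a a b : ℚ) = rightCount k h w := by
  rw [rightCount, treeCard_labelOk_add (lab' := wordLabel (h :: w)) (-a)]
  · rw [hb]
    congr 2 <;> ring
  · intro x h1 h2
    obtain ⟨m, rfl⟩ : ∃ m : ℕ, x = a + m := ⟨(x - a).toNat, by omega⟩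
    rw [hlab m (by omega), wordLabel]
    congr 1
    omega

theorem treeCard_eq_leftCount {k : ℕ} {lab : ℤ → ℕ} {a b : ℤ} {d : ℕ} {w : List ℕ}
    (hb : b = a + w.length) (hlab : ∀ m : ℕ, m ≤ w.length → lab (a + m) = (w ++ [d]).getD m 0) :
    (treeCard (LabelOk k lab) b a b : ℚ) = leftCount k d w := by
  rw [leftCount, treeCard_labelOk_add (lab' := wordLabel (w ++ [d])) (-a)]
  · rw [hb]
    congr 2 <;> ring
  · intro x h1 h2
    obtain ⟨m, rfl⟩ : ∃ m : ℕ, x = a + m := ⟨(x - a).toNat, by omega⟩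
    rw [hlab m (by omega), wordLabel]
    congr 1
    omega

theorem sum_range_ite_add_lt (n i : ℕ) (hi : i < n) (F : ℕ → ℚ) :
    ∑ j ∈ Finset.range n, (if i + j < n then F j else 0) = ∑ j ∈ Finset.range (n - i), F j := by
  rw [← Finset.sum_filter]
  congr 1
  ext j
  simp only [Finset.mem_filter, Finset.mem_range]
  omega

/-- The recursion at the largest neighbour of the root: its label `d` is the letter of `w` that
`pre d` removes, and it must satisfy `h + d ≤ k + 1`. -/
theorem rightCount_eq (k h : ℕ) (w : List ℕ) (hw : ∀ a ∈ w, a ∈ Finset.Icc 1 k) :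
    rightCount k h w = emptyWord w + conv (rightCount k h)
      (fun v => ∑ d ∈ Finset.Icc 1 (k + 1 - h),
        conv (leftCount k d) (pre d (rightCount k d)) v) w := by
  classical
  rcases Nat.eq_zero_or_pos w.length with hlen | hlen
  · obtain rfl := List.length_eq_zero_iff.mp hlen
    rw [conv_nil, Finset.sum_eq_zero fun d _ => by simp [pre], mul_zero, add_zero]
    simp [rightCount, treeCard_self, emptyWord]
  · have hrec := treeCard_left (LabelOk k (wordLabel (h :: w))) 0 hlen
    simp only [zero_add] at hrec
    have he : emptyWord w = 0 := by
      cases w with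
      | nil => simp at hlen
      | cons => rfl
    rw [rightCount, hrec, he, zero_add, conv, Finset.sum_range_succ,
      List.drop_length, sum_conv_pre, List.length_nil, Finset.range_zero, Finset.sum_empty,
      mul_zero, add_zero, Finset.sum_product, Nat.cast_sum]
    refine Finset.sum_congr rfl fun i hi => ?_
    have hi' := Finset.mem_range.mp hi
    rw [sum_conv_pre, List.length_drop, ← sum_range_ite_add_lt _ _ hi', Nat.cast_sum,
      Finset.mul_sum]
    refine Finset.sum_congr rfl fun j _ => ?_
    by_cases hij : i + j < w.length
    · have hd : (w.drop i).getD j 0 = w[i + j] := by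
        rw [List.getD_eq_getElem _ _ (by rw [List.length_drop]; omega), List.getElem_drop]
      have hok : LabelOk k (wordLabel (h :: w)) 0 ((i : ℤ) + 1 + (j : ℤ)) ↔
          w[i + j] ∈ Finset.Icc 1 (k + 1 - h) := by
        have h1 := Finset.mem_Icc.mp (hw _ (List.getElem_mem hij))
        have h2 : wordLabel (h :: w) ((i : ℤ) + 1 + (j : ℤ)) = w[i + j] := by
          rw [wordLabel, show ((i : ℤ) + 1 + (j : ℤ)).toNat = i + j + 1 by omega,
            List.getD_cons_succ, List.getD_eq_getElem _ _ hij]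
        have h3 : wordLabel (h :: w) 0 = h := rfl
        rw [LabelOk, h2, h3, Finset.mem_Icc]
        constructor
        · intro h; have := h (by omega); omega
        · intro h _; omega
      simp only [hij, true_and, hok, hd, if_true]
      split_ifs with hm
      · push_cast
        rw [treeCard_eq_rightCount (h := h) (w := w.take i), treeCard_eq_leftCount (d := w[i + j])
          (w := (w.drop i).take j), treeCard_eq_rightCount (h := w[i + j])
          (w := w.drop (i + j + 1)),
          List.drop_drop, show i + (j + 1) = i + j + 1 by ring]
        · rw [List.length_drop]; omega
        · intro m hm
          rw [List.length_drop] at hm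
          simp only [wordLabel, List.getD_eq_getElem?_getD]
          rw [show ((i : ℤ) + 1 + j + m).toNat = i + j + 1 + m by omega]
          grind
        · rw [List.length_take, List.length_drop]; omega
        · intro m hm
          rw [List.length_take, List.length_drop] at hm
          simp only [wordLabel, List.getD_eq_getElem?_getD]
          rw [show ((i : ℤ) + 1 + m).toNat = i + 1 + m by omega]
          grind
        · rw [List.length_take]; omega
        · intro m hm
          rw [List.length_take] at hm
          simp only [wordLabel, List.getD_eq_getElem?_getD]
          rw [show (0 + (m : ℤ)).toNat = m by omega]
          grind
      · simp
    · rw [if_neg (by tauto), if_neg hij, Nat.cast_zero, mul_zero]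

/-- The recursion at the smallest neighbour of the root. As the root is the larger of the
two, the label of the neighbour is not restricted. -/
theorem leftCount_eq (k e : ℕ) (w : List ℕ) (hw : ∀ a ∈ w, a ∈ Finset.Icc 1 k) :
    leftCount k e w = emptyWord w + ∑ d ∈ Finset.Icc 1 k,
      conv (leftCount k d) (conv (pre d (rightCount k d)) (leftCount k e)) w := by
  classical
  simp only [conv_pre]
  rcases Nat.eq_zero_or_pos w.length with hlen | hlen
  · obtain rfl := List.length_eq_zero_iff.mp hlen
    rw [Finset.sum_eq_zero fun d _ => by simp [pre], add_zero]
    simp [leftCount, treeCard_self, emptyWord]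
  · have hrec := treeCard_right (LabelOk k (wordLabel (w ++ [e]))) 0 hlen
    simp only [zero_add] at hrec
    have he : emptyWord w = 0 := by
      cases w with
      | nil => simp at hlen
      | cons => rfl
    rw [leftCount, hrec, he, zero_add, sum_conv_pre,
      Finset.sum_product, Nat.cast_sum]
    refine Finset.sum_congr rfl fun i hi => ?_
    have hi' := Finset.mem_range.mp hi
    have hgd : w.getD i 0 = w[i] := List.getD_eq_getElem _ _ hi'
    rw [hgd, if_pos (hw _ (List.getElem_mem hi')), conv, List.length_drop,
      show w.length - (i + 1) + 1 = w.length - i by omega, ← sum_range_ite_add_lt _ _ hi',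
      Nat.cast_sum, Finset.mul_sum]
    refine Finset.sum_congr rfl fun j _ => ?_
    have hok : LabelOk k (wordLabel (w ++ [e])) w.length i := fun h => by
      omega
    by_cases hij : i + j < w.length
    · rw [if_pos hij, if_pos ⟨hij, hok⟩]
      push_cast
      rw [treeCard_eq_leftCount (d := w[i]) (w := w.take i), treeCard_eq_rightCount (h := w[i])
          (w := (w.drop (i + 1)).take j), treeCard_eq_leftCount (d := e) (w := w.drop (i + j + 1)),
          List.drop_drop, show i + 1 + j = i + j + 1 by ring]
      · rw [List.length_drop]; omega
      · intro m hm
        rw [List.length_drop] at hm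
        simp only [wordLabel, List.getD_eq_getElem?_getD]
        rw [show ((i : ℤ) + j + 1 + m).toNat = i + j + 1 + m by omega]
        grind
      · rw [List.length_take, List.length_drop]; omega
      · intro m hm
        rw [List.length_take, List.length_drop] at hm
        simp only [wordLabel, List.getD_eq_getElem?_getD]
        rw [show ((i : ℤ) + m).toNat = i + m by omega]
        grind
      · rw [List.length_take]; omega
      · intro m hm
        rw [List.length_take] at hm
        simp only [wordLabel, List.getD_eq_getElem?_getD]
        rw [show (0 + (m : ℤ)).toNat = m by omega]
        grind
    · rw [if_neg (by tauto), if_neg hij, Nat.cast_zero, mul_zero]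

/-- The functional equations of the generating functions of trees. -/
theorem isTreeSystem_wordSeries (k : ℕ) :
    IsTreeSystem k (fun d => C (MvPolynomial.X d)) X (wordSeries k (leftCount k 1))
      (fun h => wordSeries k (rightCount k h)) := by
  have hmem : ∀ m ≤ k, ∀ d ∈ Finset.Icc 1 m, d ∈ Finset.Icc 1 k := fun m hm d hd => by
    rw [Finset.mem_Icc] at hd ⊢; omega
  set S := ∑ d ∈ Finset.Icc 1 k, X * (C (MvPolynomial.X d) *
      (wordSeries k (leftCount k d) * wordSeries k (rightCount k d))) with hS
  have hl : ∀ e, wordSeries k (leftCount k e) = 1 + wordSeries k (leftCount k e) * S := by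
    intro e
    have h := wordSeries_congr k (leftCount_eq k e)
    rw [wordSeries_add, wordSeries_sum, wordSeries_emptyWord] at h
    rw [hS, Finset.mul_sum]
    refine h.trans (congrArg _ (Finset.sum_congr rfl fun d hd => ?_))
    rw [wordSeries_conv, wordSeries_conv, wordSeries_pre k hd]
    ring
  -- The generating function of the trees with root at the right end is `1 / (1 - S)` for every
  -- label of the root.
  have hind : ∀ e, wordSeries k (leftCount k e) = wordSeries k (leftCount k 1) := fun e => by
    linear_combination wordSeries k (leftCount k 1) * hl e - wordSeries k (leftCount k e) * hl 1
  constructor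
  · have h := hl 1
    simp only [hS, hind] at h
    exact h
  · intro h hh
    have h := wordSeries_congr k (rightCount_eq k h)
    rw [wordSeries_add, wordSeries_conv, wordSeries_sum, wordSeries_emptyWord] at h
    refine h.trans (congrArg _ (congrArg _ (Finset.sum_congr rfl fun d hd => ?_)))
    have hh' := Finset.mem_Icc.mp hh
    rw [wordSeries_conv, wordSeries_pre k (hmem _ (by omega) d hd), hind]
    ring

/-! ### Words as label functions -/

theorem sum_piFinset_succ {M : Type*} [AddCommMonoid M] (D : Finset ℕ) (n : ℕ)
    (F : (Fin (n + 1) → ℕ) → M) :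
    ∑ v ∈ Fintype.piFinset (fun _ : Fin (n + 1) => D), F v =
      ∑ a ∈ D, ∑ w ∈ Fintype.piFinset (fun _ : Fin n => D), F (Fin.cons a w) := by
  rw [← Finset.sum_product']
  refine Finset.sum_nbij' (fun v => (v 0, Fin.tail v)) (fun p => Fin.cons p.1 p.2) ?_ ?_ ?_ ?_ ?_
  · intro v hv
    rw [Fintype.mem_piFinset] at hv
    rw [Finset.mem_product, Fintype.mem_piFinset]
    exact ⟨hv 0, fun i => hv i.succ⟩
  · rintro ⟨a, w⟩ hp
    rw [Finset.mem_product, Fintype.mem_piFinset] at hp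
    rw [Fintype.mem_piFinset]
    intro i
    refine Fin.cases ?_ (fun i => ?_) i
    · exact hp.1
    · simpa using hp.2 i
  · intro v _
    exact Fin.cons_self_tail v
  · rintro ⟨a, w⟩ _
    simp
  · intro v _
    rw [Fin.cons_self_tail]

theorem wordCoeff_eq_sum (k n : ℕ) (f : List ℕ → ℚ) :
    wordCoeff k n f = ∑ v ∈ Fintype.piFinset (fun _ : Fin n => Finset.Icc 1 k),
      MvPolynomial.C (f (List.ofFn v)) * ∏ i, MvPolynomial.X (v i) := by
  induction n generalizing f with
  | zero => simp [wordCoeff]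
  | succ n ih =>
    rw [sum_piFinset_succ, wordCoeff]
    refine Finset.sum_congr rfl fun a _ => ?_
    rw [ih, Finset.mul_sum]
    refine Finset.sum_congr rfl fun w _ => ?_
    rw [List.ofFn_cons, Fin.prod_univ_succ]
    simp only [Fin.cons_zero, Fin.cons_succ]
    ring

theorem sum_single_eq_labelVec_iff {k n : ℕ} {v : Fin n → ℕ} (hv : ∀ i, v i ∈ Finset.Icc 1 k)
    (ℓ : ℕ → ℕ) : ∑ i, Finsupp.single (v i) 1 = labelVec k ℓ ↔
      ∀ a ∈ Finset.Icc 1 k, {i | v i = a}.ncard = ℓ a := by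
  have hcount : ∀ a, (∑ i, Finsupp.single (v i) 1 : ℕ →₀ ℕ) a = {i | v i = a}.ncard := by
    intro a
    rw [Finsupp.finsetSum_apply, Set.ncard_eq_toFinset_card', Set.toFinset_ofPred,
      Finset.card_filter]
    exact Finset.sum_congr rfl fun i _ => by rw [Finsupp.single_apply]
  constructor
  · intro h a ha
    rw [← hcount, h, labelVec_apply ha]
  · intro h
    ext a
    by_cases ha : a ∈ Finset.Icc 1 k
    · rw [hcount, h a ha, labelVec_apply ha]
    · have h1 : {i | v i = a} = ∅ := by
        ext i
        simp only [Set.mem_ofPred_eq, Set.mem_empty_iff_false, iff_false]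
        rintro rfl
        exact ha (hv i)
      rw [hcount, h1, Set.ncard_empty, labelVec, Finsupp.finsetSum_apply]
      refine (Finset.sum_eq_zero fun j hj => ?_).symm
      rw [Finsupp.single_apply, if_neg]
      rintro rfl
      exact ha hj

open Classical in
/-- The label functions with values in `{1, …, k}` that take each value `i` exactly `ℓ i` times. -/
noncomputable def labelings (k n : ℕ) (ℓ : ℕ → ℕ) : Finset (Fin n → ℕ) :=
  {v ∈ Fintype.piFinset fun _ : Fin n => Finset.Icc 1 k |
    ∀ a ∈ Finset.Icc 1 k, {i | v i = a}.ncard = ℓ a}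

theorem mem_labelings {k n : ℕ} {ℓ : ℕ → ℕ} {v : Fin n → ℕ} : v ∈ labelings k n ℓ ↔
    (∀ i, v i ∈ Finset.Icc 1 k) ∧ ∀ a ∈ Finset.Icc 1 k, {i | v i = a}.ncard = ℓ a := by
  simp only [labelings, Finset.mem_filter, Fintype.mem_piFinset]

/-- Only the label functions with the prescribed multiplicities contribute to a coefficient. -/
theorem monoCoeff_wordSeries (k n : ℕ) (ℓ : ℕ → ℕ) (f : List ℕ → ℚ) :
    monoCoeff n (labelVec k ℓ) (wordSeries k f) = ∑ v ∈ labelings k n ℓ, f (List.ofFn v) := by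
  classical
  rw [monoCoeff_apply, coeff_wordSeries, wordCoeff_eq_sum, MvPolynomial.coeff_sum, labelings,
    Finset.sum_filter]
  refine Finset.sum_congr rfl fun v hv => ?_
  have hX : ∏ i, (MvPolynomial.X (v i) : LabelRing) =
      MvPolynomial.monomial (∑ i, Finsupp.single (v i) 1) 1 := by
    rw [MvPolynomial.monomial_sum_one]
    rfl
  have hiff := sum_single_eq_labelVec_iff (Fintype.mem_piFinset.mp hv) ℓ
  rw [MvPolynomial.coeff_C_mul, hX, MvPolynomial.coeff_monomial, mul_ite, mul_one, mul_zero]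
  split_ifs with h1 h2 h2
  · rfl
  · exact absurd (hiff.mp h1) h2
  · exact absurd (hiff.mpr h2) h1
  · rfl

/-! ### From trees on `Fin n` to trees on intervals -/

section Transfer

variable {V W : Type*} (e : V ↪ W) (H : SimpleGraph V)

theorem reachable_map_iff {u v : V} : (H.map e).Reachable (e u) (e v) ↔ H.Reachable u v := by
  have : Nonempty V := ⟨u⟩
  constructor
  · intro h
    have := reachable_of_adj_imp (H := H) (Function.invFun e) (fun x y hxy => ?_) h
    · rwa [Function.leftInverse_invFun e.injective, Function.leftInverse_invFun e.injective] at this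
    · obtain ⟨x, y, hxy, rfl, rfl⟩ := (SimpleGraph.map_adj _ _ _ _).mp hxy
      right
      rwa [Function.leftInverse_invFun e.injective, Function.leftInverse_invFun e.injective]
  · exact reachable_of_adj_imp e fun x y hxy => Or.inr (SimpleGraph.map_adj_apply.mpr hxy)

theorem reachable_map_deleteEdges_iff {u v x y : V} :
    ((H.map e).deleteEdges {s(e x, e y)}).Reachable (e u) (e v) ↔
      (H.deleteEdges {s(x, y)}).Reachable u v := by
  rw [← reachable_map_iff e]
  have h : (H.map e).deleteEdges {s(e x, e y)} = (H.deleteEdges {s(x, y)}).map e := by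
    ext a b
    simp only [SimpleGraph.deleteEdges_adj, SimpleGraph.map_adj, Set.mem_singleton_iff]
    constructor
    · rintro ⟨⟨a, b, hab, rfl, rfl⟩, hne⟩
      refine ⟨a, b, ⟨hab, fun h => hne ?_⟩, rfl, rfl⟩
      simpa using congrArg (Sym2.map e) h
    · rintro ⟨a, b, ⟨hab, hne⟩, rfl, rfl⟩
      refine ⟨⟨a, b, hab, rfl, rfl⟩, fun h => hne ?_⟩
      exact Sym2.map.injective e.injective (by simpa using h)
  rw [h]

variable {H}

/-- If the edge between `i` and `j` is a bridge, then `i` lies on a path from `r` to `j` exactly if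
`i` can be reached from `r` without this edge. -/
theorem exists_isPath_mem_support_iff {r i j : V} (hadj : H.Adj i j)
    (hbridge : ¬(H.deleteEdges {s(i, j)}).Reachable i j) :
    (∃ p : H.Walk r j, p.IsPath ∧ i ∈ p.support) ↔ (H.deleteEdges {s(i, j)}).Reachable r i := by
  classical
  simp only [SimpleGraph.reachable_deleteEdges_iff_exists_walk] at hbridge ⊢
  constructor
  · rintro ⟨p, hp, hi⟩
    refine ⟨p.takeUntil i hi, fun h => ?_⟩
    exact SimpleGraph.Walk.endpoint_notMem_support_takeUntil hp hi hadj.ne'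
      (SimpleGraph.Walk.snd_mem_support_of_mem_edges _ h)
  · rintro ⟨q, hq⟩
    have hq' : s(i, j) ∉ q.bypass.edges := fun h => hq (q.edges_bypass_subset_edges h)
    have hj : j ∉ q.bypass.support := fun hj => hbridge
      ⟨(q.bypass.dropUntil j hj).reverse, fun h => hq' (q.bypass.edges_dropUntil_subset_edges hj (by
        simpa using h))⟩
    exact ⟨q.bypass.concat hadj, q.bypass_isPath.concat hj hadj, by simp⟩

end Transfer

/-- The vertex `i` as an integer. -/
def finToInt (n : ℕ) : Fin n ↪ ℤ := ⟨fun i => ((i : ℕ) : ℤ), fun i j h => by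
  simpa [Fin.ext_iff] using h⟩

theorem finToInt_apply {n : ℕ} (i : Fin n) : finToInt n i = ((i : ℕ) : ℤ) := rfl

theorem finToInt_lt {n : ℕ} {i j : Fin n} : finToInt n i < finToInt n j ↔ i < j := by
  simp [finToInt_apply]

theorem wordLabel_ofFn {n : ℕ} (v : Fin n → ℕ) (i : Fin n) :
    wordLabel (List.ofFn v) (finToInt n i) = v i := by
  simp [wordLabel, finToInt_apply]

theorem exists_finToInt {n : ℕ} {x : ℤ} (h0 : 0 ≤ x) (hx : x ≤ (n : ℤ) - 1) :
    ∃ i, finToInt n i = x :=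
  ⟨⟨x.toNat, by omega⟩, Int.toNat_of_nonneg h0⟩

theorem finToInt_nonneg {n : ℕ} (i : Fin n) : 0 ≤ finToInt n i := by simp [finToInt_apply]

theorem finToInt_le {n : ℕ} (i : Fin n) : finToInt n i ≤ (n : ℤ) - 1 := by
  rw [finToInt_apply]; omega

theorem finToInt_zero (n : ℕ) [NeZero n] : finToInt n 0 = 0 := by simp [finToInt_apply]

/-- The path condition on labels in a tree on `Fin n` is the parent condition in the corresponding
tree on `[0, n - 1]`. -/
theorem isIntervalTree_map_iff {k n : ℕ} [NeZero n] (v : Fin n → ℕ) (H : SimpleGraph (Fin n)) :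
    IsIntervalTree (LabelOk k (wordLabel (List.ofFn v))) 0 0 (n - 1) (H.map (finToInt n)) ↔
      H.IsTree ∧ IsNoncrossing H ∧ ∀ i j : Fin n, i < j → H.Adj i j →
        (∃ p : H.Walk 0 j, p.IsPath ∧ i ∈ p.support) → v i + v j ≤ k + 1 := by
  constructor
  · intro h
    have hbridge : ∀ i j, H.Adj i j → ¬(H.deleteEdges {s(i, j)}).Reachable i j := fun i j hij => by
      rw [← reachable_map_deleteEdges_iff (finToInt n)]
      exact h.bridge _ _ (SimpleGraph.map_adj_apply.mpr hij)
    have hreach : ∀ i, H.Reachable 0 i := fun i => by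
      rw [← reachable_map_iff (finToInt n), finToInt_zero]
      exact h.reach _ (finToInt_nonneg i) (finToInt_le i)
    refine ⟨⟨⟨fun i j => (hreach i).symm.trans (hreach j)⟩, ?_⟩, ?_, ?_⟩
    · exact SimpleGraph.isAcyclic_iff_forall_adj_isBridge.mpr hbridge
    · rintro a b c d hac hcb hbd ⟨hab, hcd⟩
      exact h.noncrossing _ _ _ _ (finToInt_lt.mpr hac) (finToInt_lt.mpr hcb) (finToInt_lt.mpr hbd)
        (SimpleGraph.map_adj_apply.mpr hab) (SimpleGraph.map_adj_apply.mpr hcd)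
    · intro i j hij hadj hp
      rw [exists_isPath_mem_support_iff hadj (hbridge _ _ hadj),
        ← reachable_map_deleteEdges_iff (finToInt n), finToInt_zero] at hp
      have := h.parent _ _ (SimpleGraph.map_adj_apply.mpr hadj) hp (finToInt_lt.mpr hij)
      rwa [wordLabel_ofFn, wordLabel_ofFn] at this
  · rintro ⟨⟨⟨hpre⟩, hacyc⟩, hnc, hlab⟩
    have hbridge : ∀ i j, H.Adj i j → ¬(H.deleteEdges {s(i, j)}).Reachable i j := fun i j hij =>
      SimpleGraph.isAcyclic_iff_forall_adj_isBridge.mp hacyc hij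
    constructor
    · intro x y hxy
      obtain ⟨i, j, hij, rfl, rfl⟩ := (SimpleGraph.map_adj _ _ _ _).mp hxy
      exact ⟨finToInt_nonneg i, finToInt_le i⟩
    · intro x h1 h2
      obtain ⟨i, rfl⟩ := exists_finToInt h1 h2
      rw [← finToInt_zero n, reachable_map_iff]
      exact hpre 0 i
    · intro x y hxy
      obtain ⟨i, j, hij, rfl, rfl⟩ := (SimpleGraph.map_adj _ _ _ _).mp hxy
      rw [reachable_map_deleteEdges_iff]
      exact hbridge i j hij
    · intro x y z w h1 h2 h3 hxy hzw
      obtain ⟨a, b, hab, rfl, rfl⟩ := (SimpleGraph.map_adj _ _ _ _).mp hxy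
      obtain ⟨c, d, hcd, rfl, rfl⟩ := (SimpleGraph.map_adj _ _ _ _).mp hzw
      exact hnc a b c d (finToInt_lt.mp h1) (finToInt_lt.mp h2) (finToInt_lt.mp h3) ⟨hab, hcd⟩
    · intro x y hxy hr hlt
      obtain ⟨i, j, hij, rfl, rfl⟩ := (SimpleGraph.map_adj _ _ _ _).mp hxy
      rw [← finToInt_zero n, reachable_map_deleteEdges_iff,
        ← exists_isPath_mem_support_iff hij (hbridge _ _ hij)] at hr
      rw [wordLabel_ofFn, wordLabel_ofFn]
      exact hlab i j (finToInt_lt.mp hlt) hij hr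

/-- The number of `k`-noncrossing trees with given labels, in terms of trees on an interval. -/
theorem card_label_eq {k n : ℕ} [NeZero n] {v : Fin n → ℕ} (hv : ∀ i, v i ∈ Finset.Icc 1 k) :
    Nat.card {T : KNoncrossingTree k n // T.label = v} =
      treeCard (LabelOk k (wordLabel (List.ofFn v))) 0 0 (n - 1) := by
  refine Nat.card_congr (Equiv.ofBijective (fun T => ⟨T.1.graph.map (finToInt n),
    (isIntervalTree_map_iff v T.1.graph).mpr ⟨T.1.isTree, T.1.noncrossing, ?_⟩⟩) ⟨?_, ?_⟩)
  · obtain ⟨T, rfl⟩ := T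
    exact T.label_add_le
  · rintro ⟨S, hS⟩ ⟨T, hT⟩ h
    refine Subtype.ext (KNoncrossingTree.ext ?_ (hS.trans hT.symm))
    exact SimpleGraph.map_injective (finToInt n) (congrArg Subtype.val h)
  · rintro ⟨G, hG⟩
    have hmap : (G.comap (finToInt n)).map (finToInt n) = G := by
      refine le_antisymm (SimpleGraph.map_comap_le _ _) fun x y hxy => ?_
      have hx := hG.mem _ _ hxy
      have hy := hG.mem _ _ hxy.symm
      obtain ⟨i, rfl⟩ := exists_finToInt hx.1 hx.2
      obtain ⟨j, rfl⟩ := exists_finToInt hy.1 hy.2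
      exact SimpleGraph.map_adj_apply.mpr hxy
    have h := (isIntervalTree_map_iff v (G.comap (finToInt n))).mp (hmap ▸ hG)
    exact ⟨⟨⟨_, h.1, h.2.1, v, hv, h.2.2⟩, rfl⟩, Subtype.ext hmap⟩

theorem pre_rightCount_ofFn {k n : ℕ} [NeZero n] {v : Fin n → ℕ}
    (hv : ∀ i, v i ∈ Finset.Icc 1 k) (h : ℕ) :
    pre h (rightCount k h) (List.ofFn v) =
      if v 0 = h then (Nat.card {T : KNoncrossingTree k n // T.label = v} : ℚ) else 0 := by
  rw [card_label_eq hv]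
  obtain ⟨m, rfl⟩ := Nat.exists_eq_succ_of_ne_zero (NeZero.ne n)
  rw [List.ofFn_succ, pre]
  split_ifs with h0
  · rw [rightCount, List.length_ofFn, ← h0]
    push_cast
    rw [add_sub_cancel_right]
  · rfl

theorem ncard_eq_sum {k n : ℕ} [NeZero n] (D : Finset (Fin n → ℕ)) :
    {T : KNoncrossingTree k n | T.label ∈ D}.ncard =
      ∑ v ∈ D, Nat.card {T : KNoncrossingTree k n // T.label = v} := by
  classical
  have := Fintype.ofFinite (KNoncrossingTree k n)
  rw [Set.ncard_eq_toFinset_card', Finset.card_eq_sum_card_fiberwise (f := fun T => T.label)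
    (t := D)]
  · refine Finset.sum_congr rfl fun v hv => ?_
    rw [Nat.card_eq_fintype_card, Fintype.card_subtype]
    congr 1
    ext T
    simp only [Finset.mem_filter, Set.mem_toFinset, Set.mem_ofPred_eq, Finset.mem_univ, true_and]
    exact ⟨fun h => h.2, fun h => ⟨h ▸ hv, h⟩⟩
  · intro T hT
    simpa using hT

/-- The number of `k`-noncrossing trees with given root label and label counts is a coefficient of
a generating function. -/
theorem ncard_root_eq {k n : ℕ} [NeZero n] {h : ℕ} (hh : h ∈ Finset.Icc 1 k) (ℓ : ℕ → ℕ) :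
    ({T : KNoncrossingTree k n | T.label 0 = h ∧ T.HasLabelCounts ℓ}.ncard : ℚ) =
      monoCoeff n (labelVec k ℓ)
        (X * (C (MvPolynomial.X h) * wordSeries k (rightCount k h))) := by
  rw [← wordSeries_pre k hh, monoCoeff_wordSeries, Finset.sum_congr rfl fun v hv =>
    pre_rightCount_ofFn (mem_labelings.mp hv).1 h, ← Finset.sum_filter, ← Nat.cast_sum,
    ← ncard_eq_sum]
  congr 2
  ext T
  rw [Set.mem_ofPred_eq, Set.mem_ofPred_eq, Finset.mem_filter, mem_labelings]
  exact ⟨fun h => ⟨⟨T.label_mem, h.2⟩, h.1⟩, fun h => ⟨h.2, h.1.2⟩⟩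

/-- The number of `k`-noncrossing trees with given label counts is a coefficient of a generating
function. -/
theorem ncard_eq {k n : ℕ} [NeZero n] (ℓ : ℕ → ℕ) :
    ({T : KNoncrossingTree k n | T.HasLabelCounts ℓ}.ncard : ℚ) =
      monoCoeff n (labelVec k ℓ) (∑ h ∈ Finset.Icc 1 k,
        X * (C (MvPolynomial.X h) * wordSeries k (rightCount k h))) := by
  classical
  have := Fintype.ofFinite (KNoncrossingTree k n)
  rw [map_sum, Finset.sum_congr rfl fun h hh => (ncard_root_eq (n := n) hh ℓ).symm, ← Nat.cast_sum,
    Set.ncard_eq_toFinset_card', Finset.card_eq_sum_card_fiberwise (f := fun T => T.label 0)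
    (t := Finset.Icc 1 k) fun T _ => T.label_mem 0]
  congr 1
  refine Finset.sum_congr rfl fun h _ => ?_
  rw [Set.ncard_eq_toFinset_card']
  congr 1
  ext T
  simp [and_comm]

end KNoncrossing

theorem mainTheorem2 (k n : ℕ) [NeZero n] (hn : 1 < n) (ℓ : ℕ → ℕ)
    (hℓ : ∑ i ∈ Finset.Icc 1 k, ℓ i = n) :
    (∀ h ∈ Finset.Icc 1 k,
      (h ≤ (k + 1) / 2 →
        ({T : KNoncrossingTree k n | T.label 0 = h ∧ T.HasLabelCounts ℓ}.ncard : ℚ) =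
          (2 * ℓ h : ℚ) / ((2 * n - 1) * (4 * n - 3)) *
            (∏ r ∈ Finset.Icc 1 ((k + 1) / 2),
              ((3 * n - 2 - outerSum k ℓ (r - 1)).choose (ℓ r) : ℚ)) *
            (∏ r ∈ Finset.Icc 1 (h - 1),
              ((n - 2 + outerSum k ℓ r).choose (ℓ (k + 1 - r)) : ℚ)) *
            (∏ r ∈ Finset.Icc h (k / 2),
              ((n - 1 + outerSum k ℓ r).choose (ℓ (k + 1 - r)) : ℚ))
          - (ℓ h : ℚ) / ((4 * n - 3) * (3 * n - 2 - outerSum k ℓ (h - 1))) *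
            (∏ r ∈ Finset.Icc 1 (k / 2),
              ((n - 1 + outerSum k ℓ r).choose (ℓ (k + 1 - r)) : ℚ)) *
            (∏ r ∈ Finset.Icc 1 (h - 1),
              ((3 * n - 3 - outerSum k ℓ (r - 1)).choose (ℓ r) : ℚ)) *
            (∏ r ∈ Finset.Icc h ((k + 1) / 2),
              ((3 * n - 2 - outerSum k ℓ (r - 1)).choose (ℓ r) : ℚ))) ∧
      ((k + 1) / 2 < h →
        ({T : KNoncrossingTree k n | T.label 0 = h ∧ T.HasLabelCounts ℓ}.ncard : ℚ) =
          (ℓ h : ℚ) / ((n - 1) * (4 * n - 3)) *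
            (∏ r ∈ Finset.Icc 1 (k / 2),
              ((n - 2 + outerSum k ℓ r).choose (ℓ (k + 1 - r)) : ℚ)) *
            (∏ r ∈ Finset.Icc 1 (k + 1 - h),
              ((3 * n - 2 - outerSum k ℓ (r - 1)).choose (ℓ r) : ℚ)) *
            (∏ r ∈ Finset.Icc (k + 2 - h) ((k + 1) / 2),
              ((3 * n - 3 - outerSum k ℓ (r - 1)).choose (ℓ r) : ℚ))
          - (ℓ h : ℚ) / ((4 * n - 3) * (n - 1 + outerSum k ℓ (k + 1 - h))) *
            (∏ r ∈ Finset.Icc 1 ((k + 1) / 2),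
              ((3 * n - 3 - outerSum k ℓ (r - 1)).choose (ℓ r) : ℚ)) *
            (∏ r ∈ Finset.Icc 1 (k + 1 - h),
              ((n - 1 + outerSum k ℓ r).choose (ℓ (k + 1 - r)) : ℚ)) *
            (∏ r ∈ Finset.Icc (k + 2 - h) (k / 2),
              ((n - 2 + outerSum k ℓ r).choose (ℓ (k + 1 - r)) : ℚ)))) ∧
    ({T : KNoncrossingTree k n | T.HasLabelCounts ℓ}.ncard : ℚ) =
      1 / ((n : ℚ) - 1) *
        (∏ r ∈ Finset.Icc 1 ((k + 1) / 2),
          ((3 * n - 3 - outerSum k ℓ (r - 1)).choose (ℓ r) : ℚ)) *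
        (∏ r ∈ Finset.Icc 1 (k / 2),
          ((n - 2 + outerSum k ℓ r).choose (ℓ (k + 1 - r)) : ℚ))
      - 1 / (2 * (n : ℚ) - 1) *
        (∏ r ∈ Finset.Icc 1 ((k + 1) / 2),
          ((3 * n - 2 - outerSum k ℓ (r - 1)).choose (ℓ r) : ℚ)) *
        (∏ r ∈ Finset.Icc 1 (k / 2),
          ((n - 1 + outerSum k ℓ r).choose (ℓ (k + 1 - r)) : ℚ)) := by
  have hs := KNoncrossing.isTreeSystem_wordSeries k
  refine ⟨fun h hh => ⟨fun hle => ?_, fun hlt => ?_⟩, ?_⟩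
  · rw [KNoncrossing.ncard_root_eq hh]
    exact hs.monoCoeff_root_of_le hn hℓ hh hle
  · rw [KNoncrossing.ncard_root_eq hh]
    exact hs.monoCoeff_root_of_lt hn hℓ hh hlt
  · rw [KNoncrossing.ncard_eq]
    exact hs.monoCoeff_sum hn hℓ
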